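/- **Setting.** Let $P$ be a set of $n$ points moving continuously in the plane (over the time axis $\mathbb R$) so that any four points of $P$ are co-circular at most three times and any three points of $P$ are collinear at most twice. The motion is in general position: no two points ever coincide; no two events (a co-circularity of four points or a collinearity of three points) are simultaneous (in particular, no five points become co-circular and no four points become collinear); at each co-circularity each of the four points crosses the circle through the other three; at each collinearity each of the three points crosses the line through the other two. A pair $pq$ is an edge of the Delaunay triangulation $\mathrm{DT}(R)$ of $R\subseteq P$ at a given time if some circle through $p,q\in R$ has no point of $R$ in its interior. $N(m)$ denotes the maximum number of Delaunay co-circularities (events where four points lie on a circle with no point of the set in its interior) over all sets of $m$ points whose motion satisfies the above assumptions. $\beta(n)=\lambda_4(n)/n$, where $\lambda_s(n)$ is the maximum length of an $(n,s)$-Davenport–Schinzel sequence. **Delaunay crossings.** A Delaunay crossing is a triple $(pq,r,I=[t_0,t_1])$ with $p,q,r\in P$ and $t_0<t_1$ such that $pq$ leaves $\mathrm{DT}(P)$ at time $t_0$, returns at time $t_1$ and is not in $\mathrm{DT}(P)$ during $(t_0,t_1)$; $r$ hits the segment $pq$ during $I$ (possibly at $t_0$ or $t_1$); and $pq$ belongs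 to $\mathrm{DT}(P\setminus\{r\})$ throughout $I$. Only single crossings are considered, where $r$ hits $pq$ exactly once during $I$; $pq$ is oriented so that $r$ crosses it from the left to the right of the line directed from $p$ to $q$. Such a crossing is called a clockwise $(p,r)$-crossing and also a counterclockwise $(q,r)$-crossing. Fix an integer constant $0\le c_0<8$. An edge is almost Delaunay during an interval if some set $A$ of at most $c_0$ points of $P$ exists such that the edge belongs to $\mathrm{DT}(P\setminus A)$ throughout that interval. A crossing $(pq,r,I)$ is $(p,r,k)$-chargeable if there is an interval $\mathcal I=[\alpha_0,\alpha_1]\supseteq I$ such that $pr$ is Delaunay (in $\mathrm{DT}(P)$) at times $\alpha_0$ and $\alpha_1$ and almost Delaunay during the rest of $\mathcal I$, and at least $k$ counterclockwise $(q,r)$-crossings $(uq,r,I_u)$ satisfy $I_u\subseteq\mathcal I$. It is $(q,r,k)$-chargeable if there is such an interval $\mathcal I$ for the edge $qr$ in place of $pr$, and at least $k$ clockwise $(p,r)$-crossings $(pu,r,I_u)$ satisfy $I_u\subseteq\mathcal I$. **Theorem.** There are constants $C$ and $k_0$ (absolute, once $c_0$ is fixed) such that for every integer $k>12$ with $k\ge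 k_0$, every $n$, and every set $P$ of $n$ moving points as above, the number of (single) Delaunay crossings $(pq,r,I)$ that are $(p,r,k)$-chargeable or $(q,r,k)$-chargeable is finite and at most $$C\left(k^2N(\lfloor n/k\rfloor)+kn^2\beta(n)\right).$$ -/

import Mathlib

open Set Filter Topology

/-- The Euclidean plane. -/
abbrev Plane : Type := EuclideanSpace ℝ (Fin 2)

/-- Twice the signed area of the triangle `abc`. For `p ≠ q`, the point `r` lies in the open
halfplane to the left of the line `pq` (oriented from `p` to `q`) iff `0 < orient p q r`, and in
the open halfplane to its right iff `orient p q r < 0`. -/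
noncomputable def orient (a b c : Plane) : ℝ :=
  (b 0 - a 0) * (c 1 - a 1) - (b 1 - a 1) * (c 0 - a 0)

/-- The points of `s` are four points that are co-circular at time `t`. -/
def CocircularAt {n : ℕ} (x : Fin n → ℝ → Plane) (s : Finset (Fin n)) (t : ℝ) : Prop :=
  s.card = 4 ∧ EuclideanGeometry.Cospherical ((fun i => x i t) '' (s : Set (Fin n)))

/-- The points of `s` are three points that are collinear at time `t`. -/
def CollinearAt {n : ℕ} (x : Fin n → ℝ → Plane) (s : Finset (Fin n)) (t : ℝ) : Prop :=
  s.card = 3 ∧ Collinear ℝ ((fun i => x i t) '' (s : Set (Fin n)))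

/-- At time `t` the point `a` lies strictly inside the circle through the points of `u`. -/
def InsideCircleAt {n : ℕ} (x : Fin n → ℝ → Plane) (u : Finset (Fin n)) (a : Fin n) (t : ℝ) :
    Prop :=
  ∃ (c : Plane) (ρ : ℝ), (∀ b ∈ u, dist (x b t) c = ρ) ∧ dist (x a t) c < ρ

/-- At time `t` the point `a` lies strictly outside the circle through the points of `u`. -/
def OutsideCircleAt {n : ℕ} (x : Fin n → ℝ → Plane) (u : Finset (Fin n)) (a : Fin n) (t : ℝ) :
    Prop :=
  ∃ (c : Plane) (ρ : ℝ), (∀ b ∈ u, dist (x b t) c = ρ) ∧ ρ < dist (x a t) c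

/-- At time `t` the point `r` crosses the line through `p` and `q` (oriented from `p` to `q`)
from its left side to its right side. -/
def CrossesLeftToRight {n : ℕ} (x : Fin n → ℝ → Plane) (p q r : Fin n) (t : ℝ) : Prop :=
  (∀ᶠ τ in 𝓝[<] t, 0 < orient (x p τ) (x q τ) (x r τ)) ∧
  orient (x p t) (x q t) (x r t) = 0 ∧
  (∀ᶠ τ in 𝓝[>] t, orient (x p τ) (x q τ) (x r τ) < 0)

/-- The admissible motions of `n` points in the plane (with time axis `ℝ`): continuous motions
in which every four points are co-circular at most three times and every three points are
collinear at most twice, and which are in general position. (That no five points become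
co-circular and no four points become collinear is contained in `no_simultaneous`.) -/
structure IsAdmissibleMotion {n : ℕ} (x : Fin n → ℝ → Plane) : Prop where
  continuous : ∀ i, Continuous (x i)
  cocircular_le_three : ∀ s : Finset (Fin n), s.card = 4 → {t | CocircularAt x s t}.encard ≤ 3
  collinear_le_two : ∀ s : Finset (Fin n), s.card = 3 → {t | CollinearAt x s t}.encard ≤ 2
  /-- no two points coincide -/
  no_coincidence : ∀ i j, i ≠ j → ∀ t, x i t ≠ x j t
  /-- no two events (co-circularities of four points or collinearities of three points) are
  simultaneous -/
  no_simultaneous : ∀ (t : ℝ) (s s' : Finset (Fin n)),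
    (CocircularAt x s t ∨ CollinearAt x s t) → (CocircularAt x s' t ∨ CollinearAt x s' t) → s = s'
  /-- at a co-circularity, each of the four points crosses the circle through the other three -/
  cocircular_crossing : ∀ (t : ℝ) (s : Finset (Fin n)), CocircularAt x s t → ∀ a ∈ s,
    ((∀ᶠ τ in 𝓝[<] t, OutsideCircleAt x (s.erase a) a τ) ∧
      (∀ᶠ τ in 𝓝[>] t, InsideCircleAt x (s.erase a) a τ)) ∨
    ((∀ᶠ τ in 𝓝[<] t, InsideCircleAt x (s.erase a) a τ) ∧
      (∀ᶠ τ in 𝓝[>] t, OutsideCircleAt x (s.erase a) a τ))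
  /-- at a collinearity, each of the three points crosses the line through the other two -/
  collinear_crossing : ∀ (t : ℝ) (p q r : Fin n), CollinearAt x {p, q, r} t →
    CrossesLeftToRight x p q r t ∨ CrossesLeftToRight x q p r t

/-- `pq` is an edge of the Delaunay triangulation of the points of `R` at time `t`: some circle
through `p` and `q` has no point of `R` in its interior. -/
def DelaunayAt {n : ℕ} (x : Fin n → ℝ → Plane) (R : Finset (Fin n)) (p q : Fin n) (t : ℝ) :
    Prop :=
  p ∈ R ∧ q ∈ R ∧ p ≠ q ∧ ∃ (c : Plane) (ρ : ℝ),
    dist (x p t) c = ρ ∧ dist (x q t) c = ρ ∧ ∀ z ∈ R, ρ ≤ dist (x z t) c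

/-- The set `s` of four points has a Delaunay co-circularity at time `t`: the points of `s` lie
on a circle which has no point of the whole set in its interior. -/
def DelaunayCocircularAt {n : ℕ} (x : Fin n → ℝ → Plane) (s : Finset (Fin n)) (t : ℝ) : Prop :=
  s.card = 4 ∧ ∃ (c : Plane) (ρ : ℝ),
    (∀ i ∈ s, dist (x i t) c = ρ) ∧ ∀ z, ρ ≤ dist (x z t) c

/-- `N(n)`: the maximum number of Delaunay co-circularities of an admissible motion of `n` points.
(This number is at most `3 * n.choose 4` for every admissible motion.) -/
noncomputable def maxDelaunayCocircularities (n : ℕ) : ℕ :=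
  sSup {m : ℕ | ∃ x : Fin n → ℝ → Plane, IsAdmissibleMotion x ∧
    m = {e : Finset (Fin n) × ℝ | DelaunayCocircularAt x e.1 e.2}.ncard}

/-- The alternating word `a b a b ⋯` of length `m`. -/
def alternatingWord {α : Type*} (a b : α) (m : ℕ) : List α :=
  (List.range m).map fun i => if i % 2 = 0 then a else b

/-- `w` is an `(n, s)`-Davenport–Schinzel sequence: a word over `n` symbols without equal adjacent
letters and without alternating subsequences `a b a b ⋯` (`a ≠ b`) of length `s + 2`. -/
def IsDavenportSchinzel (n s : ℕ) (w : List (Fin n)) : Prop :=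
  w.IsChain (· ≠ ·) ∧ ∀ a b : Fin n, a ≠ b → ¬ (alternatingWord a b (s + 2)).Sublist w

/-- `λ_s(n)`: the maximum length of an `(n, s)`-Davenport–Schinzel sequence. -/
noncomputable def davenportSchinzel (s n : ℕ) : ℕ :=
  sSup {m : ℕ | ∃ w : List (Fin n), IsDavenportSchinzel n s w ∧ m = w.length}

/-- `β(n) = λ_4(n) / n`, that is, `λ_{s+2}(n) / n`, where `s = 2` bounds the number of
collinearities of a triple of points. -/
noncomputable def betaDS (n : ℕ) : ℝ := (davenportSchinzel 4 n : ℝ) / n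

/-- At time `t` the point `r` lies on the segment `pq`. -/
def HitsAt {n : ℕ} (x : Fin n → ℝ → Plane) (p q r : Fin n) (t : ℝ) : Prop :=
  x r t ∈ segment ℝ (x p t) (x q t)

/-- `(pq, r, [t₀, t₁])` is a Delaunay crossing: `pq` leaves the Delaunay triangulation at time
`t₀`, is absent from it during `(t₀, t₁)` and returns at time `t₁`; `r` hits `pq` during
`[t₀, t₁]`; and `pq` is Delaunay throughout `[t₀, t₁]` once `r` is removed. (Leaving and returning
are expressed through the times right before `t₀` and right after `t₁`, since `r` may also hit
`pq` at time `t₀` or `t₁`, when `pq` is an edge of the convex hull of the points right before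
`t₀` or right after `t₁`.) -/
structure IsDelaunayCrossing {n : ℕ} (x : Fin n → ℝ → Plane) (p q r : Fin n) (t₀ t₁ : ℝ) :
    Prop where
  lt : t₀ < t₁
  leaves : ∀ᶠ t in 𝓝[<] t₀, DelaunayAt x Finset.univ p q t
  absent : ∀ t ∈ Ioo t₀ t₁, ¬ DelaunayAt x Finset.univ p q t
  returns : ∀ᶠ t in 𝓝[>] t₁, DelaunayAt x Finset.univ p q t
  hits : ∃ t ∈ Icc t₀ t₁, HitsAt x p q r t
  delaunay_without : ∀ t ∈ Icc t₀ t₁, DelaunayAt x (Finset.univ.erase r) p q t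

/-- `(pq, r, [t₀, t₁])` is a single Delaunay crossing, with the orientation convention: `r` hits
`pq` exactly once during `[t₀, t₁]`, and it then crosses from the left side of the line `pq`
to its right side. Such a crossing is called a clockwise `(p, r)`-crossing, and
also a counterclockwise `(q, r)`-crossing. -/
def IsSingleCrossing {n : ℕ} (x : Fin n → ℝ → Plane) (p q r : Fin n) (t₀ t₁ : ℝ) : Prop :=
  IsDelaunayCrossing x p q r t₀ t₁ ∧
  ∃ t ∈ Icc t₀ t₁, HitsAt x p q r t ∧ CrossesLeftToRight x p q r t ∧
    ∀ t' ∈ Icc t₀ t₁, HitsAt x p q r t' → t' = t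

/-- The edge `pq` is almost Delaunay during `J`: at most `c₀` points can be removed so that `pq`
is Delaunay throughout `J`. -/
def AlmostDelaunayOn {n : ℕ} (x : Fin n → ℝ → Plane) (c₀ : ℕ) (p q : Fin n) (J : Set ℝ) : Prop :=
  ∃ A : Finset (Fin n), A.card ≤ c₀ ∧ ∀ t ∈ J, DelaunayAt x (Finset.univ \ A) p q t

/-- The single Delaunay crossing `(pq, r, [t₀, t₁])` is `(p, r, k)`-chargeable: on some interval
`[α₀, α₁]` containing `[t₀, t₁]` the edge `pr` is almost Delaunay, and Delaunay at
the endpoints, and at least `k` counterclockwise `(q, r)`-crossings occur within `[α₀, α₁]`. -/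
def IsFirstChargeable {n : ℕ} (x : Fin n → ℝ → Plane) (c₀ k : ℕ) (p q r : Fin n) (t₀ t₁ : ℝ) :
    Prop :=
  IsSingleCrossing x p q r t₀ t₁ ∧ ∃ α₀ α₁ : ℝ, α₀ ≤ t₀ ∧ t₁ ≤ α₁ ∧
    DelaunayAt x Finset.univ p r α₀ ∧ DelaunayAt x Finset.univ p r α₁ ∧
    AlmostDelaunayOn x c₀ p r (Ioo α₀ α₁) ∧
    k ≤ {u : Fin n | ∃ s₀ s₁ : ℝ, IsSingleCrossing x u q r s₀ s₁ ∧
      Icc s₀ s₁ ⊆ Icc α₀ α₁}.ncard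

/-- The single Delaunay crossing `(pq, r, [t₀, t₁])` is `(q, r, k)`-chargeable: on some interval
`[α₀, α₁]` containing `[t₀, t₁]` the edge `qr` is almost Delaunay, and Delaunay at
the endpoints, and at least `k` clockwise `(p, r)`-crossings occur within `[α₀, α₁]`. -/
def IsSecondChargeable {n : ℕ} (x : Fin n → ℝ → Plane) (c₀ k : ℕ) (p q r : Fin n) (t₀ t₁ : ℝ) :
    Prop :=
  IsSingleCrossing x p q r t₀ t₁ ∧ ∃ α₀ α₁ : ℝ, α₀ ≤ t₀ ∧ t₁ ≤ α₁ ∧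
    DelaunayAt x Finset.univ q r α₀ ∧ DelaunayAt x Finset.univ q r α₁ ∧
    AlmostDelaunayOn x c₀ q r (Ioo α₀ α₁) ∧
    k ≤ {u : Fin n | ∃ s₀ s₁ : ℝ, IsSingleCrossing x p u r s₀ s₁ ∧
      Icc s₀ s₁ ⊆ Icc α₀ α₁}.ncard

/-- All Delaunay crossings `(pq, r, [t₀, t₁])` that are `(p, r, k)`-chargeable or
`(q, r, k)`-chargeable, as tuples `(p, q, r, t₀, t₁)`. -/
def chargeableCrossings {n : ℕ} (x : Fin n → ℝ → Plane) (c₀ k : ℕ) :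
    Set (Fin n × Fin n × Fin n × ℝ × ℝ) :=
  {c | IsFirstChargeable x c₀ k c.1 c.2.1 c.2.2.1 c.2.2.2.1 c.2.2.2.2 ∨
    IsSecondChargeable x c₀ k c.1 c.2.1 c.2.2.1 c.2.2.2.1 c.2.2.2.2}

/-! The proof is a random sampling argument in the manner of Clarkson and Shor. Reflection exchanges
the two kinds of chargeability, and reflection with time reversal exchanges the crossings before and
after the given one. So it suffices to count long events: crossings of `pq` by `r` such that `pr`
stays almost Delaunay over an interval that also contains `l = k / 4` earlier crossings of edges
`uq` by `r`. Let `L` be the set of the `l` latest such points `u`, and `A` the set of at most 7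
points whose removal keeps `pr` Delaunay.

The basic geometric fact is `Crosser.exclusion`. Throughout a crossing of `zq` by `r`, both `z` and
`q` are Delaunay neighbours of `r`. The incircle determinant of `r`, `z`, `q` and any third point
`p` changes sign during the crossing, while three points that remain mutual neighbours of `r` never
become co-circular with `r`. Hence no third point is a neighbour of `r` all along, even among fewer
points, as long as `z` and `q` are kept.

Take a random sample `R` of `m = n / k` points. With probability at least of order `1 / k` it
contains `r` and exactly three points of `L`, and avoids `p`, `q` and `A` (`choose_le_mul_pattern`):
there are about `k ^ 3` triples, and each is caught together with `r` with probability about `k ^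
(-4)`. Let `u` be the crosser in `R` that is hit second. By `ChargedEvent.classify` one of four
things happens during the event: a Delaunay triangle at `rp` changes when `p` replaces a sample
point; a triangle of `R` at `ru` changes; `q` passes between `r` and `u` while `ru` is Delaunay in
`R`; or the triangles at `ru` persist and `q` settles on the far side of `u` or in their circles.
The last case uses up all three co-circularities of `r`, `u`, `q` and the third vertex `v` of such a
triangle, so that `q` can never leave again.

Each case is rare. A change of a triangle is a Delaunay co-circularity of the sample, or one of
`O(m²)` swaps on its convex hull, and exclusion lets only `O(l)` events share it. Two independent
events that settle at the same edge `ru` are separated by a change there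
(`ChargedEvent.Settles.absurd`). Passing under `u` is counted by adding `q` to the sample
(`card_passesUnder_le`). Summed over `r`, a sample sees `O(k N(m) + k m² + k m n)` events on
average. Multiplying by `k` gives `O(k² N(m) + k n²)`. The factor `betaDS n` enters only through `1
≤ betaDS n`. -/

/-! ### Davenport–Schinzel sequences: a lower bound for `betaDS`. -/

theorem alternatingWord_succ_succ {α : Type*} (a b : α) (m : ℕ) :
    alternatingWord a b (m + 2) = a :: b :: alternatingWord a b m := by
  unfold alternatingWord
  rw [List.range_succ_eq_map, List.range_succ_eq_map]
  have h : ∀ i, (i + 1 + 1) % 2 = i % 2 := fun i => by omega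
  simp [Function.comp_def, h]

theorem alternatingWord_sublist_of_le {α : Type*} (a b : α) {m m' : ℕ} (h : m ≤ m') :
    (alternatingWord a b m).Sublist (alternatingWord a b m') := by
  unfold alternatingWord
  exact (List.range_sublist.mpr h).map _

/-- Every occurrence of the adjacent pair `a b` contributes a period of an alternation. -/
theorem alternatingWord_count_sublist {α : Type*} [BEq α] [LawfulBEq α] {a b : α} (hab : a ≠ b) :
    ∀ w : List α, (alternatingWord a b (2 * (w.zip w.tail).count (a, b))).Sublist w
  | [] => by simp [alternatingWord]
  | [x] => by simp [alternatingWord]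
  | x :: y :: t => by
    by_cases h : x = a ∧ y = b
    · obtain ⟨rfl, rfl⟩ := h
      have ih := alternatingWord_count_sublist hab t
      have hc : (((x :: y :: t).zip (x :: y :: t).tail).count (x, y))
          = (t.zip t.tail).count (x, y) + 1 := by
        cases t with
        | nil => simp
        | cons z t => simp [Ne.symm hab]
      rw [hc, Nat.mul_add, alternatingWord_succ_succ]
      exact (ih.cons_cons y).cons_cons x
    · have ih := alternatingWord_count_sublist hab (y :: t)
      have hc : (((x :: y :: t).zip (x :: y :: t).tail).count (a, b))
          = ((y :: t).zip (y :: t).tail).count (a, b) := by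
        simp only [List.tail_cons, List.zip_cons_cons]
        rw [List.count_cons_of_ne]
        intro h'
        exact h ⟨congrArg Prod.fst h', congrArg Prod.snd h'⟩
      rw [hc]
      exact ih.cons x

/-- Each ordered pair of letters is adjacent at most `s + 2` times. Any finite bound would do: it
keeps the supremum `davenportSchinzel` from taking its default value 0. -/
theorem IsDavenportSchinzel.length_le {n s : ℕ} {w : List (Fin n)}
    (h : IsDavenportSchinzel n s w) : w.length ≤ n * n * (s + 2) + 1 := by
  have hne : ∀ e ∈ w.zip w.tail, e.1 ≠ e.2 := by
    have := h.1
    clear h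
    induction w with
    | nil => simp
    | cons x t ih =>
      cases t with
      | nil => simp
      | cons y t =>
        rw [List.isChain_cons_cons] at this
        intro e he
        simp only [List.tail_cons, List.zip_cons_cons, List.mem_cons] at he
        rcases he with rfl | he
        · exact this.1
        · exact ih this.2 e he
  have hlen : (w.zip w.tail).length = w.length - 1 := by simp
  have hsum : (w.zip w.tail).length = ∑ e : Fin n × Fin n, (w.zip w.tail).count e := by
    have := Multiset.sum_count_eq_card (s := Finset.univ) (m := ((w.zip w.tail : List (Fin n × Fin n)) : Multiset (Fin n × Fin n)))
      (fun a _ => Finset.mem_univ a)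
    have e : (instBEqProd : BEq (Fin n × Fin n)) = instBEqOfDecidableEq :=
      lawful_beq_subsingleton _ _
    rw [e]
    simpa using this.symm
  have hle : ∀ e : Fin n × Fin n, (w.zip w.tail).count e ≤ s + 2 := by
    rintro ⟨a, b⟩
    by_cases hm : (a, b) ∈ w.zip w.tail
    · by_contra hlt
      have hlt' : s + 2 < (w.zip w.tail).count (a, b) := not_le.mp hlt
      refine h.2 a b (hne _ hm) ?_
      exact (alternatingWord_sublist_of_le a b
        (show s + 2 ≤ 2 * (w.zip w.tail).count (a, b) by omega)).trans
        (alternatingWord_count_sublist (hne _ hm) w)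
    · simp [List.count_eq_zero_of_not_mem hm]
  have := Finset.sum_le_sum (fun e (_ : e ∈ (Finset.univ : Finset (Fin n × Fin n))) => hle e)
  simp at this
  rw [← hsum, hlen] at this
  omega

/-- The witness is the word in which every letter occurs once. An alternation of length at least 3
repeats a letter, hence `1 ≤ s`. -/
theorem le_davenportSchinzel (s n : ℕ) (hs : 1 ≤ s) : n ≤ davenportSchinzel s n := by
  refine le_csSup ⟨n * n * (s + 2) + 1, ?_⟩ ⟨List.finRange n, ⟨?_, ?_⟩, by simp⟩
  · rintro m ⟨w, hw, rfl⟩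
    exact hw.length_le
  · exact (List.nodup_finRange n).isChain
  · intro a b _ hsub
    have hn := hsub.nodup (List.nodup_finRange n)
    have h3 := (alternatingWord_sublist_of_le a b (show 3 ≤ s + 2 by omega)).nodup hn
    simp [alternatingWord, List.range_succ] at h3

theorem one_le_betaDS {n : ℕ} (hn : 0 < n) : 1 ≤ betaDS n := by
  unfold betaDS
  rw [le_div_iff₀ (by positivity), one_mul]
  exact_mod_cast le_davenportSchinzel 4 n (by norm_num)

/-! ### Coordinates relative to `r`, orientations and the incircle determinant. -/

theorem continuous_orient {n : ℕ} {x : Fin n → ℝ → Plane} (hx : ∀ i, Continuous (x i))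
    (p q r : Fin n) : Continuous fun t => orient (x p t) (x q t) (x r t) := by
  have h : ∀ i j, Continuous fun t => (x i t) j := fun i j =>
    (EuclideanSpace.proj (𝕜 := ℝ) j).continuous.comp (hx i)
  unfold orient
  have h0 := fun i => h i 0
  have h1 := fun i => h i 1
  fun_prop

theorem collinear_of_orient_eq_zero {a b c : Plane} (hab : a ≠ b) (h : orient a b c = 0) :
    Collinear ℝ ({a, b, c} : Set Plane) := by
  rw [collinear_iff_of_mem (p₀ := a) (by simp)]
  refine ⟨b - a, ?_⟩
  unfold orient at h
  have hne : (b 0 - a 0) ≠ 0 ∨ (b 1 - a 1) ≠ 0 := by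
    by_contra hh
    push Not at hh
    exact hab (by ext i; fin_cases i <;> simp <;> linarith [hh.1, hh.2])
  rintro y (rfl | rfl | rfl)
  · exact ⟨0, by simp⟩
  · exact ⟨1, by simp⟩
  · rcases hne with h0 | h1
    · refine ⟨(y 0 - a 0) / (b 0 - a 0), ?_⟩
      ext i
      fin_cases i
      · simp; field_simp; ring
      · simp; field_simp; linarith
    · refine ⟨(y 1 - a 1) / (b 1 - a 1), ?_⟩
      ext i
      fin_cases i
      · simp; field_simp; linarith
      · simp; field_simp; ring

/-- First coordinate of `a` relative to `r`. -/
noncomputable def relX {n : ℕ} (x : Fin n → ℝ → Plane) (r a : Fin n) (t : ℝ) : ℝ :=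
  x a t 0 - x r t 0

/-- Second coordinate of `a` relative to `r`. -/
noncomputable def relY {n : ℕ} (x : Fin n → ℝ → Plane) (r a : Fin n) (t : ℝ) : ℝ :=
  x a t 1 - x r t 1

/-- The orientation of `a`, `b` seen from `r`. -/
noncomputable def oo {n : ℕ} (x : Fin n → ℝ → Plane) (r a b : Fin n) (t : ℝ) : ℝ :=
  relX x r a t * relY x r b t - relY x r a t * relX x r b t

/-- The squared distance from `r` to `a`. -/
noncomputable def nn {n : ℕ} (x : Fin n → ℝ → Plane) (r a : Fin n) (t : ℝ) : ℝ :=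
  relX x r a t ^ 2 + relY x r a t ^ 2

/-- The incircle determinant of `r`, `a`, `b`, `c`. -/
noncomputable def DD {n : ℕ} (x : Fin n → ℝ → Plane) (r a b c : Fin n) (t : ℝ) : ℝ :=
  oo x r a b t * nn x r c t + oo x r b c t * nn x r a t + oo x r c a t * nn x r b t

/-- Seen from `r`, the position vector of `b` is `l` times that of `a`. -/
def Ratio {n : ℕ} (x : Fin n → ℝ → Plane) (r a b : Fin n) (t l : ℝ) : Prop :=
  relX x r b t = l * relX x r a t ∧ relY x r b t = l * relY x r a t

/-- The point `q` lies in the open segment between `r` and `p`. -/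
def Under {n : ℕ} (x : Fin n → ℝ → Plane) (r q p : Fin n) (t : ℝ) : Prop :=
  ∃ l, 0 < l ∧ l < 1 ∧ Ratio x r p q t l

section algebra
variable {n : ℕ} {x : Fin n → ℝ → Plane} {r a b c d : Fin n} {t l : ℝ}

theorem orient_eq_oo : orient (x r t) (x a t) (x b t) = oo x r a b t := rfl

theorem oo_swap (a b : Fin n) : oo x r b a t = -oo x r a b t := by unfold oo; ring

theorem DD_cycle (a b c : Fin n) : DD x r b c a t = DD x r a b c t := by unfold DD; ring

theorem DD_swap (a b c : Fin n) : DD x r b a c t = -DD x r a b c t := by unfold DD oo; ring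

theorem DD_swap' (a b c : Fin n) : DD x r a c b t = -DD x r a b c t := by unfold DD oo; ring

theorem nn_nonneg : 0 ≤ nn x r a t := by unfold nn; positivity

theorem oo_plucker (a b c d : Fin n) :
    oo x r a c t * oo x r b d t = oo x r a b t * oo x r c d t + oo x r a d t * oo x r b c t := by
  unfold oo; ring

theorem Ratio.oo_right (h : Ratio x r a b t l) (c : Fin n) : oo x r c b t = l * oo x r c a t := by
  unfold oo; rw [h.1, h.2]; ring

theorem Ratio.oo_left (h : Ratio x r a b t l) (c : Fin n) : oo x r b c t = l * oo x r a c t := by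
  unfold oo; rw [h.1, h.2]; ring

theorem Ratio.oo_self (h : Ratio x r a b t l) : oo x r a b t = 0 := by
  unfold oo; rw [h.1, h.2]; ring

theorem Ratio.nn_eq (h : Ratio x r a b t l) : nn x r b t = l ^ 2 * nn x r a t := by
  unfold nn; rw [h.1, h.2]; ring

/-- The factor `l * (l - 1)` is negative exactly when `b` lies strictly between `r` and `a`. At an
alignment the sign of the determinant is thus decided by the side of `c` and by whether `b` is under
`a`. -/
theorem Ratio.DD_eq (h : Ratio x r a b t l) (c : Fin n) :
    DD x r a c b t = oo x r a c t * nn x r a t * (l * (l - 1)) := by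
  have h0 : oo x r a a t = 0 := by unfold oo; ring
  unfold DD; rw [h.nn_eq, h.oo_left, h.oo_right, oo_swap a c, h0]; ring

theorem Ratio.symm (h : Ratio x r a b t l) (hl : l ≠ 0) : Ratio x r b a t l⁻¹ := by
  constructor
  · rw [h.1]; field_simp
  · rw [h.2]; field_simp

/-- Expansion of the incircle determinant by a quadratic function. -/
theorem DD_expand (y₀ y₁ h : ℝ) (a b c : Fin n) :
    DD x r a b c t = oo x r a b t * (nn x r c t - y₀ * relX x r c t - y₁ * relY x r c t - h)
      + oo x r b c t * (nn x r a t - y₀ * relX x r a t - y₁ * relY x r a t - h)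
      + oo x r c a t * (nn x r b t - y₀ * relX x r b t - y₁ * relY x r b t - h)
      + h * orient (x a t) (x b t) (x c t) := by
  have e : orient (x a t) (x b t) (x c t)
      = oo x r a b t + oo x r b c t + oo x r c a t := by
    unfold oo relX relY orient; ring
  rw [e]
  unfold DD oo; ring

theorem dist_sq_eq (r a : Fin n) (t : ℝ) (c : Plane) :
    dist (x a t) c ^ 2 = nn x r a t - 2 * (c 0 - x r t 0) * relX x r a t
      - 2 * (c 1 - x r t 1) * relY x r a t
      + ((c 0 - x r t 0) ^ 2 + (c 1 - x r t 1) ^ 2) := by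
  rw [EuclideanSpace.dist_eq, Real.sq_sqrt (by positivity)]
  simp only [Fin.sum_univ_two, Real.dist_eq, sq_abs]
  unfold nn relX relY; ring

/-- The expression is the power of `w` with respect to the circle centred at `r + (y₀, y₁) / 2`. The
point `r` itself has power `-h`, so `0 < h` means that `r` is inside, and `h = 0` that the circle
passes through `r`. -/
theorem delaunayAt_iff (r : Fin n) {X : Finset (Fin n)} {p q : Fin n} :
    DelaunayAt x X p q t ↔ p ∈ X ∧ q ∈ X ∧ p ≠ q ∧ ∃ y₀ y₁ h : ℝ,
      nn x r p t - y₀ * relX x r p t - y₁ * relY x r p t - h = 0 ∧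
      nn x r q t - y₀ * relX x r q t - y₁ * relY x r q t - h = 0 ∧
      ∀ w ∈ X, 0 ≤ nn x r w t - y₀ * relX x r w t - y₁ * relY x r w t - h := by
  constructor
  · rintro ⟨hp, hq, hpq, c, ρ, h1, h2, h3⟩
    refine ⟨hp, hq, hpq, 2 * (c 0 - x r t 0), 2 * (c 1 - x r t 1),
      ρ ^ 2 - ((c 0 - x r t 0) ^ 2 + (c 1 - x r t 1) ^ 2), ?_, ?_, fun w hw => ?_⟩
    · have := dist_sq_eq (x := x) r p t c
      rw [h1] at this; linarith
    · have := dist_sq_eq (x := x) r q t c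
      rw [h2] at this; linarith
    · have := dist_sq_eq (x := x) r w t c
      have hρ : 0 ≤ ρ := h1 ▸ dist_nonneg
      have h4 : ρ ^ 2 ≤ dist (x w t) c ^ 2 := by
        have := h3 w hw
        gcongr
      linarith
  · rintro ⟨hp, hq, hpq, y₀, y₁, h, h1, h2, h3⟩
    let c : Plane := !₂[x r t 0 + y₀ / 2, x r t 1 + y₁ / 2]
    have hc0 : c 0 - x r t 0 = y₀ / 2 := by simp [c]
    have hc1 : c 1 - x r t 1 = y₁ / 2 := by simp [c]
    refine ⟨hp, hq, hpq, c, dist (x p t) c, rfl, ?_, fun w hw => ?_⟩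
    · have e1 := dist_sq_eq (x := x) r p t c
      have e2 := dist_sq_eq (x := x) r q t c
      rw [hc0, hc1] at e1 e2
      exact (pow_left_inj₀ dist_nonneg dist_nonneg two_ne_zero).mp (by linarith)
    · have e1 := dist_sq_eq (x := x) r p t c
      have e2 := dist_sq_eq (x := x) r w t c
      have := h3 w hw
      rw [hc0, hc1] at e1 e2
      exact (pow_le_pow_iff_left₀ dist_nonneg dist_nonneg two_ne_zero).mp (by linarith)

theorem nn_self : nn x r r t = 0 := by simp [nn, relX, relY]

theorem relX_self : relX x r r t = 0 := by simp [relX]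

theorem relY_self : relY x r r t = 0 := by simp [relY]

theorem delaunayAt_iff_slack {X : Finset (Fin n)} {z : Fin n} :
    DelaunayAt x X z r t ↔ z ∈ X ∧ r ∈ X ∧ z ≠ r ∧ ∃ y₀ y₁ : ℝ,
      nn x r z t - y₀ * relX x r z t - y₁ * relY x r z t = 0 ∧
      ∀ w ∈ X, 0 ≤ nn x r w t - y₀ * relX x r w t - y₁ * relY x r w t := by
  rw [delaunayAt_iff r]
  constructor
  · rintro ⟨h1, h2, h3, y₀, y₁, h, h4, h5, h6⟩
    rw [nn_self, relX_self, relY_self] at h5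
    have : h = 0 := by linarith
    subst this
    exact ⟨h1, h2, h3, y₀, y₁, by linarith, fun w hw => by linarith [h6 w hw]⟩
  · rintro ⟨h1, h2, h3, y₀, y₁, h4, h6⟩
    refine ⟨h1, h2, h3, y₀, y₁, 0, by linarith, ?_, fun w hw => by linarith [h6 w hw]⟩
    rw [nn_self, relX_self, relY_self]; ring

theorem DelaunayAt.symm {X : Finset (Fin n)} {p q : Fin n} (h : DelaunayAt x X p q t) :
    DelaunayAt x X q p t := by
  obtain ⟨h1, h2, h3, c, ρ, h4, h5, h6⟩ := h
  exact ⟨h2, h1, h3.symm, c, ρ, h5, h4, h6⟩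

theorem DelaunayAt.mono {X Y : Finset (Fin n)} {p q : Fin n} (h : DelaunayAt x X p q t)
    (hY : Y ⊆ X) (hp : p ∈ Y) (hq : q ∈ Y) : DelaunayAt x Y p q t := by
  obtain ⟨h1, h2, h3, c, ρ, h4, h5, h6⟩ := h
  exact ⟨hp, hq, h3, c, ρ, h4, h5, fun z hz => h6 z (hY hz)⟩

/-- A Delaunay neighbour of `r` that lies angularly between two points. -/
theorem DelaunayAt.DD_nonneg {X : Finset (Fin n)} {z w₁ w₂ : Fin n} (h : DelaunayAt x X z r t)
    (h₁ : w₁ ∈ X) (h₂ : w₂ ∈ X) (h1 : 0 ≤ oo x r w₁ z t) (h2 : 0 ≤ oo x r z w₂ t) :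
    0 ≤ DD x r w₁ z w₂ t := by
  obtain ⟨_, _, _, y₀, y₁, h3, h4⟩ := delaunayAt_iff_slack.mp h
  rw [DD_expand y₀ y₁ 0, sub_zero, sub_zero, sub_zero, h3]
  have := mul_nonneg h1 (h4 _ h₂)
  have := mul_nonneg h2 (h4 _ h₁)
  linarith

/-- A point aligned with `r` and a Delaunay neighbour of `r` lies behind one of them. -/
theorem DelaunayAt.ratio_pos {X : Finset (Fin n)} {z w : Fin n} (h : DelaunayAt x X z r t)
    (hw : w ∈ X) (hz : 0 < nn x r z t) (hl : Ratio x r z w t l) : 0 ≤ l * (l - 1) := by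
  obtain ⟨_, _, _, y₀, y₁, h3, h4⟩ := delaunayAt_iff_slack.mp h
  have h5 := h4 w hw
  rw [hl.nn_eq, hl.1, hl.2] at h5
  have h6 : 0 ≤ (l * (l - 1)) * nn x r z t := by
    refine h5.trans_eq ?_
    linear_combination l * h3
  exact nonneg_of_mul_nonneg_left h6 hz

/-- For the circle through `r`, `u`, `v`, the power of a point is the incircle determinant divided
by the orientation. -/
theorem DD_slack {u v : Fin n} (ho : oo x r u v t ≠ 0) : ∃ y₀ y₁ : ℝ, ∀ w,
    nn x r w t - y₀ * relX x r w t - y₁ * relY x r w t = DD x r u v w t / oo x r u v t := by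
  refine ⟨(nn x r u t * relY x r v t - nn x r v t * relY x r u t) / oo x r u v t,
    (relX x r u t * nn x r v t - relX x r v t * nn x r u t) / oo x r u v t, fun w => ?_⟩
  rw [div_mul_eq_mul_div, div_mul_eq_mul_div, eq_div_iff ho, sub_mul, sub_mul,
    div_mul_cancel₀ _ ho, div_mul_cancel₀ _ ho]
  unfold DD oo; ring

theorem DD_self_right (a b : Fin n) : DD x r a b b t = 0 := by unfold DD oo; ring

theorem DD_self_left (a b : Fin n) : DD x r a b a t = 0 := by unfold DD oo; ring

theorem DD_origin (a b : Fin n) : DD x r a b r t = 0 := by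
  unfold DD oo; rw [nn_self, relX_self, relY_self]; ring

/-- If the circle through `r`, `u`, `v` contains no point of `X` then `u` is a Delaunay
neighbour of `r`. -/
theorem delaunayAt_of_DD_nonneg {X : Finset (Fin n)} {u v : Fin n} (hu : u ∈ X) (hr : r ∈ X)
    (hur : u ≠ r) (ho : 0 < oo x r u v t) (h : ∀ w ∈ X, 0 ≤ DD x r u v w t) :
    DelaunayAt x X u r t := by
  obtain ⟨y₀, y₁, key⟩ := DD_slack ho.ne'
  refine delaunayAt_iff_slack.mpr ⟨hu, hr, hur, y₀, y₁, ?_, fun w hw => ?_⟩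
  · rw [key, DD_self_left, zero_div]
  · rw [key]; exact div_nonneg (h w hw) ho.le

/-- The edge `uv` is Delaunay if the circle through `r`, `u`, `v` contains no point. -/
theorem delaunayAt_of_DD_nonneg' {X : Finset (Fin n)} {u v : Fin n} (hu : u ∈ X) (hv : v ∈ X)
    (huv : u ≠ v) (ho : 0 < oo x r u v t) (h : ∀ w ∈ X, 0 ≤ DD x r u v w t) :
    DelaunayAt x X u v t := by
  obtain ⟨y₀, y₁, key⟩ := DD_slack ho.ne'
  refine (delaunayAt_iff r).mpr ⟨hu, hv, huv, y₀, y₁, 0, ?_, ?_, fun w hw => ?_⟩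
  · rw [key, DD_self_left, zero_div, sub_zero]
  · rw [key, DD_self_right, zero_div, sub_zero]
  · rw [key, sub_zero]; exact div_nonneg (h w hw) ho.le

end algebra

/-! ### Continuity and nondegeneracy along an admissible motion. -/

section motion
variable {n : ℕ} {x : Fin n → ℝ → Plane}

theorem continuous_coord (hx : ∀ i, Continuous (x i)) (i : Fin n) (j : Fin 2) :
    Continuous fun t => (x i t) j :=
  (EuclideanSpace.proj (𝕜 := ℝ) j).continuous.comp (hx i)

theorem IsAdmissibleMotion.continuous_oo (hx : IsAdmissibleMotion x) (r a b : Fin n) :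
    Continuous (oo x r a b) := continuous_orient hx.continuous r a b

theorem IsAdmissibleMotion.continuous_nn (hx : IsAdmissibleMotion x) (r a : Fin n) :
    Continuous (nn x r a) := by
  have h := continuous_coord hx.continuous
  exact (((h a 0).sub (h r 0)).pow 2).add (((h a 1).sub (h r 1)).pow 2)

theorem IsAdmissibleMotion.continuous_DD (hx : IsAdmissibleMotion x) (r a b c : Fin n) :
    Continuous (DD x r a b c) := by
  have h := hx.continuous_oo r
  have h' := hx.continuous_nn r
  exact (((h a b).mul (h' c)).add ((h b c).mul (h' a))).add ((h c a).mul (h' b))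

theorem IsAdmissibleMotion.nn_pos (hx : IsAdmissibleMotion x) {r a : Fin n} (h : a ≠ r) (t : ℝ) :
    0 < nn x r a t := by
  have := hx.no_coincidence a r h t
  by_contra hn
  have h0 : nn x r a t = 0 := le_antisymm (not_lt.mp hn) nn_nonneg
  unfold nn at h0
  have h1 : relX x r a t = 0 := by nlinarith [sq_nonneg (relX x r a t), sq_nonneg (relY x r a t)]
  have h2 : relY x r a t = 0 := by nlinarith [sq_nonneg (relX x r a t), sq_nonneg (relY x r a t)]
  apply this
  unfold relX at h1
  unfold relY at h2
  ext i; fin_cases i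
  · simpa using sub_eq_zero.mp h1
  · simpa using sub_eq_zero.mp h2

theorem IsAdmissibleMotion.exists_ratio (hx : IsAdmissibleMotion x) {r a b : Fin n} (h : a ≠ r)
    {t : ℝ} (h0 : oo x r a b t = 0) : ∃ l, Ratio x r a b t l := by
  have hp := hx.nn_pos h t
  refine ⟨(relX x r a t * relX x r b t + relY x r a t * relY x r b t) / nn x r a t, ?_, ?_⟩
  · rw [div_mul_eq_mul_div, eq_div_iff hp.ne']
    unfold oo at h0
    unfold nn
    linear_combination (- relY x r a t) * h0
  · rw [div_mul_eq_mul_div, eq_div_iff hp.ne']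
    unfold oo at h0
    unfold nn
    linear_combination (relX x r a t) * h0

theorem IsAdmissibleMotion.ratio_ne_zero (hx : IsAdmissibleMotion x) {r a b : Fin n} (h : b ≠ r)
    {t l : ℝ} (hl : Ratio x r a b t l) : l ≠ 0 := by
  rintro rfl
  have h1 := hx.nn_pos h t
  rw [hl.nn_eq] at h1
  simp at h1

theorem IsAdmissibleMotion.ratio_ne_one (hx : IsAdmissibleMotion x) {r a b : Fin n} (h : a ≠ b)
    {t l : ℝ} (hl : Ratio x r a b t l) : l ≠ 1 := by
  rintro rfl
  have h1 := hl.1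
  have h2 := hl.2
  unfold relX at h1
  unfold relY at h2
  refine hx.no_coincidence a b h t ?_
  ext i; fin_cases i
  · simp; linarith
  · simp; linarith

end motion

/-! ### Zeros of continuous real functions. -/

section ivt
variable {f : ℝ → ℝ} {a b : ℝ}

theorem exists_zero_of_pos_neg (hf : Continuous f) (hab : a < b) (ha : 0 < f a) (hb : f b < 0) :
    ∃ z ∈ Ioo a b, f z = 0 :=
  intermediate_value_Ioo' hab.le hf.continuousOn ⟨hb, ha⟩

theorem exists_zero_of_neg_pos (hf : Continuous f) (hab : a < b) (ha : f a < 0) (hb : 0 < f b) :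
    ∃ z ∈ Ioo a b, f z = 0 :=
  intermediate_value_Ioo hab.le hf.continuousOn ⟨ha, hb⟩

theorem pos_of_ne_zero_right (hf : Continuous f) (ha : 0 < f a)
    (h : ∀ τ ∈ Icc a b, f τ ≠ 0) : ∀ τ ∈ Icc a b, 0 < f τ := by
  intro τ hτ
  by_contra hn
  have hlt : f τ < 0 := lt_of_le_of_ne (not_lt.mp hn) (h τ hτ)
  have hne : a < τ := lt_of_le_of_ne hτ.1 (by rintro rfl; linarith)
  obtain ⟨z, hz, hz0⟩ := exists_zero_of_pos_neg hf hne ha hlt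
  exact h z ⟨hz.1.le, hz.2.le.trans hτ.2⟩ hz0

theorem exists_last_zero (hf : Continuous f) (hab : a ≤ b) (ha : f a ≤ 0) (hb : 0 < f b) :
    ∃ z ∈ Ico a b, f z = 0 ∧ ∀ τ ∈ Ioc z b, 0 < f τ := by
  let S := {τ ∈ Icc a b | f τ ≤ 0}
  have hS : IsCompact S := isCompact_Icc.inter_right (isClosed_le hf continuous_const)
  obtain ⟨z, hz, hmax⟩ := hS.exists_isGreatest ⟨a, ⟨le_rfl, hab⟩, ha⟩
  have hzb : z < b := lt_of_le_of_ne hz.1.2 (by rintro rfl; exact absurd hz.2 (not_le.mpr hb))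
  have hpos : ∀ τ ∈ Ioc z b, 0 < f τ := by
    intro τ hτ
    by_contra hn
    exact absurd (hmax ⟨⟨hz.1.1.trans hτ.1.le, hτ.2⟩, not_lt.mp hn⟩) (not_le.mpr hτ.1)
  refine ⟨z, ⟨hz.1.1, hzb⟩, le_antisymm hz.2 ?_, hpos⟩
  have ht : Tendsto f (𝓝[>] z) (𝓝 (f z)) := hf.continuousAt.tendsto.mono_left nhdsWithin_le_nhds
  refine ge_of_tendsto ht ?_
  filter_upwards [Ioc_mem_nhdsGT hzb] with τ hτ using (hpos τ hτ).le

theorem three_zeros_absurd (h : {t | f t = 0}.encard ≤ 2) {z₁ z₂ z₃ : ℝ} (h12 : z₁ < z₂)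
    (h23 : z₂ < z₃) (h1 : f z₁ = 0) (h2 : f z₂ = 0) (h3 : f z₃ = 0) : False := by
  have hs : ({z₁, z₂, z₃} : Set ℝ) ⊆ {t | f t = 0} := by
    rintro y (rfl | rfl | rfl) <;> assumption
  have := (Set.encard_le_encard hs).trans h
  rw [Set.encard_insert_of_notMem (by simp; constructor <;> intro <;> linarith),
    Set.encard_insert_of_notMem (by simp; intro; linarith), Set.encard_singleton] at this
  exact absurd this (by decide)

theorem four_zeros_absurd (h : {t | f t = 0}.encard ≤ 3) {z₁ z₂ z₃ z₄ : ℝ} (h12 : z₁ < z₂)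
    (h23 : z₂ < z₃) (h34 : z₃ < z₄) (h1 : f z₁ = 0) (h2 : f z₂ = 0) (h3 : f z₃ = 0)
    (h4 : f z₄ = 0) : False := by
  have hs : ({z₁, z₂, z₃, z₄} : Set ℝ) ⊆ {t | f t = 0} := by
    rintro y (rfl | rfl | rfl | rfl) <;> assumption
  have := (Set.encard_le_encard hs).trans h
  rw [Set.encard_insert_of_notMem (by simp; refine ⟨?_, ?_, ?_⟩ <;> intro <;> linarith),
    Set.encard_insert_of_notMem (by simp; constructor <;> intro <;> linarith),
    Set.encard_insert_of_notMem (by simp; intro; linarith), Set.encard_singleton] at this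
  exact absurd this (by decide)

end ivt

/-! ### Collinearities and co-circularities as sign changes of `oo` and `DD`. -/

section events
variable {n : ℕ} {x : Fin n → ℝ → Plane} {r a b c : Fin n} {t : ℝ}

theorem oo_eq_zero_of_collinearAt (h : CollinearAt x {r, a, b} t) : oo x r a b t = 0 := by
  have h2 := h.2
  rw [collinear_iff_of_mem (p₀ := x r t) (by simp)] at h2
  obtain ⟨v, hv⟩ := h2
  obtain ⟨la, ha⟩ := hv (x a t) (by simp)
  obtain ⟨lb, hb⟩ := hv (x b t) (by simp)
  unfold oo relX relY
  rw [ha, hb]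
  simp; ring

theorem collinearAt_of_oo_eq_zero (hx : IsAdmissibleMotion x) (har : a ≠ r) (hbr : b ≠ r)
    (hab : a ≠ b) (h : oo x r a b t = 0) : CollinearAt x {r, a, b} t := by
  refine ⟨Finset.card_eq_three.mpr ⟨r, a, b, har.symm, hbr.symm, hab, rfl⟩, ?_⟩
  have := collinear_of_orient_eq_zero (hx.no_coincidence r a har.symm t) h
  convert this using 1
  simp [Set.image_insert_eq]

theorem encard_oo_zeros (hx : IsAdmissibleMotion x) (har : a ≠ r) (hbr : b ≠ r)
    (hab : a ≠ b) : {t | oo x r a b t = 0}.encard ≤ 2 :=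
  (Set.encard_le_encard fun _ h => collinearAt_of_oo_eq_zero hx har hbr hab h).trans
    (hx.collinear_le_two {r, a, b} (Finset.card_eq_three.mpr
      ⟨r, a, b, har.symm, hbr.symm, hab, rfl⟩))

/-- The sign of `f` changes from positive to negative at `t`. -/
def PosNegAt (f : ℝ → ℝ) (t : ℝ) : Prop := (∀ᶠ τ in 𝓝[<] t, 0 < f τ) ∧ ∀ᶠ τ in 𝓝[>] t, f τ < 0

/-- The sign of `f` changes from negative to positive at `t`. -/
def NegPosAt (f : ℝ → ℝ) (t : ℝ) : Prop := (∀ᶠ τ in 𝓝[<] t, f τ < 0) ∧ ∀ᶠ τ in 𝓝[>] t, 0 < f τ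

theorem oo_sign_change (hx : IsAdmissibleMotion x) (har : a ≠ r) (hbr : b ≠ r)
    (hab : a ≠ b) (h : oo x r a b t = 0) :
    PosNegAt (oo x r a b) t ∨ NegPosAt (oo x r a b) t := by
  rcases hx.collinear_crossing t r a b (collinearAt_of_oo_eq_zero hx har hbr hab h) with h | h
  · exact Or.inl ⟨h.1, h.2.2⟩
  · have e : ∀ τ, orient (x a τ) (x r τ) (x b τ) = -oo x r a b τ := by
      intro τ; unfold orient oo relX relY; ring
    simp only [CrossesLeftToRight, e] at h
    refine Or.inr ⟨h.1.mono fun τ hτ => by linarith, h.2.2.mono fun τ hτ => by linarith⟩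

theorem card_four (har : a ≠ r) (hbr : b ≠ r) (hcr : c ≠ r) (hab : a ≠ b) (hac : a ≠ c)
    (hbc : b ≠ c) : ({r, a, b, c} : Finset (Fin n)).card = 4 := by
  rw [Finset.card_insert_of_notMem (by simp [har.symm, hbr.symm, hcr.symm]),
    Finset.card_eq_three.mpr ⟨a, b, c, hab, hac, hbc, rfl⟩]

theorem collinearAt_unique (hx : IsAdmissibleMotion x) {s s' : Finset (Fin n)}
    (h : CollinearAt x s t) (h' : CollinearAt x s' t) : s = s' :=
  hx.no_simultaneous t s s' (Or.inr h) (Or.inr h')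

theorem collinearAt_not_cocircularAt (hx : IsAdmissibleMotion x) {s s' : Finset (Fin n)}
    (h : CollinearAt x s t) (h' : CocircularAt x s' t) : False := by
  have := hx.no_simultaneous t s s' (Or.inr h) (Or.inl h')
  have h3 := h.1
  have h4 := h'.1
  rw [this] at h3
  omega

/-- Two points other than `r` are not aligned with `r` and `a` at the same time. -/
theorem oo_ne_zero_of_oo_eq_zero (hx : IsAdmissibleMotion x) (har : a ≠ r) (hbr : b ≠ r)
    (hab : a ≠ b) (h : oo x r a b t = 0) {d : Fin n} (hcr : c ≠ r) (hdr : d ≠ r) (hcd : c ≠ d)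
    (hc : c ≠ a ∧ c ≠ b ∨ d ≠ a ∧ d ≠ b) : oo x r c d t ≠ 0 := by
  intro h'
  have := collinearAt_unique hx (collinearAt_of_oo_eq_zero hx har hbr hab h)
    (collinearAt_of_oo_eq_zero hx hcr hdr hcd h')
  rcases hc with hc | hc
  · have hm : c ∈ ({r, a, b} : Finset (Fin n)) := by rw [this]; simp
    simp [hcr, hc.1, hc.2] at hm
  · have hm : d ∈ ({r, a, b} : Finset (Fin n)) := by rw [this]; simp
    simp [hdr, hc.1, hc.2] at hm

theorem cocircularAt_of_oo_ne_zero (har : a ≠ r) (hbr : b ≠ r) (hcr : c ≠ r) (hab : a ≠ b)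
    (hac : a ≠ c) (hbc : b ≠ c) (ho : oo x r a b t ≠ 0) (h : DD x r a b c t = 0) :
    CocircularAt x {r, a, b, c} t := by
  refine ⟨card_four har hbr hcr hab hac hbc, ?_⟩
  obtain ⟨y₀, y₁, key⟩ := DD_slack ho
  refine ⟨!₂[x r t 0 + y₀ / 2, x r t 1 + y₁ / 2], Real.sqrt ((y₀ / 2) ^ 2 + (y₁ / 2) ^ 2), ?_⟩
  have hd : ∀ w, DD x r a b w t = 0 → dist (x w t) !₂[x r t 0 + y₀ / 2, x r t 1 + y₁ / 2]
      = Real.sqrt ((y₀ / 2) ^ 2 + (y₁ / 2) ^ 2) := by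
    intro w hw
    have e := dist_sq_eq (x := x) r w t !₂[x r t 0 + y₀ / 2, x r t 1 + y₁ / 2]
    have k := key w
    rw [hw, zero_div] at k
    symm
    rw [Real.sqrt_eq_iff_eq_sq (by positivity) dist_nonneg, e]
    simp
    linarith
  rintro _ ⟨w, hw, rfl⟩
  simp at hw
  rcases hw with rfl | rfl | rfl | rfl
  · exact hd _ (DD_origin _ _)
  · exact hd _ (DD_self_left _ _)
  · exact hd _ (DD_self_right _ _)
  · exact hd _ h

/-- If `a` and `b` were aligned with `r`, then either `b` and `c` would be too, giving two
simultaneous collinearities, or the four points would be co-circular at the time of a collinearity.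
-/
theorem oo_ne_zero_of_DD_eq_zero (hx : IsAdmissibleMotion x) (har : a ≠ r) (hbr : b ≠ r)
    (hcr : c ≠ r) (hab : a ≠ b) (hac : a ≠ c) (hbc : b ≠ c) (h : DD x r a b c t = 0) :
    oo x r a b t ≠ 0 := by
  intro h0
  by_cases h1 : oo x r b c t = 0
  · exact oo_ne_zero_of_oo_eq_zero hx har hbr hab h0 hbr hcr hbc (Or.inr ⟨hac.symm, hbc.symm⟩) h1
  · rw [← DD_cycle] at h
    exact collinearAt_not_cocircularAt hx (collinearAt_of_oo_eq_zero hx har hbr hab h0)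
      (cocircularAt_of_oo_ne_zero hbr hcr har hbc hab.symm hac.symm h1 h)

theorem cocircularAt_of_DD_eq_zero (hx : IsAdmissibleMotion x) (har : a ≠ r) (hbr : b ≠ r)
    (hcr : c ≠ r) (hab : a ≠ b) (hac : a ≠ c) (hbc : b ≠ c) (h : DD x r a b c t = 0) :
    CocircularAt x {r, a, b, c} t :=
  cocircularAt_of_oo_ne_zero har hbr hcr hab hac hbc
    (oo_ne_zero_of_DD_eq_zero hx har hbr hcr hab hac hbc h) h

theorem encard_DD_zeros (hx : IsAdmissibleMotion x) (har : a ≠ r) (hbr : b ≠ r)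
    (hcr : c ≠ r) (hab : a ≠ b) (hac : a ≠ c) (hbc : b ≠ c) :
    {t | DD x r a b c t = 0}.encard ≤ 3 :=
  (Set.encard_le_encard fun _ h => cocircularAt_of_DD_eq_zero hx har hbr hcr hab hac hbc h).trans
    (hx.cocircular_le_three _ (card_four har hbr hcr hab hac hbc))

/-- Collinearities and co-circularities are not simultaneous. -/
theorem DD_ne_zero_of_oo_eq_zero (hx : IsAdmissibleMotion x) {d e : Fin n} (hdr : d ≠ r)
    (her : e ≠ r) (hde : d ≠ e) (ho : oo x r d e t = 0) (har : a ≠ r) (hbr : b ≠ r)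
    (hcr : c ≠ r) (hab : a ≠ b) (hac : a ≠ c) (hbc : b ≠ c) : DD x r a b c t ≠ 0 := fun h =>
  collinearAt_not_cocircularAt hx (collinearAt_of_oo_eq_zero hx hdr her hde ho)
    (cocircularAt_of_DD_eq_zero hx har hbr hcr hab hac hbc h)

theorem DD_of_circle {z : Plane} {ρ : ℝ} (hr : dist (x r t) z = ρ) (ha : dist (x a t) z = ρ)
    (hb : dist (x b t) z = ρ) : DD x r a b c t = oo x r a b t * (dist (x c t) z ^ 2 - ρ ^ 2) := by
  have er := dist_sq_eq (x := x) r r t z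
  have ea := dist_sq_eq (x := x) r a t z
  have eb := dist_sq_eq (x := x) r b t z
  have ec := dist_sq_eq (x := x) r c t z
  rw [nn_self, relX_self, relY_self, hr] at er
  rw [ha] at ea
  rw [hb] at eb
  rw [DD_expand (2 * (z 0 - x r t 0)) (2 * (z 1 - x r t 1)) 0, ec]
  rw [show nn x r a t - 2 * (z 0 - x r t 0) * relX x r a t - 2 * (z 1 - x r t 1) * relY x r a t
    = 0 by linarith, show nn x r b t - 2 * (z 0 - x r t 0) * relX x r b t
    - 2 * (z 1 - x r t 1) * relY x r b t = 0 by linarith]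
  rw [er]; ring

/-- The determinant is `oo x r a b` times the power of `c` with respect to the circle `rab`. The
first factor keeps its sign near `t`, and the second changes sign because `c` crosses the circle. -/
theorem DD_sign_change (hx : IsAdmissibleMotion x) (har : a ≠ r) (hbr : b ≠ r)
    (hcr : c ≠ r) (hab : a ≠ b) (hac : a ≠ c) (hbc : b ≠ c) (h : DD x r a b c t = 0) :
    PosNegAt (DD x r a b c) t ∨ NegPosAt (DD x r a b c) t := by
  have ho := oo_ne_zero_of_DD_eq_zero hx har hbr hcr hab hac hbc h
  have hcc := cocircularAt_of_DD_eq_zero hx har hbr hcr hab hac hbc h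
  have hmem : ∀ w, w = r ∨ w = a ∨ w = b → w ∈ ({r, a, b, c} : Finset (Fin n)).erase c := by
    rintro w (rfl | rfl | rfl) <;> simp [hcr.symm, hac, hbc]
  have hout : ∀ τ, OutsideCircleAt x (({r, a, b, c} : Finset (Fin n)).erase c) c τ →
      ∃ d, 0 < d ∧ DD x r a b c τ = oo x r a b τ * d := by
    rintro τ ⟨z, ρ, h1, h2⟩
    refine ⟨_, ?_, DD_of_circle (h1 r (hmem r (by simp))) (h1 a (hmem a (by simp)))
      (h1 b (hmem b (by simp)))⟩
    have : 0 ≤ ρ := (h1 r (hmem r (by simp))) ▸ dist_nonneg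
    nlinarith
  have hin : ∀ τ, InsideCircleAt x (({r, a, b, c} : Finset (Fin n)).erase c) c τ →
      ∃ d, d < 0 ∧ DD x r a b c τ = oo x r a b τ * d := by
    rintro τ ⟨z, ρ, h1, h2⟩
    refine ⟨_, ?_, DD_of_circle (h1 r (hmem r (by simp))) (h1 a (hmem a (by simp)))
      (h1 b (hmem b (by simp)))⟩
    have : 0 ≤ dist (x c τ) z := dist_nonneg
    nlinarith
  have hcont := hx.continuous_oo r a b
  rcases lt_or_gt_of_ne ho with ho | ho
  · have hl : ∀ᶠ τ in 𝓝 t, oo x r a b τ < 0 := hcont.continuousAt.eventually_lt_const ho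
    rcases hx.cocircular_crossing t _ hcc c (by simp) with ⟨h1, h2⟩ | ⟨h1, h2⟩
    · right
      constructor
      · filter_upwards [h1, hl.filter_mono nhdsWithin_le_nhds] with τ h3 h4
        obtain ⟨d, hd, e⟩ := hout τ h3
        rw [e]; exact mul_neg_of_neg_of_pos h4 hd
      · filter_upwards [h2, hl.filter_mono nhdsWithin_le_nhds] with τ h3 h4
        obtain ⟨d, hd, e⟩ := hin τ h3
        rw [e]; exact mul_pos_of_neg_of_neg h4 hd
    · left
      constructor
      · filter_upwards [h1, hl.filter_mono nhdsWithin_le_nhds] with τ h3 h4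
        obtain ⟨d, hd, e⟩ := hin τ h3
        rw [e]; exact mul_pos_of_neg_of_neg h4 hd
      · filter_upwards [h2, hl.filter_mono nhdsWithin_le_nhds] with τ h3 h4
        obtain ⟨d, hd, e⟩ := hout τ h3
        rw [e]; exact mul_neg_of_neg_of_pos h4 hd
  · have hl : ∀ᶠ τ in 𝓝 t, 0 < oo x r a b τ := hcont.continuousAt.eventually_const_lt ho
    rcases hx.cocircular_crossing t _ hcc c (by simp) with ⟨h1, h2⟩ | ⟨h1, h2⟩
    · left
      constructor
      · filter_upwards [h1, hl.filter_mono nhdsWithin_le_nhds] with τ h3 h4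
        obtain ⟨d, hd, e⟩ := hout τ h3
        rw [e]; exact mul_pos h4 hd
      · filter_upwards [h2, hl.filter_mono nhdsWithin_le_nhds] with τ h3 h4
        obtain ⟨d, hd, e⟩ := hin τ h3
        rw [e]; exact mul_neg_of_pos_of_neg h4 hd
    · right
      constructor
      · filter_upwards [h1, hl.filter_mono nhdsWithin_le_nhds] with τ h3 h4
        obtain ⟨d, hd, e⟩ := hin τ h3
        rw [e]; exact mul_neg_of_pos_of_neg h4 hd
      · filter_upwards [h2, hl.filter_mono nhdsWithin_le_nhds] with τ h3 h4
        obtain ⟨d, hd, e⟩ := hout τ h3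
        rw [e]; exact mul_pos h4 hd

/-- Three mutually Delaunay neighbours of `r` are not co-circular with `r`. -/
theorem DD_ne_zero_of_mutual (hx : IsAdmissibleMotion x) (har : a ≠ r) (hbr : b ≠ r)
    (hcr : c ≠ r) (hab : a ≠ b) (hac : a ≠ c) (hbc : b ≠ c)
    {Xa Xb Xc : Finset (Fin n)} (ba : b ∈ Xa) (ca : c ∈ Xa) (ab : a ∈ Xb) (cb : c ∈ Xb)
    (ac : a ∈ Xc) (bc : b ∈ Xc) (ha : ∀ᶠ τ in 𝓝 t, DelaunayAt x Xa a r τ)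
    (hb : ∀ᶠ τ in 𝓝 t, DelaunayAt x Xb b r τ) (hc : ∀ᶠ τ in 𝓝 t, DelaunayAt x Xc c r τ) :
    DD x r a b c t ≠ 0 := by
  intro h
  have h1 := oo_ne_zero_of_DD_eq_zero hx har hbr hcr hab hac hbc h
  have h2 := oo_ne_zero_of_DD_eq_zero hx hbr hcr har hbc hab.symm hac.symm (by rwa [DD_cycle])
  have h3 := oo_ne_zero_of_DD_eq_zero hx hcr har hbr hac.symm hbc.symm hab
    (by rwa [DD_cycle, DD_cycle])
  have na := hx.nn_pos har t
  have nb := hx.nn_pos hbr t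
  have nc := hx.nn_pos hcr t
  have sgn : ∀ {u v : Fin n}, oo x r u v t ≠ 0 →
      (∀ᶠ τ in 𝓝 t, 0 < oo x r u v τ) ∨ (∀ᶠ τ in 𝓝 t, oo x r u v τ < 0) := by
    intro u v huv
    rcases lt_or_gt_of_ne huv with h | h
    · exact Or.inr ((hx.continuous_oo r u v).continuousAt.eventually_lt_const h)
    · exact Or.inl ((hx.continuous_oo r u v).continuousAt.eventually_const_lt h)
  -- If the three cyclic orientations had the same sign, the determinant would not vanish. Otherwise
  -- one of the points lies angularly between the other two, and its being a neighbour of `r` fixes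
  -- the weak sign of the determinant around `t`, against the sign change.
  have weak : (∀ᶠ τ in 𝓝 t, 0 ≤ DD x r a b c τ) ∨ (∀ᶠ τ in 𝓝 t, DD x r a b c τ ≤ 0) := by
    rcases sgn h1 with s1 | s1 <;> rcases sgn h2 with s2 | s2 <;> rcases sgn h3 with s3 | s3
    · exfalso
      have := mul_pos s1.self_of_nhds nc
      have := mul_pos s2.self_of_nhds na
      have := mul_pos s3.self_of_nhds nb
      unfold DD at h; linarith
    · left; filter_upwards [s1, s2, hb] with τ q1 q2 q3
      exact q3.DD_nonneg ab cb q1.le q2.le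
    · left; filter_upwards [s1, s3, ha] with τ q1 q2 q3
      rw [← DD_cycle, ← DD_cycle]
      exact q3.DD_nonneg ca ba q2.le q1.le
    · right; filter_upwards [s2, s3, hc] with τ q1 q2 q3
      have := q3.DD_nonneg ac bc (by rw [oo_swap]; linarith) (by rw [oo_swap]; linarith)
      rw [DD_swap'] at this; linarith
    · left; filter_upwards [s2, s3, hc] with τ q1 q2 q3
      rw [← DD_cycle]
      exact q3.DD_nonneg bc ac q1.le q2.le
    · right; filter_upwards [s1, s3, ha] with τ q1 q2 q3
      have := q3.DD_nonneg ba ca (by rw [oo_swap]; linarith) (by rw [oo_swap]; linarith)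
      rw [DD_swap] at this; linarith
    · right; filter_upwards [s1, s2, hb] with τ q1 q2 q3
      have := q3.DD_nonneg cb ab (by rw [oo_swap]; linarith) (by rw [oo_swap]; linarith)
      rw [← DD_cycle, DD_swap] at this; linarith
    · exfalso
      have := mul_neg_of_neg_of_pos s1.self_of_nhds nc
      have := mul_neg_of_neg_of_pos s2.self_of_nhds na
      have := mul_neg_of_neg_of_pos s3.self_of_nhds nb
      unfold DD at h; linarith
  rcases DD_sign_change hx har hbr hcr hab hac hbc h with ⟨p, q⟩ | ⟨p, q⟩
  · rcases weak with w | w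
    · obtain ⟨τ, h5, h6⟩ := (q.and (w.filter_mono nhdsWithin_le_nhds)).exists
      linarith
    · obtain ⟨τ, h5, h6⟩ := (p.and (w.filter_mono nhdsWithin_le_nhds)).exists
      linarith
  · rcases weak with w | w
    · obtain ⟨τ, h5, h6⟩ := (p.and (w.filter_mono nhdsWithin_le_nhds)).exists
      linarith
    · obtain ⟨τ, h5, h6⟩ := (q.and (w.filter_mono nhdsWithin_le_nhds)).exists
      linarith

end events

/-! ### Symmetries: reflection and time reversal. -/

/-- Reflection of the plane in the first coordinate axis. -/
noncomputable def reflectPlane : Plane →ₗ[ℝ] Plane where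
  toFun v := !₂[v 0, -v 1]
  map_add' v w := by ext i; fin_cases i <;> simp; ring
  map_smul' c v := by ext i; fin_cases i <;> simp

@[simp] theorem reflectPlane_zero (v : Plane) : reflectPlane v 0 = v 0 := rfl

@[simp] theorem reflectPlane_one (v : Plane) : reflectPlane v 1 = -v 1 := rfl

@[simp] theorem reflectPlane_reflectPlane (v : Plane) : reflectPlane (reflectPlane v) = v := by
  ext i; fin_cases i <;> simp

theorem dist_reflectPlane (v w : Plane) : dist (reflectPlane v) (reflectPlane w) = dist v w := by
  rw [EuclideanSpace.dist_eq, EuclideanSpace.dist_eq]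
  simp only [Fin.sum_univ_two, Real.dist_eq, sq_abs, reflectPlane_zero, reflectPlane_one]
  congr 2; ring

theorem orient_reflectPlane (a b c : Plane) :
    orient (reflectPlane a) (reflectPlane b) (reflectPlane c) = orient b a c := by
  unfold orient; simp only [reflectPlane_zero, reflectPlane_one]; ring

theorem collinear_reflectPlane {s : Set Plane} (h : Collinear ℝ s) :
    Collinear ℝ (reflectPlane '' s) := by
  rw [collinear_iff_exists_forall_eq_smul_vadd] at h ⊢
  obtain ⟨p, v, h⟩ := h
  refine ⟨reflectPlane p, reflectPlane v, ?_⟩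
  rintro _ ⟨y, hy, rfl⟩
  obtain ⟨c, rfl⟩ := h y hy
  exact ⟨c, by simp⟩

/-- The reflected motion. -/
noncomputable def reflectMotion {n : ℕ} (x : Fin n → ℝ → Plane) : Fin n → ℝ → Plane :=
  fun i t => reflectPlane (x i t)

/-- The time-reversed motion. -/
def reverseMotion {n : ℕ} (x : Fin n → ℝ → Plane) : Fin n → ℝ → Plane := fun i t => x i (-t)

section
variable {n : ℕ} {x : Fin n → ℝ → Plane}

theorem eventually_left_neg {P : ℝ → Prop} {t : ℝ} :
    (∀ᶠ τ in 𝓝[<] t, P (-τ)) ↔ ∀ᶠ τ in 𝓝[>] (-t), P τ := by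
  constructor
  · intro h
    have := (tendsto_neg_nhdsGT_neg (a := t)).eventually h
    simpa using this
  · intro h
    exact tendsto_neg_nhdsLT.eventually h

theorem eventually_right_neg {P : ℝ → Prop} {t : ℝ} :
    (∀ᶠ τ in 𝓝[>] t, P (-τ)) ↔ ∀ᶠ τ in 𝓝[<] (-t), P τ := by
  constructor
  · intro h
    have := (tendsto_neg_nhdsLT_neg (a := t)).eventually h
    simpa using this
  · intro h
    exact tendsto_neg_nhdsGT.eventually h

@[simp] theorem reflectMotion_reflectMotion : reflectMotion (reflectMotion x) = x := by
  funext i t; simp [reflectMotion]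

@[simp] theorem reverseMotion_reverseMotion : reverseMotion (reverseMotion x) = x := by
  funext i t; simp [reverseMotion]

theorem CocircularAt.reflect {s : Finset (Fin n)} {t : ℝ} (h : CocircularAt x s t) :
    CocircularAt (reflectMotion x) s t := by
  obtain ⟨h1, c, ρ, h2⟩ := h
  refine ⟨h1, reflectPlane c, ρ, ?_⟩
  rintro _ ⟨i, hi, rfl⟩
  rw [← h2 (x i t) ⟨i, hi, rfl⟩]
  exact dist_reflectPlane _ _

theorem cocircularAt_reflect {s : Finset (Fin n)} {t : ℝ} :
    CocircularAt (reflectMotion x) s t ↔ CocircularAt x s t :=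
  ⟨fun h => by simpa using h.reflect, fun h => h.reflect⟩

theorem CollinearAt.reflect {s : Finset (Fin n)} {t : ℝ} (h : CollinearAt x s t) :
    CollinearAt (reflectMotion x) s t := by
  refine ⟨h.1, ?_⟩
  have := collinear_reflectPlane h.2
  rwa [Set.image_image] at this

theorem collinearAt_reflect {s : Finset (Fin n)} {t : ℝ} :
    CollinearAt (reflectMotion x) s t ↔ CollinearAt x s t :=
  ⟨fun h => by simpa using h.reflect, fun h => h.reflect⟩

theorem InsideCircleAt.reflect {s : Finset (Fin n)} {a : Fin n} {t : ℝ}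
    (h : InsideCircleAt x s a t) : InsideCircleAt (reflectMotion x) s a t := by
  obtain ⟨c, ρ, h1, h2⟩ := h
  exact ⟨reflectPlane c, ρ, fun b hb => (dist_reflectPlane _ _).trans (h1 b hb),
    (dist_reflectPlane _ _).trans_lt h2⟩

theorem OutsideCircleAt.reflect {s : Finset (Fin n)} {a : Fin n} {t : ℝ}
    (h : OutsideCircleAt x s a t) : OutsideCircleAt (reflectMotion x) s a t := by
  obtain ⟨c, ρ, h1, h2⟩ := h
  exact ⟨reflectPlane c, ρ, fun b hb => (dist_reflectPlane _ _).trans (h1 b hb),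
    h2.trans_eq (dist_reflectPlane _ _).symm⟩

theorem crossesLeftToRight_reflect {p q r : Fin n} {t : ℝ} :
    CrossesLeftToRight (reflectMotion x) p q r t ↔ CrossesLeftToRight x q p r t := by
  simp only [CrossesLeftToRight, reflectMotion, orient_reflectPlane]

theorem crossesLeftToRight_reverse {p q r : Fin n} {t : ℝ} :
    CrossesLeftToRight (reverseMotion x) p q r t ↔ CrossesLeftToRight x q p r (-t) := by
  have e : ∀ τ, orient (x q τ) (x p τ) (x r τ) = -orient (x p τ) (x q τ) (x r τ) := by
    intro τ; unfold orient; ring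
  unfold CrossesLeftToRight reverseMotion
  rw [eventually_left_neg (P := fun τ => 0 < orient (x p τ) (x q τ) (x r τ)),
    eventually_right_neg (P := fun τ => orient (x p τ) (x q τ) (x r τ) < 0)]
  simp only [e, neg_pos, neg_lt_zero, neg_eq_zero]
  tauto

theorem IsAdmissibleMotion.reflect (hx : IsAdmissibleMotion x) :
    IsAdmissibleMotion (reflectMotion x) where
  continuous i := reflectPlane.continuous_of_finiteDimensional.comp (hx.continuous i)
  cocircular_le_three s hs := by
    simp only [cocircularAt_reflect]; exact hx.cocircular_le_three s hs
  collinear_le_two s hs := by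
    simp only [collinearAt_reflect]; exact hx.collinear_le_two s hs
  no_coincidence i j hij t h := by
    refine hx.no_coincidence i j hij t ?_
    have := congrArg reflectPlane h
    simpa [reflectMotion] using this
  no_simultaneous t s s' := by
    simp only [cocircularAt_reflect, collinearAt_reflect]; exact hx.no_simultaneous t s s'
  cocircular_crossing t s hs a ha := by
    rcases hx.cocircular_crossing t s (cocircularAt_reflect.mp hs) a ha with ⟨h1, h2⟩ | ⟨h1, h2⟩
    · exact Or.inl ⟨h1.mono fun _ h => h.reflect, h2.mono fun _ h => h.reflect⟩
    · exact Or.inr ⟨h1.mono fun _ h => h.reflect, h2.mono fun _ h => h.reflect⟩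
  collinear_crossing t p q r h := by
    rw [crossesLeftToRight_reflect, crossesLeftToRight_reflect]
    exact (hx.collinear_crossing t p q r (collinearAt_reflect.mp h)).symm

theorem encard_neg_preimage {S : Set ℝ} : {t | -t ∈ S}.encard = S.encard := by
  have : {t | -t ∈ S} = Neg.neg '' S := by
    ext t; simp
  rw [this, neg_injective.encard_image]

theorem IsAdmissibleMotion.reverse (hx : IsAdmissibleMotion x) :
    IsAdmissibleMotion (reverseMotion x) where
  continuous i := (hx.continuous i).comp continuous_neg
  cocircular_le_three s hs :=
    (encard_neg_preimage (S := {t | CocircularAt x s t})).trans_le (hx.cocircular_le_three s hs)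
  collinear_le_two s hs :=
    (encard_neg_preimage (S := {t | CollinearAt x s t})).trans_le (hx.collinear_le_two s hs)
  no_coincidence i j hij t := hx.no_coincidence i j hij (-t)
  no_simultaneous t s s' := hx.no_simultaneous (-t) s s'
  cocircular_crossing t s hs a ha := by
    rcases hx.cocircular_crossing (-t) s hs a ha with ⟨h1, h2⟩ | ⟨h1, h2⟩
    · exact Or.inr ⟨(eventually_left_neg (P := InsideCircleAt x (s.erase a) a)).mpr h2,
        (eventually_right_neg (P := OutsideCircleAt x (s.erase a) a)).mpr h1⟩
    · exact Or.inl ⟨(eventually_left_neg (P := OutsideCircleAt x (s.erase a) a)).mpr h2,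
        (eventually_right_neg (P := InsideCircleAt x (s.erase a) a)).mpr h1⟩
  collinear_crossing t p q r h := by
    rw [crossesLeftToRight_reverse, crossesLeftToRight_reverse]
    exact (hx.collinear_crossing (-t) p q r h).symm

theorem DelaunayAt.reflect {X : Finset (Fin n)} {p q : Fin n} {t : ℝ} (h : DelaunayAt x X p q t) :
    DelaunayAt (reflectMotion x) X p q t := by
  obtain ⟨h1, h2, h3, c, ρ, h4, h5, h6⟩ := h
  exact ⟨h1, h2, h3, reflectPlane c, ρ, (dist_reflectPlane _ _).trans h4,
    (dist_reflectPlane _ _).trans h5, fun z hz => (h6 z hz).trans_eq (dist_reflectPlane _ _).symm⟩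

theorem delaunayAt_reflect {X : Finset (Fin n)} {p q : Fin n} {t : ℝ} :
    DelaunayAt (reflectMotion x) X p q t ↔ DelaunayAt x X p q t :=
  ⟨fun h => by simpa using h.reflect, fun h => h.reflect⟩

theorem HitsAt.reflect {p q r : Fin n} {t : ℝ} (h : HitsAt x p q r t) :
    HitsAt (reflectMotion x) p q r t := by
  unfold HitsAt reflectMotion
  have := image_segment ℝ reflectPlane.toAffineMap (x p t) (x q t)
  simp only [LinearMap.coe_toAffineMap] at this
  rw [← this]
  exact ⟨_, h, rfl⟩

theorem hitsAt_reflect {p q r : Fin n} {t : ℝ} :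
    HitsAt (reflectMotion x) p q r t ↔ HitsAt x p q r t :=
  ⟨fun h => by simpa using h.reflect, fun h => h.reflect⟩

theorem hitsAt_comm {p q r : Fin n} {t : ℝ} : HitsAt x p q r t ↔ HitsAt x q p r t := by
  unfold HitsAt; rw [segment_symm]

theorem IsSingleCrossing.reflect {p q r : Fin n} {t₀ t₁ : ℝ} (h : IsSingleCrossing x p q r t₀ t₁) :
    IsSingleCrossing (reflectMotion x) q p r t₀ t₁ := by
  obtain ⟨⟨h1, h2, h3, h4, h5, h6⟩, t, ht, h7, h8, h9⟩ := h
  refine ⟨⟨h1, h2.mono fun _ h => h.symm.reflect, fun t ht hd => h3 t ht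
    (delaunayAt_reflect.mp hd).symm, h4.mono fun _ h => h.symm.reflect, ?_,
    fun t ht => (h6 t ht).symm.reflect⟩, t, ht, (hitsAt_comm.mp h7).reflect,
    crossesLeftToRight_reflect.mpr h8, fun t' ht' h' => h9 t' ht' (hitsAt_comm.mp
      (hitsAt_reflect.mp h'))⟩
  obtain ⟨t, ht, h⟩ := h5
  exact ⟨t, ht, (hitsAt_comm.mp h).reflect⟩

theorem isSingleCrossing_reflect {p q r : Fin n} {t₀ t₁ : ℝ} :
    IsSingleCrossing (reflectMotion x) p q r t₀ t₁ ↔ IsSingleCrossing x q p r t₀ t₁ :=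
  ⟨fun h => by simpa using h.reflect, fun h => h.reflect⟩

theorem IsSingleCrossing.reverse {p q r : Fin n} {t₀ t₁ : ℝ} (h : IsSingleCrossing x p q r t₀ t₁) :
    IsSingleCrossing (reverseMotion x) q p r (-t₁) (-t₀) := by
  obtain ⟨⟨h1, h2, h3, h4, h5, h6⟩, t, ht, h7, h8, h9⟩ := h
  have hI : ∀ τ, τ ∈ Icc (-t₁) (-t₀) → -τ ∈ Icc t₀ t₁ := fun τ hτ =>
    ⟨by linarith [hτ.2], by linarith [hτ.1]⟩
  have hI' : ∀ τ, τ ∈ Icc t₀ t₁ → -τ ∈ Icc (-t₁) (-t₀) := fun τ hτ =>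
    ⟨by linarith [hτ.2], by linarith [hτ.1]⟩
  refine ⟨⟨by linarith, ?_, fun t ht hd => h3 (-t) ⟨by linarith [ht.2], by linarith [ht.1]⟩ hd.symm,
    ?_, ?_, fun t ht => (h6 (-t) (hI t ht)).symm⟩, -t, hI' t ht, ?_, ?_, ?_⟩
  · refine (eventually_left_neg (P := fun τ => DelaunayAt x Finset.univ q p τ)).mpr ?_
    rw [neg_neg]; exact h4.mono fun _ h => h.symm
  · refine (eventually_right_neg (P := fun τ => DelaunayAt x Finset.univ q p τ)).mpr ?_
    rw [neg_neg]; exact h2.mono fun _ h => h.symm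
  · obtain ⟨t, ht, h⟩ := h5
    refine ⟨-t, hI' t ht, ?_⟩
    rw [hitsAt_comm]
    simpa [HitsAt, reverseMotion] using h
  · rw [hitsAt_comm]
    simpa [HitsAt, reverseMotion] using h7
  · rw [crossesLeftToRight_reverse, neg_neg]; exact h8
  · intro t' ht' h'
    have := h9 (-t') (hI t' ht') (hitsAt_comm.mp h')
    linarith

theorem isSingleCrossing_reverse {p q r : Fin n} {t₀ t₁ : ℝ} :
    IsSingleCrossing (reverseMotion x) p q r t₀ t₁ ↔ IsSingleCrossing x q p r (-t₁) (-t₀) :=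
  ⟨fun h => by simpa using h.reverse, fun h => by simpa using h.reverse⟩

/-- The reflected and time-reversed motion. -/
noncomputable def mirrorMotion (x : Fin n → ℝ → Plane) : Fin n → ℝ → Plane :=
  reflectMotion (reverseMotion x)

theorem IsAdmissibleMotion.mirror (hx : IsAdmissibleMotion x) :
    IsAdmissibleMotion (mirrorMotion x) := hx.reverse.reflect

/-- Reflection and time reversal both exchange `p` and `q`. Their composition keeps the pair and
turns the end of a crossing into a start, so that each one-sided argument is needed only once. -/
theorem isSingleCrossing_mirror {p q r : Fin n} {t₀ t₁ : ℝ} :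
    IsSingleCrossing (mirrorMotion x) p q r t₀ t₁ ↔ IsSingleCrossing x p q r (-t₁) (-t₀) :=
  isSingleCrossing_reflect.trans isSingleCrossing_reverse

theorem delaunayAt_mirror {X : Finset (Fin n)} {p q : Fin n} {t : ℝ} :
    DelaunayAt (mirrorMotion x) X p q t ↔ DelaunayAt x X p q (-t) := delaunayAt_reflect

theorem relX_mirror {r a : Fin n} {t : ℝ} : relX (mirrorMotion x) r a t = relX x r a (-t) := rfl

theorem relY_mirror {r a : Fin n} {t : ℝ} : relY (mirrorMotion x) r a t = -relY x r a (-t) := by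
  simp only [relY, mirrorMotion, reflectMotion, reverseMotion, reflectPlane_one]; ring

theorem oo_mirror {r a b : Fin n} {t : ℝ} : oo (mirrorMotion x) r a b t = -oo x r a b (-t) := by
  unfold oo; rw [relX_mirror, relX_mirror, relY_mirror, relY_mirror]; ring

theorem nn_mirror {r a : Fin n} {t : ℝ} : nn (mirrorMotion x) r a t = nn x r a (-t) := by
  unfold nn; rw [relX_mirror, relY_mirror]; ring

theorem DD_mirror {r a b c : Fin n} {t : ℝ} :
    DD (mirrorMotion x) r a b c t = -DD x r a b c (-t) := by
  unfold DD; simp only [oo_mirror, nn_mirror]; ring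

theorem ratio_mirror {r a b : Fin n} {t l : ℝ} :
    Ratio (mirrorMotion x) r a b t l ↔ Ratio x r a b (-t) l := by
  unfold Ratio; simp only [relX_mirror, relY_mirror]
  constructor <;> rintro ⟨h1, h2⟩ <;> exact ⟨h1, by linarith⟩

theorem under_mirror {r q p : Fin n} {t : ℝ} :
    Under (mirrorMotion x) r q p t ↔ Under x r q p (-t) := by
  unfold Under; simp only [ratio_mirror]

end

/-! ### Signs under one-sided limits. -/

section limits
variable {f : ℝ → ℝ} {t : ℝ}

theorem nonneg_of_eventually_left (hf : Continuous f) (h : ∀ᶠ τ in 𝓝[<] t, 0 < f τ) : 0 ≤ f t := by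
  have ht : Tendsto f (𝓝[<] t) (𝓝 (f t)) := hf.continuousAt.tendsto.mono_left nhdsWithin_le_nhds
  exact ge_of_tendsto ht (h.mono fun _ h => h.le)

theorem nonneg_of_eventually_right (hf : Continuous f) (h : ∀ᶠ τ in 𝓝[>] t, 0 < f τ) :
    0 ≤ f t := by
  have ht : Tendsto f (𝓝[>] t) (𝓝 (f t)) := hf.continuousAt.tendsto.mono_left nhdsWithin_le_nhds
  exact ge_of_tendsto ht (h.mono fun _ h => h.le)

theorem nonpos_of_eventually_left (hf : Continuous f) (h : ∀ᶠ τ in 𝓝[<] t, f τ < 0) : f t ≤ 0 := by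
  have ht : Tendsto f (𝓝[<] t) (𝓝 (f t)) := hf.continuousAt.tendsto.mono_left nhdsWithin_le_nhds
  exact le_of_tendsto ht (h.mono fun _ h => h.le)

theorem nonpos_of_eventually_right (hf : Continuous f) (h : ∀ᶠ τ in 𝓝[>] t, f τ < 0) :
    f t ≤ 0 := by
  have ht : Tendsto f (𝓝[>] t) (𝓝 (f t)) := hf.continuousAt.tendsto.mono_left nhdsWithin_le_nhds
  exact le_of_tendsto ht (h.mono fun _ h => h.le)

theorem eventually_pos_of_pos (hf : Continuous f) (h : 0 < f t) (s : Set ℝ) :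
    ∀ᶠ τ in 𝓝[s] t, 0 < f τ :=
  (hf.continuousAt.eventually_const_lt h).filter_mono nhdsWithin_le_nhds

theorem eventually_neg_of_neg (hf : Continuous f) (h : f t < 0) (s : Set ℝ) :
    ∀ᶠ τ in 𝓝[s] t, f τ < 0 :=
  (hf.continuousAt.eventually_lt_const h).filter_mono nhdsWithin_le_nhds

end limits

/-! ### Anatomy of a single crossing. -/

section crossing
variable {n : ℕ} {x : Fin n → ℝ → Plane} {r q z w : Fin n} {s₀ s₁ t τ : ℝ}

theorem delaunayAt_of_DD_nonneg_right {X : Finset (Fin n)} {u v : Fin n} (hv : v ∈ X) (hr : r ∈ X)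
    (hvr : v ≠ r) (ho : oo x r u v t ≠ 0) (h : ∀ w ∈ X, 0 ≤ DD x r u v w t / oo x r u v t) :
    DelaunayAt x X v r t := by
  obtain ⟨y₀, y₁, key⟩ := DD_slack ho
  refine delaunayAt_iff_slack.mpr ⟨hv, hr, hvr, y₀, y₁, ?_, fun w hw => ?_⟩
  · rw [key, DD_self_right, zero_div]
  · rw [key]; exact h w hw

/-- A circle through `z` and `q` that contains `r`, but no other point, yields an empty circle
through `z` and `r`. -/
theorem delaunayAt_of_circle {y₀ y₁ h : ℝ} (hx : IsAdmissibleMotion x) (hzr : z ≠ r)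
    (hz : nn x r z t - y₀ * relX x r z t - y₁ * relY x r z t - h = 0) (hh : 0 ≤ h)
    (hf : ∀ w ≠ r, 0 ≤ nn x r w t - y₀ * relX x r w t - y₁ * relY x r w t - h) :
    DelaunayAt x Finset.univ z r t := by
  have hp := hx.nn_pos hzr t
  -- The new power function is the weighted mean of the given one and of the squared distance to
  -- `z`. It vanishes at `z`, and this weight `m` makes it vanish at `r` too.
  set m := h / nn x r z t with hm
  have hm0 : 0 ≤ m := div_nonneg hh hp.le
  have hmn : m * nn x r z t = h := div_mul_cancel₀ _ hp.ne'
  have h1m : 0 < 1 + m := by linarith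
  have key : ∀ w, nn x r w t - (y₀ + 2 * m * relX x r z t) / (1 + m) * relX x r w t
      - (y₁ + 2 * m * relY x r z t) / (1 + m) * relY x r w t
      = ((nn x r w t - y₀ * relX x r w t - y₁ * relY x r w t - h)
        + m * ((relX x r w t - relX x r z t) ^ 2 + (relY x r w t - relY x r z t) ^ 2))
          / (1 + m) := by
    intro w
    have e : ∀ A B : ℝ, A / (1 + m) * B * (1 + m) = A * B := fun A B => by field_simp
    rw [eq_div_iff h1m.ne', sub_mul, sub_mul, e, e, ← hmn]
    unfold nn; ring
  refine delaunayAt_iff_slack.mpr ⟨Finset.mem_univ _, Finset.mem_univ _, hzr,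
    (y₀ + 2 * m * relX x r z t) / (1 + m), (y₁ + 2 * m * relY x r z t) / (1 + m), ?_,
    fun w _ => ?_⟩
  · exact (key z).trans (by rw [hz]; simp)
  · refine (key w).symm ▸ div_nonneg ?_ h1m.le
    by_cases hw : w = r
    · subst hw
      rw [nn_self, relX_self, relY_self, show (0 - relX x w z t) ^ 2 + (0 - relY x w z t) ^ 2
        = nn x w z t by unfold nn; ring, hmn]
      linarith
    · have := hf w hw
      positivity

theorem IsSingleCrossing.ne₁ (h : IsSingleCrossing x z q r s₀ s₁) : z ≠ r := by
  have := (h.1.delaunay_without s₀ ⟨le_rfl, h.1.lt.le⟩).1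
  exact (Finset.mem_erase.mp this).1

theorem IsSingleCrossing.ne₂ (h : IsSingleCrossing x z q r s₀ s₁) : q ≠ r := by
  have := (h.1.delaunay_without s₀ ⟨le_rfl, h.1.lt.le⟩).2.1
  exact (Finset.mem_erase.mp this).1

theorem IsSingleCrossing.ne₃ (h : IsSingleCrossing x z q r s₀ s₁) : z ≠ q :=
  (h.1.delaunay_without s₀ ⟨le_rfl, h.1.lt.le⟩).2.2.1

theorem hitsAt_iff_ratio (hx : IsAdmissibleMotion x) (hzr : z ≠ r) (hqr : q ≠ r) :
    HitsAt x z q r t ↔ ∃ l < 0, Ratio x r q z t l := by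
  constructor
  · rintro ⟨a, b, ha, hb, hab, h⟩
    have h0 := congrFun (congrArg (fun v : Plane => (v : Fin 2 → ℝ)) h) 0
    have h1 := congrFun (congrArg (fun v : Plane => (v : Fin 2 → ℝ)) h) 1
    simp at h0 h1
    have ha' : a ≠ 0 := by
      rintro rfl
      apply hx.no_coincidence q r hqr t
      rw [← h]; simp at hab; simp [hab]
    have hb' : b ≠ 0 := by
      rintro rfl
      apply hx.no_coincidence z r hzr t
      rw [← h]; simp at hab; simp [hab]
    have ha'' : 0 < a := lt_of_le_of_ne ha ha'.symm
    have hb'' : 0 < b := lt_of_le_of_ne hb hb'.symm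
    refine ⟨-(b / a), by have := div_pos hb'' ha''; linarith, ?_, ?_⟩
    · unfold relX; field_simp
      linear_combination h0 - (x r t).ofLp 0 * hab
    · unfold relY; field_simp
      linear_combination h1 - (x r t).ofLp 1 * hab
  · rintro ⟨l, hl, h0, h1⟩
    unfold relX at h0
    unfold relY at h1
    have h1l : (1 : ℝ) - l ≠ 0 := by linarith
    refine ⟨1 / (1 - l), -l / (1 - l), div_nonneg zero_le_one (by linarith),
      div_nonneg (by linarith) (by linarith), by field_simp; ring, ?_⟩
    ext i; fin_cases i
    · simp; field_simp; linarith
    · simp; field_simp; linarith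

/-- On the line `zq` but off the segment, `r` lies outside every circle through `z` and `q`, so
putting it back does no harm. -/
theorem delaunayAt_of_ratio_pos {X : Finset (Fin n)} {l : ℝ}
    (h : DelaunayAt x (X.erase r) z q t) (hr : r ∈ X) (hl : Ratio x r z q t l) (hl0 : 0 < l)
    (hl1 : l ≠ 1) : DelaunayAt x X z q t := by
  obtain ⟨h1, h2, h3, y₀, y₁, d, h4, h5, h6⟩ := (delaunayAt_iff r).mp h
  refine (delaunayAt_iff r).mpr ⟨Finset.mem_of_mem_erase h1, Finset.mem_of_mem_erase h2, h3,
    y₀, y₁, d, h4, h5, fun w hw => ?_⟩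
  by_cases hwr : w = r
  · subst hwr
    rw [nn_self, relX_self, relY_self]
    rw [hl.nn_eq, hl.1, hl.2] at h5
    have : (l - 1) * (l * nn x w z t + d) = 0 := by linear_combination h5 - l * h4
    rcases mul_eq_zero.mp this with h7 | h7
    · exact absurd (by linarith) hl1
    · have := mul_nonneg hl0.le (nn_nonneg (x := x) (r := w) (a := z) (t := t))
      linarith
  · exact h6 w (Finset.mem_erase.mpr ⟨hwr, hw⟩)

/-- A circle through `z` and `q` without `r` in its interior covers the part of the disc `rzq` that
lies beyond `zq` as seen from `r`. If that circle is empty, a point inside the disc is on the side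
of `r`. -/
theorem orient_pos_of_delaunayAt (h : DelaunayAt x Finset.univ z q t) (ho : 0 < oo x r z q t)
    (hD : DD x r z q w t < 0) : 0 < orient (x z t) (x q t) (x w t) := by
  obtain ⟨h1, h2, h3, y₀, y₁, h, h4, h5, h6⟩ := (delaunayAt_iff r).mp h
  rw [DD_expand y₀ y₁ h, h4, h5] at hD
  have h7 := mul_nonneg ho.le (h6 w (Finset.mem_univ _))
  have h8 := h6 r (Finset.mem_univ _)
  rw [nn_self, relX_self, relY_self] at h8
  have h9 : h * orient (x z t) (x q t) (x w t) < 0 := by linarith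
  by_contra hn
  have := mul_nonneg_of_nonpos_of_nonpos (by linarith : h ≤ 0) (not_lt.mp hn)
  linarith

theorem exists_circle_of_absent (h : DelaunayAt x (Finset.univ.erase r) z q t)
    (ha : ¬ DelaunayAt x Finset.univ z q t) : ∃ y₀ y₁ h : ℝ, 0 < h ∧
      nn x r z t - y₀ * relX x r z t - y₁ * relY x r z t - h = 0 ∧
      nn x r q t - y₀ * relX x r q t - y₁ * relY x r q t - h = 0 ∧
      ∀ w ≠ r, 0 ≤ nn x r w t - y₀ * relX x r w t - y₁ * relY x r w t - h := by
  obtain ⟨h1, h2, h3, y₀, y₁, h, h4, h5, h6⟩ := (delaunayAt_iff r).mp h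
  refine ⟨y₀, y₁, h, ?_, h4, h5, fun w hw => h6 w (by simp [hw])⟩
  by_contra hn
  refine ha ((delaunayAt_iff r).mpr ⟨Finset.mem_univ _, Finset.mem_univ _, h3, y₀, y₁, h, h4, h5,
    fun w _ => ?_⟩)
  by_cases hw : w = r
  · subst hw
    rw [nn_self, relX_self, relY_self]; linarith
  · exact h6 w (by simp [hw])

/-- Dual to `orient_pos_of_delaunayAt`: now the circle has `r` in its interior and covers the part
of the disc on the side of `r`. -/
theorem orient_neg_of_absent (h : DelaunayAt x (Finset.univ.erase r) z q t)
    (ha : ¬ DelaunayAt x Finset.univ z q t) (hw : w ≠ r) (ho : 0 < oo x r z q t)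
    (hD : DD x r z q w t < 0) : orient (x z t) (x q t) (x w t) < 0 := by
  obtain ⟨y₀, y₁, h, h3, h4, h5, h6⟩ := exists_circle_of_absent h ha
  rw [DD_expand y₀ y₁ h, h4, h5] at hD
  have h7 := mul_nonneg ho.le (h6 w hw)
  by_contra hn
  have := mul_nonneg h3.le (not_lt.mp hn)
  linarith

theorem Ratio.DD_eq_orient {l : ℝ} (hl : Ratio x r z q t l) (w : Fin n) :
    DD x r z q w t = -(l * nn x r z t * orient (x z t) (x q t) (x w t)) := by
  have e : orient (x z t) (x q t) (x w t)
      = oo x r z q t + oo x r q w t + oo x r w z t := by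
    unfold oo relX relY orient; ring
  rw [e, ← neg_eq_iff_eq_neg, ← DD_swap', hl.DD_eq, hl.oo_self, hl.oo_left, oo_swap z w]
  ring

variable (hx : IsAdmissibleMotion x)
include hx

/-- While `zq` is absent, an alignment of the three points must be a hit of the segment, so none
occurs before `t`. An alignment off the segment at the start `s₀` itself would make the circle `rzq`
empty right afterwards, and `zq` would then be Delaunay. -/
theorem IsSingleCrossing.oo_pos (h : IsSingleCrossing x z q r s₀ s₁) (ht : t ∈ Icc s₀ s₁)
    (hc : CrossesLeftToRight x z q r t) (hu : ∀ t' ∈ Icc s₀ s₁, HitsAt x z q r t' → t' = t) :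
    ∀ τ ∈ Ico s₀ t, 0 < oo x r z q τ := by
  have hzr := h.ne₁
  have hqr := h.ne₂
  have hzq := h.ne₃
  have horient : ∀ τ, orient (x z τ) (x q τ) (x r τ) = oo x r z q τ := by
    intro τ; unfold orient oo relX relY; ring
  simp only [CrossesLeftToRight, horient] at hc
  have hcont := hx.continuous_oo r z q
  have hlpos : ∀ τ ∈ Ico s₀ t, oo x r z q τ = 0 →
      ∃ l, Ratio x r z q τ l ∧ 0 < l ∧ l ≠ 1 := by
    intro τ hτ h0
    obtain ⟨l, hl⟩ := hx.exists_ratio hzr h0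
    have hl0 := hx.ratio_ne_zero hqr hl
    refine ⟨l, hl, ?_, hx.ratio_ne_one hzq hl⟩
    by_contra hn
    have := hu τ ⟨hτ.1, hτ.2.le.trans ht.2⟩ ((hitsAt_iff_ratio hx hzr hqr).mpr
      ⟨l⁻¹, inv_lt_zero.mpr (lt_of_le_of_ne (not_lt.mp hn) hl0), hl.symm hl0⟩)
    exact absurd this hτ.2.ne
  have hne : ∀ τ ∈ Ioo s₀ t, oo x r z q τ ≠ 0 := by
    intro τ hτ h0
    obtain ⟨l, hl, hl0, hl1⟩ := hlpos τ ⟨hτ.1.le, hτ.2⟩ h0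
    exact h.1.absent τ ⟨hτ.1, hτ.2.trans_le ht.2⟩ (delaunayAt_of_ratio_pos
      (h.1.delaunay_without τ ⟨hτ.1.le, hτ.2.le.trans ht.2⟩) (Finset.mem_univ r) hl hl0 hl1)
  have hpos : ∀ τ ∈ Ioo s₀ t, 0 < oo x r z q τ := by
    intro τ hτ
    obtain ⟨τ', h1, h2⟩ := (hc.1.and (Ioo_mem_nhdsLT hτ.2)).exists
    by_contra hn
    have hlt : oo x r z q τ < 0 := lt_of_le_of_ne (not_lt.mp hn) (hne τ hτ)
    obtain ⟨y, hy, hy0⟩ := exists_zero_of_neg_pos hcont h2.1 hlt h1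
    exact hne y ⟨hτ.1.trans hy.1, hy.2.trans h2.2⟩ hy0
  intro τ hτ
  rcases hτ.1.eq_or_lt with rfl | hlt
  swap
  · exact hpos τ ⟨hlt, hτ.2⟩
  have hev : ∀ᶠ τ in 𝓝[>] s₀, 0 < oo x r z q τ ∧ τ ∈ Ioo s₀ s₁ := by
    filter_upwards [Ioo_mem_nhdsGT hτ.2] with y hy
    exact ⟨hpos y hy, hy.1, hy.2.trans_le ht.2⟩
  have h0 : 0 ≤ oo x r z q s₀ := nonneg_of_eventually_right hcont (hev.mono fun _ h => h.1)
  rcases h0.eq_or_lt with h0 | h0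
  swap
  · exact h0
  exfalso
  obtain ⟨l, hl, hl0, hl1⟩ := hlpos s₀ hτ h0.symm
  have hDpos : ∀ w, ∀ᶠ τ in 𝓝[>] s₀, w ≠ z → w ≠ q → w ≠ r → 0 < DD x r z q w τ := by
    intro w
    by_cases hwz : w = z
    · simp [hwz]
    by_cases hwq : w = q
    · simp [hwq]
    by_cases hwr : w = r
    · simp [hwr]
    have hD := DD_ne_zero_of_oo_eq_zero hx hzr hqr hzq h0.symm hzr hqr hwr hzq (Ne.symm hwz)
      (Ne.symm hwq)
    rcases lt_or_gt_of_ne hD with hD | hD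
    · exfalso
      have ho : 0 < orient (x z s₀) (x q s₀) (x w s₀) := by
        rw [hl.DD_eq_orient] at hD
        by_contra hn
        have := mul_nonneg_of_nonpos_of_nonpos (not_lt.mp hn) (neg_nonpos.mpr
          (mul_nonneg hl0.le (hx.nn_pos hzr s₀).le))
        linarith
      obtain ⟨y, ⟨⟨h1, h2⟩, h3⟩, h4⟩ := ((hev.and (eventually_neg_of_neg (hx.continuous_DD r z q w)
        hD _)).and (eventually_pos_of_pos (continuous_orient hx.continuous z q w) ho _)).exists
      have := orient_neg_of_absent (h.1.delaunay_without y ⟨h2.1.le, h2.2.le⟩)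
        (h.1.absent y h2) hwr h1 h3
      linarith
    · filter_upwards [eventually_pos_of_pos (hx.continuous_DD r z q w) hD _] with y hy _ _ _ using hy
  obtain ⟨y, ⟨h1, h2⟩, h3⟩ := (hev.and (eventually_all.mpr hDpos)).exists
  refine h.1.absent y h2 (delaunayAt_of_DD_nonneg' (Finset.mem_univ _) (Finset.mem_univ _) hzq h1
    fun w _ => ?_)
  by_cases hwz : w = z
  · rw [hwz, DD_self_left]
  by_cases hwq : w = q
  · rw [hwq, DD_self_right]
  by_cases hwr : w = r
  · rw [hwr, DD_origin]
  exact (h3 w hwz hwq hwr).le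

/-- Just before the crossing the triangle `rzq` is Delaunay. A point inside its circle at time `s₀`
would lie on the side of `r` by what holds before `s₀`, and on the other side by what holds after
`s₀`. -/
theorem IsSingleCrossing.eventually_left (h : IsSingleCrossing x z q r s₀ s₁) :
    ∀ᶠ τ in 𝓝[<] s₀, 0 < oo x r z q τ ∧ ∀ w, w ≠ z → w ≠ q → w ≠ r → 0 < DD x r z q w τ := by
  have hzr := h.ne₁
  have hqr := h.ne₂
  have hzq := h.ne₃
  obtain ⟨t, ht, hhit, hc, hu⟩ := h.2
  have hpos := h.oo_pos hx ht hc hu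
  have horient : ∀ τ, orient (x z τ) (x q τ) (x r τ) = oo x r z q τ := by
    intro τ; unfold orient oo relX relY; ring
  simp only [CrossesLeftToRight, horient] at hc
  have hcont := hx.continuous_oo r z q
  have hl : ∀ᶠ τ in 𝓝[<] s₀, 0 < oo x r z q τ := by
    rcases ht.1.eq_or_lt with rfl | hlt
    · exact hc.1
    · exact eventually_pos_of_pos hcont (hpos s₀ ⟨le_rfl, hlt⟩) _
  refine hl.and (eventually_all.mpr fun w => ?_)
  by_cases hwz : w = z
  · simp [hwz]
  by_cases hwq : w = q
  · simp [hwq]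
  by_cases hwr : w = r
  · simp [hwr]
  have hDc := fun w => hx.continuous_DD r z q w
  suffices hsuff : ¬ ∀ᶠ τ in 𝓝[<] s₀, DD x r z q w τ < 0 by
    by_cases hD : DD x r z q w s₀ = 0
    · rcases DD_sign_change hx hzr hqr hwr hzq (Ne.symm hwz) (Ne.symm hwq) hD with h1 | h1
      · exact h1.1.mono fun _ h _ _ _ => h
      · exact absurd h1.1 hsuff
    · rcases lt_or_gt_of_ne hD with hD | hD
      · exact absurd (eventually_neg_of_neg (hDc w) hD _) hsuff
      · exact (eventually_pos_of_pos (hDc w) hD _).mono fun _ h _ _ _ => h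
  have key : ∀ w, (∀ᶠ τ in 𝓝[<] s₀, DD x r z q w τ < 0) →
      0 ≤ orient (x z s₀) (x q s₀) (x w s₀) := by
    intro w hw
    refine nonneg_of_eventually_left (f := fun τ => orient (x z τ) (x q τ) (x w τ))
      (continuous_orient hx.continuous z q w) ?_
    filter_upwards [hw, hl, h.1.leaves] with τ h1 h2 h3
    exact orient_pos_of_delaunayAt h3 h2 h1
  intro hneg
  have hor := key w hneg
  have hD0 := nonpos_of_eventually_left (hDc w) hneg
  rcases ht.1.eq_or_lt with rfl | hlt
  · have hD := DD_ne_zero_of_oo_eq_zero hx hzr hqr hzq hc.2.1 hzr hqr hwr hzq (Ne.symm hwz)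
      (Ne.symm hwq)
    have hD1 := lt_of_le_of_ne hD0 hD
    obtain ⟨l, hl0, hlr⟩ := (hitsAt_iff_ratio hx hzr hqr).mp hhit
    rw [(hlr.symm hl0.ne).DD_eq_orient] at hD1
    have h5 : l⁻¹ < 0 := inv_lt_zero.mpr hl0
    have h6 := mul_nonneg (mul_nonneg (neg_nonneg.mpr h5.le) (hx.nn_pos hzr s₀).le) hor
    linarith
  · have ho := hpos s₀ ⟨le_rfl, hlt⟩
    have hev : ∀ᶠ τ in 𝓝[>] s₀, 0 < oo x r z q τ ∧ τ ∈ Ioo s₀ s₁ :=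
      (eventually_pos_of_pos hcont ho _).and (Ioo_mem_nhdsGT h.1.lt)
    have claim : ∀ w, w ≠ r → ¬ DD x r z q w s₀ < 0 := by
      intro w hwr hD
      have h1 := key w (eventually_neg_of_neg (hDc w) hD _)
      have h2 : orient (x z s₀) (x q s₀) (x w s₀) ≤ 0 := by
        refine nonpos_of_eventually_right (f := fun τ => orient (x z τ) (x q τ) (x w τ))
          (continuous_orient hx.continuous z q w) ?_
        filter_upwards [hev, eventually_neg_of_neg (hDc w) hD _] with τ h1 h2
        exact orient_neg_of_absent (h.1.delaunay_without τ ⟨h1.2.1.le, h1.2.2.le⟩)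
          (h.1.absent τ h1.2) hwr h1.1 h2
      obtain ⟨_, _, _, y₀, y₁, h, h4, h5, h6⟩ :=
        (delaunayAt_iff r).mp (h.1.delaunay_without s₀ ⟨le_rfl, h.1.lt.le⟩)
      rw [DD_expand y₀ y₁ h, h4, h5, le_antisymm h2 h1] at hD
      have := mul_nonneg ho.le (h6 w (by simp [hwr]))
      linarith
    have hD0 : DD x r z q w s₀ = 0 := le_antisymm hD0 (not_lt.mp (claim w hwr))
    have hcoc := cocircularAt_of_DD_eq_zero hx hzr hqr hwr hzq (Ne.symm hwz) (Ne.symm hwq) hD0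
    -- In the remaining case `w` is on the circle at `s₀` and moves out of it. No other point is on
    -- the circle at that time, so the circle is empty right afterwards and `zq` is Delaunay when it
    -- should be absent.
    have hall : ∀ v, ∀ᶠ τ in 𝓝[>] s₀, 0 ≤ DD x r z q v τ := by
      intro v
      by_cases hvz : v = z
      · exact Eventually.of_forall fun τ => by rw [hvz, DD_self_left]
      by_cases hvq : v = q
      · exact Eventually.of_forall fun τ => by rw [hvq, DD_self_right]
      by_cases hvr : v = r
      · exact Eventually.of_forall fun τ => by rw [hvr, DD_origin]
      by_cases hvw : v = w
      · subst hvw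
        rcases DD_sign_change hx hzr hqr hwr hzq (Ne.symm hwz) (Ne.symm hwq) hD0 with h1 | h1
        · obtain ⟨τ, h2, h3⟩ := (h1.1.and hneg).exists
          linarith
        · exact h1.2.mono fun _ h => h.le
      · have hDv : DD x r z q v s₀ ≠ 0 := by
          intro h0
          have := hx.no_simultaneous s₀ _ _ (Or.inl hcoc) (Or.inl (cocircularAt_of_DD_eq_zero hx
            hzr hqr hvr hzq (Ne.symm hvz) (Ne.symm hvq) h0))
          have hm : v ∈ ({r, z, q, w} : Finset (Fin n)) := by rw [this]; simp
          simp [hvz, hvq, hvr, hvw] at hm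
        exact (eventually_pos_of_pos (hDc v) (lt_of_le_of_ne (not_lt.mp (claim v hvr)) hDv.symm)
          _).mono fun _ h => h.le
    obtain ⟨τ, h1, h2⟩ := (hev.and (eventually_all.mpr hall)).exists
    exact h.1.absent τ h1.2 (delaunayAt_of_DD_nonneg' (Finset.mem_univ _) (Finset.mem_univ _) hzq
      h1.1 fun w _ => h2 w)

end crossing

/-! ### Crossers of a pair `q`, `r` and their order in time. -/

/-- The point `z` crosses the pair `q`, `r` during `[s, e]`: a single Delaunay crossing of `zq`
by `r`, with the time interval slightly enlarged. -/
structure Crosser {n : ℕ} (x : Fin n → ℝ → Plane) (r q z : Fin n) (s t e : ℝ) : Prop where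
  lt₁ : s < t
  lt₂ : t < e
  zr : z ≠ r
  qr : q ≠ r
  zq : z ≠ q
  alive : ∀ τ ∈ Icc s e, DelaunayAt x Finset.univ z r τ
  alive_q : ∀ τ ∈ Icc s e, DelaunayAt x Finset.univ q r τ
  pos : ∀ τ ∈ Ico s t, 0 < oo x r z q τ
  opposite : ∃ l < 0, Ratio x r q z t l
  neg : ∀ τ ∈ Ioc t e, oo x r z q τ < 0
  DD_pos : ∀ w, w ≠ z → w ≠ q → w ≠ r → 0 < DD x r z q w s
  DD_neg : ∀ w, w ≠ z → w ≠ q → w ≠ r → DD x r z q w e < 0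

section
variable {n : ℕ} {x : Fin n → ℝ → Plane} {r q z w : Fin n} {s₀ s₁ t τ s e : ℝ}

theorem IsSingleCrossing.mirror (h : IsSingleCrossing x z q r s₀ s₁) :
    IsSingleCrossing (mirrorMotion x) z q r (-s₁) (-s₀) := by
  rw [isSingleCrossing_mirror]; simpa using h

theorem crossesLeftToRight_mirror {p : Fin n} :
    CrossesLeftToRight (mirrorMotion x) p q r t ↔ CrossesLeftToRight x p q r (-t) :=
  crossesLeftToRight_reflect.trans crossesLeftToRight_reverse

theorem hitsAt_mirror {p : Fin n} : HitsAt (mirrorMotion x) p q r t ↔ HitsAt x p q r (-t) :=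
  hitsAt_reflect

theorem IsSingleCrossing.eventually_right (hx : IsAdmissibleMotion x)
    (h : IsSingleCrossing x z q r s₀ s₁) :
    ∀ᶠ τ in 𝓝[>] s₁, oo x r z q τ < 0 ∧ ∀ w, w ≠ z → w ≠ q → w ≠ r → DD x r z q w τ < 0 := by
  have := h.mirror.eventually_left hx.mirror
  rw [← neg_neg s₁, ← eventually_left_neg]
  refine this.mono fun τ hτ => ⟨?_, fun w h1 h2 h3 => ?_⟩
  · have := hτ.1
    rw [oo_mirror] at this; linarith
  · have := hτ.2 w h1 h2 h3
    rw [DD_mirror] at this; linarith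

theorem IsSingleCrossing.oo_neg (hx : IsAdmissibleMotion x) (h : IsSingleCrossing x z q r s₀ s₁)
    (ht : t ∈ Icc s₀ s₁) (hc : CrossesLeftToRight x z q r t)
    (hu : ∀ t' ∈ Icc s₀ s₁, HitsAt x z q r t' → t' = t) : ∀ τ ∈ Ioc t s₁, oo x r z q τ < 0 := by
  intro τ hτ
  have := h.mirror.oo_pos hx.mirror (t := -t) ⟨by linarith [ht.2], by linarith [ht.1]⟩
    (by rw [crossesLeftToRight_mirror, neg_neg]; exact hc)
    (fun t' ht' h' => by
      have := hu (-t') ⟨by linarith [ht'.2], by linarith [ht'.1]⟩ (hitsAt_mirror.mp h')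
      linarith) (-τ) ⟨by linarith [hτ.2], by linarith [hτ.1]⟩
  rw [oo_mirror, neg_neg] at this
  linarith

theorem IsSingleCrossing.alive_start (hx : IsAdmissibleMotion x)
    (h : IsSingleCrossing x z q r s₀ s₁) :
    DelaunayAt x Finset.univ z r s₀ ∧ DelaunayAt x Finset.univ q r s₀ := by
  have hzr := h.ne₁
  have hqr := h.ne₂
  have hzq := h.ne₃
  obtain ⟨t, ht, hhit, hc, hu⟩ := h.2
  rcases ht.1.eq_or_lt with rfl | hlt
  · obtain ⟨l, hl0, hl⟩ := (hitsAt_iff_ratio hx hzr hqr).mp hhit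
    obtain ⟨_, _, _, y₀, y₁, d, h4, h5, h6⟩ :=
      (delaunayAt_iff r).mp (h.1.delaunay_without s₀ ⟨le_rfl, h.1.lt.le⟩)
    have hd : 0 ≤ d := by
      have e := h4
      rw [hl.nn_eq, hl.1, hl.2] at e
      have : (l - 1) * (l * nn x r q s₀ + d) = 0 := by linear_combination e - l * h5
      rcases mul_eq_zero.mp this with h7 | h7
      · linarith
      · have := mul_nonneg (neg_nonneg.mpr hl0.le)
          (nn_nonneg (x := x) (r := r) (a := q) (t := s₀))
        linarith
    have h6' : ∀ w ≠ r, _ := fun w hw => h6 w (by simp [hw])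
    exact ⟨delaunayAt_of_circle hx hzr h4 hd h6', delaunayAt_of_circle hx hqr h5 hd h6'⟩
  · have ho := h.oo_pos hx ht hc hu s₀ ⟨le_rfl, hlt⟩
    have hD : ∀ w ∈ Finset.univ, 0 ≤ DD x r z q w s₀ := by
      intro w _
      by_cases hwz : w = z
      · rw [hwz, DD_self_left]
      by_cases hwq : w = q
      · rw [hwq, DD_self_right]
      by_cases hwr : w = r
      · rw [hwr, DD_origin]
      exact nonneg_of_eventually_left (hx.continuous_DD r z q w)
        ((h.eventually_left hx).mono fun τ hτ => hτ.2 w hwz hwq hwr)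
    exact ⟨delaunayAt_of_DD_nonneg (Finset.mem_univ _) (Finset.mem_univ _) hzr ho hD,
      delaunayAt_of_DD_nonneg_right (Finset.mem_univ _) (Finset.mem_univ _) hqr ho.ne'
        fun w hw => div_nonneg (hD w hw) ho.le⟩

theorem IsSingleCrossing.alive (hx : IsAdmissibleMotion x)
    (h : IsSingleCrossing x z q r s₀ s₁) (hτ : τ ∈ Icc s₀ s₁) :
    DelaunayAt x Finset.univ z r τ ∧ DelaunayAt x Finset.univ q r τ := by
  by_cases ha : DelaunayAt x Finset.univ z q τ
  · rcases hτ.1.eq_or_lt with rfl | h1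
    · exact h.alive_start hx
    rcases hτ.2.eq_or_lt with rfl | h2
    · have := h.mirror.alive_start hx.mirror
      rw [delaunayAt_mirror, delaunayAt_mirror, neg_neg] at this
      exact this
    exact absurd ha (h.1.absent τ ⟨h1, h2⟩)
  · obtain ⟨y₀, y₁, d, h3, h4, h5, h6⟩ := exists_circle_of_absent (h.1.delaunay_without τ hτ) ha
    exact ⟨delaunayAt_of_circle hx h.ne₁ h4 h3.le h6, delaunayAt_of_circle hx h.ne₂ h5 h3.le h6⟩

/-- The enlargement makes the triangle `rzq` strictly Delaunay at both ends. The bounds `a` and `b`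
allow it to be arbitrarily small. -/
theorem IsSingleCrossing.exists_crosser (hx : IsAdmissibleMotion x)
    (h : IsSingleCrossing x z q r s₀ s₁) {a b : ℝ} (ha : a < s₀) (hb : s₁ < b) :
    ∃ t ∈ Icc s₀ s₁, ∃ s ∈ Ioo a s₀, ∃ e ∈ Ioo s₁ b, Crosser x r q z s t e := by
  have hzr := h.ne₁
  have hqr := h.ne₂
  have hzq := h.ne₃
  obtain ⟨t, ht, hhit, hc, hu⟩ := id h.2
  obtain ⟨a', ha', hA⟩ := (mem_nhdsLT_iff_exists_Ioo_subset' ha).mp (h.eventually_left hx)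
  obtain ⟨b', hb', hB⟩ := (mem_nhdsGT_iff_exists_Ioo_subset' hb).mp (h.eventually_right hx)
  obtain ⟨s, hs1, hs2⟩ := exists_between (max_lt ha ha')
  obtain ⟨e, he1, he2⟩ := exists_between (lt_min hb hb')
  have hsa := (le_max_left a a').trans_lt hs1
  have hsa' := (le_max_right a a').trans_lt hs1
  have heb := he2.trans_le (min_le_left b b')
  have heb' := he2.trans_le (min_le_right b b')
  have hA' : ∀ τ ∈ Ico s s₀, 0 < oo x r z q τ ∧
      ∀ w, w ≠ z → w ≠ q → w ≠ r → 0 < DD x r z q w τ :=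
    fun τ hτ => hA ⟨hsa'.trans_le hτ.1, hτ.2⟩
  have hB' : ∀ τ ∈ Ioc s₁ e, oo x r z q τ < 0 ∧
      ∀ w, w ≠ z → w ≠ q → w ≠ r → DD x r z q w τ < 0 :=
    fun τ hτ => hB ⟨hτ.1, hτ.2.trans_lt heb'⟩
  have halive : ∀ τ ∈ Icc s e,
      DelaunayAt x Finset.univ z r τ ∧ DelaunayAt x Finset.univ q r τ := by
    intro τ hτ
    rcases lt_or_ge τ s₀ with h1 | h1
    · obtain ⟨ho, hD⟩ := hA' τ ⟨hτ.1, h1⟩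
      have hD' : ∀ w ∈ Finset.univ, 0 ≤ DD x r z q w τ := by
        intro w _
        by_cases hwz : w = z
        · rw [hwz, DD_self_left]
        by_cases hwq : w = q
        · rw [hwq, DD_self_right]
        by_cases hwr : w = r
        · rw [hwr, DD_origin]
        exact (hD w hwz hwq hwr).le
      exact ⟨delaunayAt_of_DD_nonneg (Finset.mem_univ _) (Finset.mem_univ _) hzr ho hD',
        delaunayAt_of_DD_nonneg_right (Finset.mem_univ _) (Finset.mem_univ _) hqr ho.ne'
          fun w hw => div_nonneg (hD' w hw) ho.le⟩
    rcases le_or_gt τ s₁ with h2 | h2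
    · exact h.alive hx ⟨h1, h2⟩
    · obtain ⟨ho, hD⟩ := hB' τ ⟨h2, hτ.2⟩
      have ho' : 0 < oo x r q z τ := by rw [oo_swap]; linarith
      have hD' : ∀ w ∈ Finset.univ, 0 ≤ DD x r q z w τ := by
        intro w _
        by_cases hwz : w = z
        · rw [hwz, DD_self_right]
        by_cases hwq : w = q
        · rw [hwq, DD_self_left]
        by_cases hwr : w = r
        · rw [hwr, DD_origin]
        have := hD w hwz hwq hwr
        rw [DD_swap] at this; linarith
      exact ⟨delaunayAt_of_DD_nonneg_right (Finset.mem_univ _) (Finset.mem_univ _) hzr ho'.ne'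
          fun w hw => div_nonneg (hD' w hw) ho'.le,
        delaunayAt_of_DD_nonneg (Finset.mem_univ _) (Finset.mem_univ _) hqr ho' hD'⟩
  refine ⟨t, ht, s, ⟨hsa, hs2⟩, e, ⟨he1, heb⟩, ⟨hs2.trans_le ht.1, ht.2.trans_lt he1, hzr, hqr, hzq,
    fun τ hτ => (halive τ hτ).1, fun τ hτ => (halive τ hτ).2, fun τ hτ => ?_,
    (hitsAt_iff_ratio hx hzr hqr).mp hhit, fun τ hτ => ?_, (hA' s ⟨le_rfl, hs2⟩).2,
    (hB' e ⟨he1, le_rfl⟩).2⟩⟩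
  · rcases lt_or_ge τ s₀ with h1 | h1
    · exact (hA' τ ⟨hτ.1, h1⟩).1
    · exact h.oo_pos hx ht hc hu τ ⟨h1, hτ.2⟩
  · rcases le_or_gt τ s₁ with h1 | h1
    · exact h.oo_neg hx ht hc hu τ ⟨hτ.1, h1⟩
    · exact (hB' τ ⟨h1, hτ.2⟩).1

theorem Crosser.lt (h : Crosser x r q z s t e) : s < e := h.lt₁.trans h.lt₂

theorem Crosser.zero (h : Crosser x r q z s t e) : oo x r z q t = 0 := by
  obtain ⟨l, _, hl⟩ := h.opposite
  rw [oo_swap, hl.oo_self, neg_zero]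

theorem Crosser.mirror (h : Crosser x r q z s t e) :
    Crosser (mirrorMotion x) r q z (-e) (-t) (-s) := by
  have hI : ∀ τ, τ ∈ Icc (-e) (-s) → -τ ∈ Icc s e := fun τ hτ =>
    ⟨by linarith [hτ.2], by linarith [hτ.1]⟩
  refine ⟨neg_lt_neg h.lt₂, neg_lt_neg h.lt₁, h.zr, h.qr, h.zq, fun τ hτ => ?_, fun τ hτ => ?_,
    fun τ hτ => ?_, ?_, fun τ hτ => ?_, fun w h1 h2 h3 => ?_, fun w h1 h2 h3 => ?_⟩
  · exact delaunayAt_mirror.mpr (h.alive _ (hI τ hτ))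
  · exact delaunayAt_mirror.mpr (h.alive_q _ (hI τ hτ))
  · rw [oo_mirror]
    have := h.neg (-τ) ⟨by linarith [hτ.2], by linarith [hτ.1]⟩
    linarith
  · obtain ⟨l, hl, h1⟩ := h.opposite
    exact ⟨l, hl, ratio_mirror.mpr (by rwa [neg_neg])⟩
  · rw [oo_mirror]
    have := h.pos (-τ) ⟨by linarith [hτ.2], by linarith [hτ.1]⟩
    linarith
  · rw [DD_mirror, neg_neg]
    have := h.DD_neg w h1 h2 h3
    linarith
  · rw [DD_mirror, neg_neg]
    have := h.DD_pos w h1 h2 h3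
    linarith

/-- At the hitting time the incircle determinant has a definite sign. -/
theorem Crosser.DD_at (hx : IsAdmissibleMotion x) (h : Crosser x r q z s t e) (w : Fin n) :
    ∃ d, 0 < d ∧ DD x r z q w t = d * oo x r q w t := by
  obtain ⟨l, hl, h1⟩ := h.opposite
  refine ⟨l * (l - 1) * nn x r q t, mul_pos (mul_pos_of_neg_of_neg hl (by linarith))
    (hx.nn_pos h.qr t), ?_⟩
  have := h1.DD_eq w
  rw [← DD_cycle, this]; ring

/-- No third point stays a Delaunay neighbour of `r` throughout a crossing, even if a set of
points not containing `z` and `q` is removed. -/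
theorem Crosser.exclusion (hx : IsAdmissibleMotion x) (h : Crosser x r q z s t e) {p : Fin n}
    (hpz : p ≠ z) (hpq : p ≠ q) {X : Finset (Fin n)} (hz : z ∈ X) (hq : q ∈ X)
    (hp : ∀ τ ∈ Icc s e, DelaunayAt x X p r τ) : False := by
  have hpr : p ≠ r := (hp s ⟨le_rfl, h.lt.le⟩).2.2.1
  -- The determinant goes from positive at `s` to negative at `e`, and at its zero the points `z`,
  -- `q`, `p` would be mutual neighbours of `r`.
  obtain ⟨τ, hτ, h0⟩ := exists_zero_of_pos_neg (hx.continuous_DD r z q p) h.lt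
    (h.DD_pos p hpz hpq hpr) (h.DD_neg p hpz hpq hpr)
  have hI : ∀ᶠ y in 𝓝 τ, y ∈ Icc s e := Icc_mem_nhds hτ.1 hτ.2
  exact DD_ne_zero_of_mutual hx h.zr h.qr hpr h.zq hpz.symm hpq.symm (Finset.mem_univ _)
    (Finset.mem_univ _) (Finset.mem_univ _) (Finset.mem_univ _) hz hq (hI.mono h.alive)
    (hI.mono h.alive_q) (hI.mono hp) h0

variable {z₁ z₂ : Fin n} {S₁ T₁ E₁ S₂ T₂ E₂ : ℝ}

/-- Suppose the second crossing started first. If it also ended last, `z₂` would be a neighbour of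
`r` throughout the first crossing, which is excluded. If it ended earlier, the sign of the
determinant at the hit `T₁` forces a co-circularity during `(S₁, T₁)`, when all three points are
neighbours of `r`. -/
theorem Crosser.start_lt (hx : IsAdmissibleMotion x) (h₁ : Crosser x r q z₁ S₁ T₁ E₁)
    (h₂ : Crosser x r q z₂ S₂ T₂ E₂) (hne : z₁ ≠ z₂) (ht : T₁ < T₂) : S₁ < S₂ := by
  by_contra hn
  rcases (not_lt.mp hn).eq_or_lt with heq | hlt
  · have a := h₁.DD_pos z₂ hne.symm h₂.zq h₂.zr
    have b := h₂.DD_pos z₁ hne h₁.zq h₁.zr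
    rw [heq, ← DD_cycle, ← DD_cycle, DD_swap'] at b
    linarith
  have a := h₁.DD_pos z₂ hne.symm h₂.zq h₂.zr
  rcases le_or_gt E₁ E₂ with hE | hE
  · exact h₁.exclusion hx hne.symm h₂.zq (Finset.mem_univ _) (Finset.mem_univ _)
      fun τ hτ => h₂.alive τ ⟨hlt.le.trans hτ.1, hτ.2.trans hE⟩
  · have hS : S₁ ≤ E₂ := h₁.lt₁.le.trans (ht.le.trans h₂.lt₂.le)
    obtain ⟨d, hd, he⟩ := h₁.DD_at hx z₂
    have ho : 0 < oo x r z₂ q T₁ := h₂.pos T₁ ⟨hlt.le.trans h₁.lt₁.le, ht⟩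
    have hneg : DD x r z₁ q z₂ T₁ < 0 := by
      rw [he, oo_swap]
      have := mul_pos hd ho
      linarith
    obtain ⟨τ, hτ, h0⟩ := exists_zero_of_pos_neg (hx.continuous_DD r z₁ q z₂) h₁.lt₁ a hneg
    have hI : ∀ᶠ y in 𝓝 τ, y ∈ Ioo S₁ T₁ := Ioo_mem_nhds hτ.1 hτ.2
    have h1 := h₁.lt₂
    have h2 := h₂.lt₂
    exact DD_ne_zero_of_mutual hx h₁.zr h₁.qr h₂.zr h₁.zq hne h₂.zq.symm (Finset.mem_univ _)
      (Finset.mem_univ _) (Finset.mem_univ _) (Finset.mem_univ _) (Finset.mem_univ _)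
      (Finset.mem_univ _) (hI.mono fun y hy => h₁.alive y ⟨hy.1.le, by linarith [hy.2]⟩)
      (hI.mono fun y hy => h₁.alive_q y ⟨hy.1.le, by linarith [hy.2]⟩)
      (hI.mono fun y hy => h₂.alive y ⟨by linarith [hy.1], by linarith [hy.2]⟩) h0

theorem Crosser.end_lt (hx : IsAdmissibleMotion x) (h₁ : Crosser x r q z₁ S₁ T₁ E₁)
    (h₂ : Crosser x r q z₂ S₂ T₂ E₂) (hne : z₁ ≠ z₂) (ht : T₁ < T₂) : E₁ < E₂ :=
  neg_lt_neg_iff.mp (h₂.mirror.start_lt hx.mirror h₁.mirror hne.symm (neg_lt_neg ht))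

/-- Distinct crossers hit at distinct times. -/
theorem Crosser.hit_ne (hx : IsAdmissibleMotion x) (h₁ : Crosser x r q z₁ S₁ T₁ E₁)
    (h₂ : Crosser x r q z₂ S₂ T₂ E₂) (hne : z₁ ≠ z₂) : T₁ ≠ T₂ := by
  rintro rfl
  exact oo_ne_zero_of_oo_eq_zero hx h₁.zr h₁.qr h₁.zq h₁.zero h₂.zr h₂.qr h₂.zq
    (Or.inl ⟨hne.symm, h₂.zq⟩) h₂.zero

end

/-! ### Sign patterns, and the position of `q` relative to a crosser. -/

section
variable {f : ℝ → ℝ} {t g e : ℝ}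

/-- A function with two sign changes is positive after the second one. -/
theorem sign_after_second_zero (hf : Continuous f) (hz : {t | f t = 0}.encard ≤ 2)
    (hs : PosNegAt f g ∨ NegPosAt f g) (ht : f t = 0) (hg : f g = 0) (he : e ∈ Ioo t g)
    (hneg : f e < 0) : (∀ τ ∈ Ioo t g, f τ < 0) ∧ ∀ τ, g < τ → 0 < f τ := by
  have htg : t < g := he.1.trans he.2
  have hmid : ∀ τ ∈ Ioo t g, f τ ≠ 0 := fun τ hτ h0 => three_zeros_absurd hz hτ.1 hτ.2 ht h0 hg
  have hneg' : ∀ τ ∈ Ioo t g, f τ < 0 := by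
    intro τ hτ
    by_contra hn
    have hp : 0 < f τ := lt_of_le_of_ne (not_lt.mp hn) (hmid τ hτ).symm
    rcases lt_trichotomy τ e with h | h | h
    · obtain ⟨y, hy, h0⟩ := exists_zero_of_pos_neg hf h hp hneg
      exact hmid y ⟨hτ.1.trans hy.1, hy.2.trans he.2⟩ h0
    · subst h; linarith
    · obtain ⟨y, hy, h0⟩ := exists_zero_of_neg_pos hf h hneg hp
      exact hmid y ⟨he.1.trans hy.1, hy.2.trans hτ.2⟩ h0
  refine ⟨hneg', fun τ hτ => ?_⟩
  have hr : ∀ᶠ y in 𝓝[>] g, 0 < f y := by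
    rcases hs with h | h
    · obtain ⟨y, h1, h2⟩ := (h.1.and (Ioo_mem_nhdsLT htg)).exists
      have := hneg' y h2
      linarith
    · exact h.2
  obtain ⟨y, h1, h2⟩ := (hr.and (Ioo_mem_nhdsGT hτ)).exists
  by_contra hn
  rcases (not_lt.mp hn).eq_or_lt with h3 | h3
  · exact three_zeros_absurd hz htg hτ ht hg h3
  · obtain ⟨w, hw, h0⟩ := exists_zero_of_pos_neg hf h2.2 h1 h3
    exact three_zeros_absurd hz htg (h2.1.trans hw.1) ht hg h0

/-- Five alternating signs cost four zeros, the last of which may be `t₄` itself. Applied to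
incircle determinants, this is how the bound of three co-circularities is exploited. -/
theorem five_alternation_absurd (hf : Continuous f) (hz : {t | f t = 0}.encard ≤ 3)
    {t₀ t₁ t₂ t₃ t₄ : ℝ} (h01 : t₀ < t₁) (h12 : t₁ < t₂) (h23 : t₂ < t₃) (h34 : t₃ < t₄)
    (h0 : 0 < f t₀) (h1 : f t₁ < 0) (h2 : 0 < f t₂) (h3 : f t₃ < 0) (h4 : 0 ≤ f t₄) : False := by
  obtain ⟨a, ha, a0⟩ := exists_zero_of_pos_neg hf h01 h0 h1
  obtain ⟨b, hb, b0⟩ := exists_zero_of_neg_pos hf h12 h1 h2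
  obtain ⟨c, hc, c0⟩ := exists_zero_of_pos_neg hf h23 h2 h3
  rcases h4.eq_or_lt with h4 | h4
  · exact four_zeros_absurd hz (ha.2.trans hb.1) (hb.2.trans hc.1) (hc.2.trans h34) a0 b0 c0 h4.symm
  · obtain ⟨d, hd, d0⟩ := exists_zero_of_neg_pos hf h34 h3 h4
    exact four_zeros_absurd hz (ha.2.trans hb.1) (hb.2.trans hc.1) (hc.2.trans hd.1) a0 b0 c0 d0

end

section
variable {n : ℕ} {x : Fin n → ℝ → Plane} {r a b c : Fin n} {t : ℝ}

/-- Among three points co-circular with `r`, of which two remain Delaunay neighbours of `r`, the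
remaining point lies angularly between these two. -/
theorem between_of_DD_eq_zero (hx : IsAdmissibleMotion x) (har : a ≠ r) (hbr : b ≠ r)
    (hcr : c ≠ r) (hab : a ≠ b) (hac : a ≠ c) (hbc : b ≠ c)
    (hb : ∀ᶠ τ in 𝓝 t, DelaunayAt x Finset.univ b r τ)
    (hc : ∀ᶠ τ in 𝓝 t, DelaunayAt x Finset.univ c r τ) (h : DD x r a b c t = 0)
    (ho : 0 < oo x r b c t) : 0 < oo x r b a t ∧ 0 < oo x r a c t := by
  have h1 := oo_ne_zero_of_DD_eq_zero hx har hbr hcr hab hac hbc h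
  have h3 := oo_ne_zero_of_DD_eq_zero hx hcr har hbr hac.symm hbc.symm hab
    (by rwa [DD_cycle, DD_cycle])
  have weak : ¬ ∀ᶠ τ in 𝓝 t, 0 ≤ DD x r a b c τ := by
    intro w
    rcases DD_sign_change hx har hbr hcr hab hac hbc h with ⟨p, q⟩ | ⟨p, q⟩
    · obtain ⟨τ, h5, h6⟩ := (q.and (w.filter_mono nhdsWithin_le_nhds)).exists
      linarith
    · obtain ⟨τ, h5, h6⟩ := (p.and (w.filter_mono nhdsWithin_le_nhds)).exists
      linarith
  have ev : ∀ {u v : Fin n}, 0 < oo x r u v t → ∀ᶠ τ in 𝓝 t, 0 < oo x r u v τ := fun huv =>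
    (hx.continuous_oo r _ _).continuousAt.eventually_const_lt huv
  constructor
  · by_contra hn
    rw [oo_swap] at hn
    have h4 : 0 < oo x r a b t := lt_of_le_of_ne (by linarith) h1.symm
    apply weak
    filter_upwards [ev h4, ev ho, hb] with τ h5 h6 h7
    exact h7.DD_nonneg (Finset.mem_univ _) (Finset.mem_univ _) h5.le h6.le
  · by_contra hn
    rw [oo_swap] at hn
    have h4 : 0 < oo x r c a t := lt_of_le_of_ne (by linarith) h3.symm
    apply weak
    filter_upwards [ev h4, ev ho, hc] with τ h5 h6 h7
    rw [← DD_cycle]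
    exact h7.DD_nonneg (Finset.mem_univ _) (Finset.mem_univ _) h6.le h5.le

end

section
variable {n : ℕ} {x : Fin n → ℝ → Plane} {r q u y : Fin n} {s t e s' t' e' : ℝ}

theorem Crosser.oo_zeros (hx : IsAdmissibleMotion x) (h : Crosser x r q u s t e) :
    {τ | oo x r u q τ = 0}.encard ≤ 2 := encard_oo_zeros hx h.zr h.qr h.zq

theorem Crosser.sign_after (hx : IsAdmissibleMotion x) (h : Crosser x r q u s t e) {g : ℝ}
    (hg : t < g) (h0 : oo x r u q g = 0) :
    (∀ τ ∈ Ioo t g, oo x r u q τ < 0) ∧ ∀ τ, g < τ → 0 < oo x r u q τ := by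
  have hge : e < g := by
    by_contra hn
    have := h.neg g ⟨hg, not_lt.mp hn⟩
    linarith
  exact sign_after_second_zero (hx.continuous_oo r u q) (h.oo_zeros hx)
    (oo_sign_change hx h.zr h.qr h.zq h0) h.zero h0 ⟨h.lt₂, hge⟩ (h.neg e ⟨h.lt₂, le_rfl⟩)

theorem Ratio.not_under_pos {l : ℝ} (hx : IsAdmissibleMotion x) (hqr : q ≠ r) (hqu : u ≠ q)
    (hl : Ratio x r u q t l) (h : ¬ Under x r q u t) : 0 < l * (l - 1) := by
  have h0 := hx.ratio_ne_zero hqr hl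
  have h1 := hx.ratio_ne_one hqu hl
  rcases lt_or_gt_of_ne h0 with h2 | h2
  · exact mul_pos_of_neg_of_neg h2 (by linarith)
  · rcases lt_or_gt_of_ne h1 with h3 | h3
    · exact absurd ⟨l, h2, h3, hl⟩ h
    · exact mul_pos h2 (by linarith)

theorem DelaunayAt.ratio_pos' {X : Finset (Fin n)} {z w : Fin n} {l : ℝ}
    (hx : IsAdmissibleMotion x) (h : DelaunayAt x X z r t) (hw : w ∈ X) (hwr : w ≠ r) (hzw : z ≠ w)
    (hl : Ratio x r z w t l) : 0 < l * (l - 1) := by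
  have h1 := h.ratio_pos hw (hx.nn_pos h.2.2.1 t) hl
  refine lt_of_le_of_ne h1 (mul_ne_zero (hx.ratio_ne_zero hwr hl) ?_).symm
  have := hx.ratio_ne_one hzw hl
  intro h; exact this (by linarith)

/-- Two aligned points that are mutually Delaunay neighbours of `r` lie on opposite sides. -/
theorem Ratio.neg_of_mutual {X Y : Finset (Fin n)} {z w : Fin n} {l : ℝ}
    (hx : IsAdmissibleMotion x) (hz : DelaunayAt x X z r t) (hw : DelaunayAt x Y w r t)
    (hwX : w ∈ X) (hzY : z ∈ Y) (hzw : z ≠ w) (hl : Ratio x r z w t l) : l < 0 := by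
  have h1 := hz.ratio_pos' hx hwX hw.2.2.1 hzw hl
  have hl0 := hx.ratio_ne_zero hw.2.2.1 hl
  have h2 := hw.ratio_pos' hx hzY hz.2.2.1 hzw.symm (hl.symm hl0)
  by_contra hn
  have hp : 0 < l := lt_of_le_of_ne (not_lt.mp hn) hl0.symm
  have h3 : 1 < l := by by_contra h; nlinarith
  have h4 := inv_lt_one_of_one_lt₀ h3
  have h5 := inv_pos.mpr hp
  nlinarith

/-- While a crosser `u` of `q`, `r` persists as a Delaunay neighbour of `r` in a set containing
a later crosser `y`, and `q` does not pass under `u`, the point `q` stays on its new side. -/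
theorem Crosser.later (hx : IsAdmissibleMotion x) (hu : Crosser x r q u s t e)
    (hy : Crosser x r q y s' t' e') (hne : u ≠ y) (ht : t < t') {X : Finset (Fin n)} (hyX : y ∈ X)
    (hX : ∀ τ ∈ Icc t e', DelaunayAt x X u r τ) (hNU : ∀ τ ∈ Ioc e e', ¬ Under x r q u τ) :
    (∀ τ ∈ Ioc t e', oo x r u q τ < 0) ∧ ∀ τ ∈ Icc t' e', 0 < oo x r u y τ := by
  have hss := hu.start_lt hx hy hne ht
  have hee := hu.end_lt hx hy hne ht
  have hDc := hx.continuous_DD r u q y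
  have hDz := encard_DD_zeros hx hu.zr hu.qr hy.zr hu.zq hne hy.zq.symm
  have d1 := hu.DD_pos y hne.symm hy.zq hy.zr
  have d2 := hu.DD_neg y hne.symm hy.zq hy.zr
  have d3 : DD x r u q y s' < 0 := by
    have := hy.DD_pos u hne hu.zq hu.zr
    rw [← DD_cycle, DD_swap] at this; linarith
  have d4 : 0 < DD x r u q y e' := by
    have := hy.DD_neg u hne hu.zq hu.zr
    rw [← DD_cycle, DD_swap] at this; linarith
  have hmax : max e s' < e' := max_lt hee hy.lt
  have dmax : DD x r u q y (max e s') ≤ 0 := by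
    rcases max_choice e s' with h | h <;> rw [h] <;> linarith
  -- The determinant of `u`, `q`, `y` is positive at `s`, negative at `e` and at `s'`, and positive
  -- at `e'`. Three zeros leave no room for a positive value between `e` and the last zero `h₂`.
  obtain ⟨h₂, hh₂, h20, h2pos⟩ := exists_last_zero hDc hmax.le dmax d4
  have h2e : e < h₂ := lt_of_le_of_ne ((le_max_left _ _).trans hh₂.1) (by rintro rfl; linarith)
  have h2s : s' < h₂ := lt_of_le_of_ne ((le_max_right _ _).trans hh₂.1) (by rintro rfl; linarith)
  have hbefore : ∀ᶠ τ in 𝓝[<] h₂, DD x r u q y τ < 0 := by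
    rcases DD_sign_change hx hu.zr hu.qr hy.zr hu.zq hne hy.zq.symm h20 with h | h
    · obtain ⟨τ, h1, h2⟩ := (h.2.and (Ioc_mem_nhdsGT hh₂.2)).exists
      have := h2pos τ h2
      linarith
    · exact h.1
  have hmidneg : ∀ τ ∈ Ioo e h₂, DD x r u q y τ < 0 := by
    have hnp : ∀ τ ∈ Ioo e h₂, ¬ 0 < DD x r u q y τ := by
      intro τ hτ hp
      obtain ⟨v, h1, h2⟩ := (hbefore.and (Ioo_mem_nhdsLT hτ.2)).exists
      exact five_alternation_absurd hDc hDz hu.lt hτ.1 h2.1 (h2.2.trans hh₂.2) d1 d2 hp h1 d4.le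
    intro τ hτ
    rcases lt_trichotomy (DD x r u q y τ) 0 with h | h | h
    · exact h
    · rcases DD_sign_change hx hu.zr hu.qr hy.zr hu.zq hne hy.zq.symm h with h' | h'
      · obtain ⟨v, h1, h2⟩ := (h'.1.and (Ioo_mem_nhdsLT hτ.1)).exists
        exact absurd h1 (hnp v ⟨h2.1, h2.2.trans hτ.2⟩)
      · obtain ⟨v, h1, h2⟩ := (h'.2.and (Ioo_mem_nhdsGT hτ.2)).exists
        exact absurd h1 (hnp v ⟨hτ.1.trans h2.1, h2.2⟩)
    · exact absurd h (hnp τ hτ)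
  have hI : ∀ᶠ v in 𝓝 h₂, v ∈ Icc s' e' := Icc_mem_nhds h2s hh₂.2
  have hya := hI.mono hy.alive
  have hqa := hI.mono hy.alive_q
  have hcc := hx.continuous_oo r u q
  have hyc := hx.continuous_oo r y u
  have h2t' : h₂ ≠ t' := by
    rintro rfl
    exact DD_ne_zero_of_oo_eq_zero hx hy.zr hy.qr hy.zq hy.zero hu.zr hu.qr hy.zr hu.zq hne
      hy.zq.symm h20
  have hmain : ∀ τ ∈ Ioc t e', oo x r u q τ ≠ 0 := by
    rcases lt_or_gt_of_ne h2t' with hlt | hgt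
    -- At `h₂` the point `u` lies angularly between the neighbours `y` and `q`, so `q` has returned
    -- to the left of `u` at some time `f`. Since `q` is not under `u`, the sign of the determinant
    -- puts `y` to the left of `u` at time `f`. Then `y` aligns with `u` before `h₂`, which
    -- conflicts with the determinant being negative there.
    · exfalso
      have ho := hy.pos h₂ ⟨h2s.le, hlt⟩
      obtain ⟨b1, b2⟩ := between_of_DD_eq_zero hx hu.zr hy.zr hu.qr hne hu.zq hy.zq hya hqa
        (by rw [DD_swap', h20, neg_zero]) ho
      obtain ⟨f, hf, f0⟩ := exists_zero_of_neg_pos hcc h2e (hu.neg e ⟨hu.lt₂, le_rfl⟩) b2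
      obtain ⟨_, hafter⟩ := hu.sign_after hx (hu.lt₂.trans hf.1) f0
      obtain ⟨l, hl⟩ := hx.exists_ratio hu.zr f0
      have hl1 := hl.not_under_pos hx hu.qr hu.zq (hNU f ⟨hf.1, hf.2.le.trans hh₂.2.le⟩)
      have hDf := hmidneg f hf
      rw [DD_swap', hl.DD_eq] at hDf
      have hyf : oo x r y u f < 0 := by
        rw [oo_swap]
        by_contra hn
        have := mul_nonneg_of_nonpos_of_nonpos
          (mul_nonpos_of_nonpos_of_nonneg (by linarith : oo x r u y f ≤ 0)
            (nn_nonneg (x := x) (r := r) (a := u) (t := f))) (neg_nonpos.mpr hl1.le)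
        linarith
      obtain ⟨f', hf', f0'⟩ := exists_zero_of_neg_pos hyc hf.2 hyf b1
      have f0u : oo x r u y f' = 0 := by rw [oo_swap, f0', neg_zero]
      obtain ⟨m, hm⟩ := hx.exists_ratio hu.zr f0u
      have hm1 := (hX f' ⟨by linarith [hu.lt₂, hf.1, hf'.1], by linarith [hf'.2, hh₂.2]⟩).ratio_pos'
        hx hyX hy.zr hne hm
      have hDf' := hmidneg f' ⟨hf.1.trans hf'.1, hf'.2⟩
      rw [hm.DD_eq] at hDf'
      have := mul_pos (mul_pos (hafter f' hf'.1) (hx.nn_pos hu.zr f')) hm1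
      linarith
    -- Here `q` is still to the right of `u` at `h₂`. A later return at `f` would happen opposite to
    -- `u`. It would force `y` and `u` to align oppositely between `h₂` and `f`, contrary to `q`
    -- being to the right of both.
    · have ho := hy.neg h₂ ⟨hgt, hh₂.2.le⟩
      obtain ⟨b1, b2⟩ := between_of_DD_eq_zero hx hu.zr hu.qr hy.zr hu.zq hne hy.zq.symm hqa hya
        h20 (by rw [oo_swap]; linarith)
      intro f hf f0
      obtain ⟨hbef, hafter⟩ := hu.sign_after hx hf.1 f0
      have hcneg : oo x r u q h₂ < 0 := by rw [oo_swap]; linarith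
      have hfh : h₂ < f := by
        by_contra hn
        rcases (not_lt.mp hn).eq_or_lt with h | h
        · subst h; linarith
        · have := hafter h₂ h; linarith
      obtain ⟨l, hl⟩ := hx.exists_ratio hu.zr f0
      have hl1 := hl.not_under_pos hx hu.qr hu.zq (hNU f ⟨h2e.trans hfh, hf.2⟩)
      have hl2 := (hy.alive_q f ⟨h2s.le.trans hfh.le, hf.2⟩).ratio_pos' hx (Finset.mem_univ u)
        hu.zr hu.zq.symm (hl.symm (hx.ratio_ne_zero hu.qr hl))
      have hl0 : l < 0 := by
        by_contra hn
        have hp : 0 < l := lt_of_le_of_ne (not_lt.mp hn) (hx.ratio_ne_zero hu.qr hl).symm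
        have h3 : 1 < l := by by_contra h; nlinarith
        have h4 := inv_lt_one_of_one_lt₀ h3
        have h5 := inv_pos.mpr hp
        nlinarith
      have hyf : 0 < oo x r y u f := by
        have h6 := hy.neg f ⟨hgt.trans hfh, hf.2⟩
        rw [hl.oo_right] at h6
        by_contra hn
        have := mul_nonneg_of_nonpos_of_nonpos hl0.le (not_lt.mp hn)
        linarith
      obtain ⟨f', hf', f0'⟩ := exists_zero_of_neg_pos hyc hfh (by rw [oo_swap]; linarith) hyf
      have f0u : oo x r u y f' = 0 := by rw [oo_swap, f0', neg_zero]
      obtain ⟨m, hm⟩ := hx.exists_ratio hu.zr f0u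
      have hm1 := hm.neg_of_mutual hx
        (hX f' ⟨by linarith [hu.lt₂, h2e, hf'.1], by linarith [hf'.2, hf.2]⟩)
        (hy.alive f' ⟨by linarith [hf'.1], by linarith [hf'.2, hf.2]⟩) hyX (Finset.mem_univ _) hne
      have h7 := hy.neg f' ⟨hgt.trans hf'.1, hf'.2.le.trans hf.2⟩
      rw [hm.oo_left] at h7
      have h8 := hbef f' ⟨hu.lt₂.trans (h2e.trans hf'.1), hf'.2⟩
      have := mul_pos_of_neg_of_neg hm1 h8
      linarith
  have hneg : ∀ τ ∈ Ioc t e', oo x r u q τ < 0 := by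
    intro τ hτ
    by_contra hn
    have hp : 0 < oo x r u q τ := lt_of_le_of_ne (not_lt.mp hn) (hmain τ hτ).symm
    have he := hu.neg e ⟨hu.lt₂, le_rfl⟩
    rcases lt_trichotomy τ e with h | h | h
    · obtain ⟨v, hv, h0⟩ := exists_zero_of_pos_neg hcc h hp he
      exact hmain v ⟨hτ.1.trans hv.1, hv.2.le.trans hee.le⟩ h0
    · subst h; linarith
    · obtain ⟨v, hv, h0⟩ := exists_zero_of_neg_pos hcc h he hp
      exact hmain v ⟨hu.lt₂.trans hv.1, hv.2.le.trans hτ.2⟩ h0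
  refine ⟨hneg, pos_of_ne_zero_right (hx.continuous_oo r u y) ?_ fun τ hτ h0 => ?_⟩
  · obtain ⟨l, hl, h1⟩ := hy.opposite
    rw [h1.oo_right]
    exact mul_pos_of_neg_of_neg hl (hneg t' ⟨ht, hy.lt₂.le⟩)
  · obtain ⟨m, hm⟩ := hx.exists_ratio hu.zr h0
    have hm1 := hm.neg_of_mutual hx (hX τ ⟨ht.le.trans hτ.1, hτ.2⟩)
      (hy.alive τ ⟨hy.lt₁.le.trans hτ.1, hτ.2⟩) hyX (Finset.mem_univ _) hne
    have h8 := mul_pos_of_neg_of_neg hm1 (hneg τ ⟨ht.trans_le hτ.1, hτ.2⟩)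
    rw [← hm.oo_left] at h8
    rcases hτ.1.eq_or_lt with h | h
    · subst h; rw [hy.zero] at h8; exact lt_irrefl _ h8
    · have := hy.neg τ ⟨h, hτ.2⟩
      linarith

/-- The mirror image of `Crosser.later`. -/
theorem Crosser.earlier (hx : IsAdmissibleMotion x) (hu : Crosser x r q u s t e)
    (hy : Crosser x r q y s' t' e') (hne : u ≠ y) (ht : t' < t) {X : Finset (Fin n)} (hyX : y ∈ X)
    (hX : ∀ τ ∈ Icc s' t, DelaunayAt x X u r τ) (hNU : ∀ τ ∈ Ico s' s, ¬ Under x r q u τ) :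
    (∀ τ ∈ Ico s' t, 0 < oo x r u q τ) ∧ ∀ τ ∈ Icc s' t', 0 < oo x r y u τ := by
  obtain ⟨h1, h2⟩ := hu.mirror.later hx.mirror hy.mirror hne (neg_lt_neg ht) hyX
    (fun τ hτ => delaunayAt_mirror.mpr (hX (-τ) ⟨by linarith [hτ.2], by linarith [hτ.1]⟩))
    (fun τ hτ => under_mirror.not.mpr (hNU (-τ) ⟨by linarith [hτ.2], by linarith [hτ.1]⟩))
  constructor
  · intro τ hτ
    have := h1 (-τ) ⟨by linarith [hτ.2], by linarith [hτ.1]⟩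
    rw [oo_mirror, neg_neg] at this
    linarith
  · intro τ hτ
    have := h2 (-τ) ⟨by linarith [hτ.2], by linarith [hτ.1]⟩
    rw [oo_mirror, neg_neg, ← oo_swap] at this
    exact this

/-- A triple has at most one single crossing. -/
theorem IsSingleCrossing.unique (hx : IsAdmissibleMotion x) {s₀ s₁ s₀' s₁' : ℝ}
    (h : IsSingleCrossing x u q r s₀ s₁) (h' : IsSingleCrossing x u q r s₀' s₁') :
    s₀ = s₀' ∧ s₁ = s₁' := by
  obtain ⟨t, ht, _, hc, _⟩ := id h.2
  obtain ⟨t', ht', _, hc', _⟩ := id h'.2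
  have horient : ∀ τ, orient (x u τ) (x q τ) (x r τ) = oo x r u q τ := by
    intro τ; unfold orient oo relX relY; ring
  simp only [CrossesLeftToRight, horient] at hc hc'
  have hz := encard_oo_zeros hx h.ne₁ h.ne₂ h.ne₃
  have hcont := hx.continuous_oo r u q
  -- Each hit is a change of sign from positive to negative. Two of them would need a third
  -- collinearity in between.
  have order : ∀ {a b : ℝ}, (∀ᶠ τ in 𝓝[>] a, oo x r u q τ < 0) →
      (∀ᶠ τ in 𝓝[<] b, 0 < oo x r u q τ) → oo x r u q a = 0 → oo x r u q b = 0 → ¬ a < b := by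
    intro a b ha hb ha0 hb0 hab
    obtain ⟨y, h1, h2⟩ := (ha.and (Ioo_mem_nhdsGT hab)).exists
    obtain ⟨w, h3, h4⟩ := (hb.and (Ioo_mem_nhdsLT h2.2)).exists
    obtain ⟨v, hv, h0⟩ := exists_zero_of_neg_pos hcont h4.1 h1 h3
    exact three_zeros_absurd hz (h2.1.trans hv.1) (hv.2.trans h4.2) ha0 h0 hb0
  have htt : t = t' := le_antisymm (not_lt.mp (order hc'.2.2 hc.1 hc'.2.1 hc.2.1))
    (not_lt.mp (order hc.2.2 hc'.1 hc.2.1 hc'.2.1))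
  subst htt
  -- With a common hit the intervals overlap. Their ends agree because the edge is present just
  -- outside either interval and absent inside.
  have start : ∀ {a b a' b' : ℝ}, IsSingleCrossing x u q r a b → IsSingleCrossing x u q r a' b' →
      t ∈ Icc a b → t ∈ Icc a' b' → ¬ a < a' := by
    intro a b a' b' h1 h2 h3 h4 hlt
    obtain ⟨y, h5, h6⟩ := (h2.1.leaves.and (Ioo_mem_nhdsLT hlt)).exists
    exact h1.1.absent y ⟨h6.1, h6.2.trans_le (h4.1.trans h3.2)⟩ h5
  have fin : ∀ {a b a' b' : ℝ}, IsSingleCrossing x u q r a b → IsSingleCrossing x u q r a' b' →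
      t ∈ Icc a b → t ∈ Icc a' b' → ¬ b < b' := by
    intro a b a' b' h1 h2 h3 h4 hlt
    obtain ⟨y, h5, h6⟩ := (h1.1.returns.and (Ioo_mem_nhdsGT hlt)).exists
    exact h2.1.absent y ⟨(h4.1.trans h3.2).trans_lt h6.1, h6.2⟩ h5
  exact ⟨le_antisymm (not_lt.mp (start h' h ht' ht)) (not_lt.mp (start h h' ht ht')),
    le_antisymm (not_lt.mp (fin h' h ht' ht)) (not_lt.mp (fin h h' ht ht'))⟩

end

/-! ### Delaunay triangles at `r`, and whether `q` is in their circles. -/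

/-- The triangle `abc` is positively oriented, and its circumcircle has all other points of `R`
strictly outside. -/
def StrictTri {n : ℕ} (x : Fin n → ℝ → Plane) (R : Finset (Fin n)) (a b c : Fin n) (t : ℝ) : Prop :=
  0 < oo x a b c t ∧ ∀ z ∈ R, z ≠ a → z ≠ b → z ≠ c → 0 < DD x a b c z t

section
variable {n : ℕ} {x : Fin n → ℝ → Plane} {r q u v w y z p : Fin n} {R Q X : Finset (Fin n)}
  {t τ : ℝ} {su tu eu sy ty ey sp tp ep sz tz ez α₀ α₁ : ℝ}

theorem oo_self_right : oo x r u r t = 0 := by simp [oo, relX_self, relY_self]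

theorem oo_self_left : oo x r r u t = 0 := by simp [oo, relX_self, relY_self]

theorem oo_self : oo x r u u t = 0 := by unfold oo; ring

theorem StrictTri.ne₁ (h : StrictTri x R r u v t) : u ≠ r := by
  rintro rfl; have := h.1; rw [oo_self_left] at this; exact lt_irrefl _ this

theorem StrictTri.ne₂ (h : StrictTri x R r u v t) : v ≠ r := by
  rintro rfl; have := h.1; rw [oo_self_right] at this; exact lt_irrefl _ this

theorem StrictTri.ne₃ (h : StrictTri x R r u v t) : u ≠ v := by
  rintro rfl; have := h.1; rw [oo_self] at this; exact lt_irrefl _ this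

theorem StrictTri.DD_nonneg (h : StrictTri x R r u v t) (hz : z ∈ R) : 0 ≤ DD x r u v z t := by
  by_cases h1 : z = r
  · rw [h1, DD_origin]
  by_cases h2 : z = u
  · rw [h2, DD_self_left]
  by_cases h3 : z = v
  · rw [h3, DD_self_right]
  exact (h.2 z hz h1 h2 h3).le

theorem StrictTri.alive_left (h : StrictTri x R r u v t) (hr : r ∈ R) (hu : u ∈ R) :
    DelaunayAt x R u r t :=
  delaunayAt_of_DD_nonneg hu hr h.ne₁ h.1 fun _ hz => h.DD_nonneg hz

theorem StrictTri.alive_right (h : StrictTri x R r u v t) (hr : r ∈ R) (hv : v ∈ R) :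
    DelaunayAt x R v r t :=
  delaunayAt_of_DD_nonneg_right hv hr h.ne₂ h.1.ne' fun _ hz => div_nonneg (h.DD_nonneg hz) h.1.le

theorem strictTri_mirror :
    StrictTri (mirrorMotion x) R r u v t ↔ StrictTri x R r v u (-t) := by
  unfold StrictTri
  simp only [oo_mirror, DD_mirror]
  rw [oo_swap u v]
  refine and_congr Iff.rfl (forall₂_congr fun z _ => ?_)
  rw [DD_swap u v]
  tauto

/-- The counterclockwise neighbour `w` of `p` is different from a crosser `u`, and follows it. -/
theorem neighbour_after_crosser (hx : IsAdmissibleMotion x) (hp : Crosser x r q p sp tp ep)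
    (hu : Crosser x r q u su tu eu) (hy : Crosser x r q y sy ty ey) (hpu : p ≠ u) (hpy : p ≠ y)
    (huy : u ≠ y) (hut : tu < ty) (hyt : ty < tp) (huX : u ∈ X) (hyX : y ∈ X)
    (hX : ∀ τ ∈ Icc su tp, DelaunayAt x X p r τ) (hNU : ∀ τ ∈ Ico su sp, ¬ Under x r q p τ)
    (huQ : u ∈ Q) (hyQ : y ∈ Q) (hS : ∀ τ ∈ Icc su tp, StrictTri x (insert p Q) r w p τ) :
    u ≠ w ∧ 0 < oo x r u w tu := by
  have hsy := hu.start_lt hx hy huy hut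
  have hsp := hy.start_lt hx hp hpy.symm hyt
  obtain ⟨-, a1⟩ := hp.earlier hx hu hpu (hut.trans hyt) huX hX hNU
  obtain ⟨-, y1⟩ := hp.earlier hx hy hpy hyt hyX
    (fun τ hτ => hX τ ⟨hsy.le.trans hτ.1, hτ.2⟩) (fun τ hτ => hNU τ ⟨hsy.le.trans hτ.1, hτ.2⟩)
  have hne : u ≠ w := by
    rintro rfl
    -- If `u = w`, then `q` has to be to the right of `u` at `ty`: otherwise it stays on the left
    -- until `tp`, where it is opposite to `p`, and `p` could not be to the left of `w`. The
    -- neighbour `y`, opposite to `q`, then lies angularly between `u` and `p`, and hence within the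
    -- circle of the triangle `r u p`.
    have hcy : oo x r u q ty < 0 := by
      by_contra hn
      have hne0 := oo_ne_zero_of_oo_eq_zero hx hy.zr hy.qr hy.zq hy.zero hu.zr hu.qr hu.zq
        (Or.inl ⟨huy, hu.zq⟩)
      have hpos : 0 < oo x r u q ty := lt_of_le_of_ne (not_lt.mp hn) hne0.symm
      have het : eu < ty := by
        by_contra h
        have := hu.neg ty ⟨hut, not_lt.mp h⟩
        linarith
      obtain ⟨f, hf, f0⟩ := exists_zero_of_neg_pos (hx.continuous_oo r u q) het
        (hu.neg eu ⟨hu.lt₂, le_rfl⟩) hpos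
      have h1 := (hu.sign_after hx (hu.lt₂.trans hf.1) f0).2 tp (hf.2.trans hyt)
      obtain ⟨l, hl, h2⟩ := hp.opposite
      have h3 := (hS tp ⟨by linarith [hu.lt₁], le_rfl⟩).1
      rw [h2.oo_right] at h3
      have := mul_neg_of_neg_of_pos hl h1
      linarith
    obtain ⟨l, hl, h2⟩ := hy.opposite
    have huy' : 0 < oo x r u y ty := by
      rw [h2.oo_right]; exact mul_pos_of_neg_of_neg hl hcy
    have h3 := (hy.alive ty ⟨hy.lt₁.le, hy.lt₂.le⟩).DD_nonneg (Finset.mem_univ u)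
      (Finset.mem_univ p) huy'.le (y1 ty ⟨hy.lt₁.le, le_rfl⟩).le
    have h4 := (hS ty ⟨by linarith [hu.lt₁], hyt.le⟩).2 y (by simp [hyQ]) hy.zr huy.symm hpy.symm
    rw [DD_swap'] at h4
    linarith
  refine ⟨hne, ?_⟩
  -- Otherwise the neighbour `u` lies angularly between `w` and `p`, contrary to the empty circle of
  -- `r w p`.
  by_contra hn
  have h1 : 0 ≤ oo x r w u tu := by rw [oo_swap]; linarith
  have h3 := (hu.alive tu ⟨hu.lt₁.le, hu.lt₂.le⟩).DD_nonneg (Finset.mem_univ w)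
    (Finset.mem_univ p) h1 (a1 tu ⟨hu.lt₁.le, le_rfl⟩).le
  have h4 := (hS tu ⟨hu.lt₁.le, by linarith⟩).2 u (by simp [huQ]) hu.zr hne hpu.symm
  rw [DD_swap'] at h4
  linarith

/-- At the end of the next crossing, `q` has entered the circle of the triangle `r u v`. -/
theorem inside_at_end (hx : IsAdmissibleMotion x) (hu : Crosser x r q u su tu eu)
    (hy : Crosser x r q y sy ty ey) (huy : u ≠ y) (hut : tu < ty) (hr : r ∈ R) (huR : u ∈ R)
    (hyR : y ∈ R) (hvR : v ∈ R) (hqR : q ∉ R)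
    (hS : ∀ τ ∈ Icc tu ey, ∃ v ∈ R, StrictTri x R r u v τ) (hv : StrictTri x R r u v ey)
    (hNU : ∀ τ ∈ Ioc eu ey, ¬ Under x r q u τ) : DD x r u v q ey < 0 := by
  obtain ⟨h1, h2⟩ := hu.later hx hy huy hut hyR
    (fun τ hτ => by obtain ⟨v, _, h⟩ := hS τ hτ; exact h.alive_left hr huR) hNU
  have hvq : v ≠ q := by rintro rfl; exact hqR hvR
  have hqu := hy.DD_neg u huy hu.zq hu.zr
  by_cases hvy : v = y
  · subst hvy
    rw [← DD_cycle]; exact hqu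
  have hqv := hy.DD_neg v hvy hvq hv.ne₂
  have c0 := h1 ey ⟨by linarith [hy.lt₂], le_rfl⟩
  have c1 := h2 ey ⟨hy.lt₂.le, le_rfl⟩
  have c2 := hy.neg ey ⟨hy.lt₂, le_rfl⟩
  have c3 := hv.1
  have c4 := hv.2 y hyR hy.zr huy.symm (Ne.symm hvy)
  -- Everything is expressed by the powers of `u` and `v` with respect to the circle through `r`,
  -- `y`, `q`, which is empty at `ey`. The Plücker relation between the four directions then
  -- combines the known inequalities.
  obtain ⟨y₀, y₁, key⟩ := DD_slack c2.ne
  have kq := key q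
  have ky := key y
  have ku := key u
  have kv := key v
  rw [DD_self_right, zero_div] at kq
  rw [DD_self_left, zero_div] at ky
  have su : 0 < nn x r u ey - y₀ * relX x r u ey - y₁ * relY x r u ey := by
    rw [ku]; exact div_pos_of_neg_of_neg hqu c2
  have sv : 0 < nn x r v ey - y₀ * relX x r v ey - y₁ * relY x r v ey := by
    rw [kv]; exact div_pos_of_neg_of_neg hqv c2
  rw [DD_expand y₀ y₁ 0, sub_zero, sub_zero, sub_zero, ky] at c4
  rw [DD_expand y₀ y₁ 0, sub_zero, sub_zero, sub_zero, kq]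
  set σu := nn x r u ey - y₀ * relX x r u ey - y₁ * relY x r u ey
  set σv := nn x r v ey - y₀ * relX x r v ey - y₁ * relY x r v ey
  have pl := oo_plucker (x := x) (r := r) (t := ey) q u v y
  rw [oo_swap u q, oo_swap y q, oo_swap v q] at pl
  rw [oo_swap u y] at c4
  rw [oo_swap u q]
  have m1 : 0 < oo x r u v ey * (-oo x r y q ey) * σu :=
    mul_pos (mul_pos c3 (by linarith)) su
  have m2 : 0 < (-oo x r u q ey) * (oo x r v y ey * σu - oo x r u y ey * σv) :=
    mul_pos (by linarith) (by linarith)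
  have m3 : 0 < oo x r u y ey * (-(oo x r v q ey) * σu + oo x r u q ey * σv) := by
    have : oo x r u y ey * (-(oo x r v q ey) * σu + oo x r u q ey * σv)
      = oo x r u v ey * (-oo x r y q ey) * σu
        + (-oo x r u q ey) * (oo x r v y ey * σu - oo x r u y ey * σv) := by
      linear_combination σu * pl
    rw [this]; linarith
  have := pos_of_mul_pos_right m3 c1.le
  linarith

/-- The mirror image of `inside_at_end`. -/
theorem inside_at_start (hx : IsAdmissibleMotion x) (hu : Crosser x r q u su tu eu)
    (hy : Crosser x r q y sy ty ey) (huy : u ≠ y) (hut : ty < tu) (hr : r ∈ R) (huR : u ∈ R)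
    (hyR : y ∈ R) (hvR : v ∈ R) (hqR : q ∉ R)
    (hS : ∀ τ ∈ Icc sy tu, ∃ v ∈ R, StrictTri x R r v u τ) (hv : StrictTri x R r v u sy)
    (hNU : ∀ τ ∈ Ico sy su, ¬ Under x r q u τ) : DD x r v u q sy < 0 := by
  have := inside_at_end hx.mirror hu.mirror hy.mirror huy (neg_lt_neg hut) hr huR hyR hvR hqR
    (fun τ hτ => ?_) (strictTri_mirror.mpr (by rwa [neg_neg]))
    (fun τ hτ => under_mirror.not.mpr (hNU (-τ) ⟨by linarith [hτ.2], by linarith [hτ.1]⟩))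
  · rw [DD_mirror, neg_neg, ← DD_swap] at this
    exact this
  · obtain ⟨v, hv, h⟩ := hS (-τ) ⟨by linarith [hτ.2], by linarith [hτ.1]⟩
    exact ⟨v, hv, strictTri_mirror.mpr h⟩

/-- If `q` lies far behind the edges of the triangles at `u`, it lies outside their circles. -/
theorem outside_of_neighbour (hwR : w ∈ R) (ha : 0 < oo x r u p t) (hw : 0 < oo x r u w t) (hc : 0 < oo x r u q t)
    (hD : 0 ≤ DD x r u p q t) (hwp : 0 < DD x r u w p t) :
    (∀ v ∈ R, StrictTri x R r u v t → 0 < DD x r u v q t) ∧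
    (∀ v ∈ R, StrictTri x R r v u t → 0 < DD x r v u q t) := by
  have hwne : oo x r u w t ≠ 0 := hw.ne'
  -- Powers are taken with respect to the circle through `r`, `u`, `w`. The points `p` and hence `q`
  -- are outside. Since `w` is not inside the circle of the triangle at `ru`, the power of `v` has
  -- the sign that leaves `q` outside that circle.
  obtain ⟨y₀, y₁, key⟩ := DD_slack hwne
  have kw := key w
  have ku := key u
  rw [DD_self_right, zero_div] at kw
  rw [DD_self_left, zero_div] at ku
  set σ : Fin n → ℝ := fun z => nn x r z t - y₀ * relX x r z t - y₁ * relY x r z t with hσ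
  have ex : ∀ a b c, DD x r a b c t = oo x r a b t * σ c + oo x r b c t * σ a
      + oo x r c a t * σ b := by
    intro a b c
    rw [DD_expand y₀ y₁ 0]; simp [hσ]
  have σu : σ u = 0 := ku
  have σw : σ w = 0 := kw
  have σp : 0 < σ p := by
    have : σ p = DD x r u w p t / oo x r u w t := key p
    rw [this]; exact div_pos hwp hw
  have σq : 0 < σ q := by
    rw [ex, σu, oo_swap u q] at hD
    have h1 : 0 < oo x r u p t * σ q := by
      have := mul_pos hc σp
      linarith
    exact pos_of_mul_pos_right h1 ha.le
  constructor
  · intro v hv h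
    have h1 := h.DD_nonneg hwR
    rw [ex, σu, σw, oo_swap u w] at h1
    have h2 : σ v ≤ 0 := by
      by_contra hn
      have := mul_pos hw (not_le.mp hn)
      linarith
    rw [ex, σu, oo_swap u q]
    have h3 := mul_pos h.1 σq
    have h4 := mul_nonneg hc.le (neg_nonneg.mpr h2)
    linarith
  · intro v hv h
    have h1 := h.DD_nonneg hwR
    rw [ex, σu, σw] at h1
    have h2 : 0 ≤ σ v := by
      by_contra hn
      have := mul_pos hw (neg_pos.mpr (not_le.mp hn))
      linarith
    rw [ex, σu]
    have h3 := mul_pos h.1 σq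
    have h4 := mul_nonneg hc.le h2
    linarith

end

/-! ### Charged events: the fate of `q` after an event, and pairs of events. -/

/-- A crossing of the pair `p`, `q` by `r`, together with an interval `[α₀, α₁]` on which `pr` is
almost Delaunay, and a set `L` of earlier crossers of `q`, `r` within this interval. -/
structure ChargedEvent {n : ℕ} (x : Fin n → ℝ → Plane) (r : Fin n) where
  q : Fin n
  p : Fin n
  t₀ : ℝ
  t₁ : ℝ
  sp : ℝ
  tp : ℝ
  ep : ℝ
  α₀ : ℝ
  α₁ : ℝ
  A : Finset (Fin n)
  L : Finset (Fin n)
  a : Fin n → ℝ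
  b : Fin n → ℝ
  s : Fin n → ℝ
  t : Fin n → ℝ
  e : Fin n → ℝ
  single : IsSingleCrossing x p q r t₀ t₁
  crosser : Crosser x r q p sp tp ep
  sp_lt : sp < t₀
  le_t₀ : α₀ ≤ t₀
  t₁_le : t₁ ≤ α₁
  tp_le : tp ≤ α₁
  alive : ∀ τ ∈ Icc α₀ α₁, DelaunayAt x (Finset.univ \ A) p r τ
  alive₀ : DelaunayAt x Finset.univ p r α₀
  p_ne : ∀ u ∈ L, p ≠ u
  not_mem : ∀ u ∈ L, u ∉ A
  single' : ∀ u ∈ L, IsSingleCrossing x u q r (a u) (b u)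
  crosser' : ∀ u ∈ L, Crosser x r q u (s u) (t u) (e u)
  le_s : ∀ u ∈ L, α₀ ≤ s u
  s_lt : ∀ u ∈ L, s u < a u
  lt_e : ∀ u ∈ L, b u < e u
  e_le : ∀ u ∈ L, e u ≤ α₁
  t_lt : ∀ u ∈ L, t u < tp

namespace ChargedEvent
variable {n : ℕ} {x : Fin n → ℝ → Plane} {r u v v' w y z b : Fin n} {R Q : Finset (Fin n)}

/-- The point `q` does not pass under `p` before the crossing. -/
def Clear (E : ChargedEvent x r) : Prop := ∀ τ ∈ Ico E.α₀ E.t₀, ¬ Under x r E.q E.p τ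

theorem mem_sdiff (E : ChargedEvent x r) (hu : u ∈ E.L) : u ∈ Finset.univ \ E.A := by
  simp [E.not_mem u hu]

theorem s_lt_sp (E : ChargedEvent x r) (hx : IsAdmissibleMotion x) (hu : u ∈ E.L) :
    E.s u < E.sp :=
  (E.crosser' u hu).start_lt hx E.crosser (E.p_ne u hu).symm (E.t_lt u hu)

theorem earlier (E : ChargedEvent x r) (hx : IsAdmissibleMotion x) (hE : E.Clear) (hu : u ∈ E.L) :
    (∀ τ ∈ Ico (E.s u) E.tp, 0 < oo x r E.p E.q τ) ∧
      ∀ τ ∈ Icc (E.s u) (E.t u), 0 < oo x r u E.p τ :=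
  E.crosser.earlier hx (E.crosser' u hu) (E.p_ne u hu) (E.t_lt u hu) (E.mem_sdiff hu)
    (fun τ hτ => E.alive τ ⟨(E.le_s u hu).trans hτ.1, hτ.2.trans E.tp_le⟩)
    (fun τ hτ => hE τ ⟨(E.le_s u hu).trans hτ.1, hτ.2.trans E.sp_lt⟩)

theorem t_mem (E : ChargedEvent x r) (hu : u ∈ E.L) : E.t u ∈ Icc E.α₀ E.α₁ :=
  ⟨(E.le_s u hu).trans (E.crosser' u hu).lt₁.le, (E.t_lt u hu).le.trans E.tp_le⟩

theorem neighbour (E : ChargedEvent x r) (hx : IsAdmissibleMotion x) (hE : E.Clear) (hu : u ∈ E.L)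
    (hy : y ∈ E.L) (huy : E.t u < E.t y) (huQ : u ∈ Q) (hyQ : y ∈ Q)
    (hw : ∀ τ ∈ Icc E.α₀ E.α₁, StrictTri x (insert E.p Q) r w E.p τ) :
    u ≠ w ∧ 0 < oo x r u w (E.t u) :=
  neighbour_after_crosser hx E.crosser (E.crosser' u hu) (E.crosser' y hy) (E.p_ne u hu)
    (E.p_ne y hy) (by rintro rfl; exact lt_irrefl _ huy) huy (E.t_lt y hy) (E.mem_sdiff hu)
    (E.mem_sdiff hy)
    (fun τ hτ => E.alive τ ⟨(E.le_s u hu).trans hτ.1, hτ.2.trans E.tp_le⟩)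
    (fun τ hτ => hE τ ⟨(E.le_s u hu).trans hτ.1, hτ.2.trans E.sp_lt⟩) huQ hyQ
    (fun τ hτ => hw τ ⟨(E.le_s u hu).trans hτ.1, hτ.2.trans E.tp_le⟩)

/-- The angular order of `u`, `w`, `p` persists backwards in time. -/
theorem order_persists (E : ChargedEvent x r) (hx : IsAdmissibleMotion x) (hu : u ∈ E.L)
    (huw : u ≠ w) (huw' : 0 < oo x r u w (E.t u)) (hup : 0 < oo x r u E.p (E.t u))
    (hQR : Q ⊆ R) (huQ : u ∈ Q) (hr : r ∈ Q) (hwQ : w ∈ Q)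
    (hw : ∀ τ ∈ Icc E.α₀ E.α₁, StrictTri x (insert E.p Q) r w E.p τ)
    (hv : ∀ τ ∈ Icc E.α₀ E.α₁, DelaunayAt x R u r τ) {τ : ℝ} (hτ : E.α₀ ≤ τ) (hτu : τ ≤ E.t u)
    (hb : ∀ y ∈ Icc τ (E.t u), 0 ≤ oo x r E.p E.q y)
    (hc : ∀ y ∈ Ico τ (E.t u), 0 < oo x r u E.q y) :
    0 < oo x r u w τ ∧ 0 < oo x r u E.p τ := by
  by_contra hn
  have ha1 := hx.continuous_oo r u w
  have ha2 := hx.continuous_oo r u E.p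
  obtain ⟨κ, hκ, h0, hpos⟩ := exists_last_zero
    (f := fun y => min (oo x r u w y) (oo x r u E.p y)) (ha1.min ha2) hτu
    (by
      by_contra h
      exact hn (lt_min_iff.mp (not_le.mp h))) (lt_min huw' hup)
  have htu := E.t_mem hu
  have hκ' : κ ∈ Icc E.α₀ E.α₁ := ⟨hτ.trans hκ.1, hκ.2.le.trans htu.2⟩
  have h1 : 0 ≤ oo x r u w κ := h0 ▸ min_le_left (oo x r u w κ) (oo x r u E.p κ)
  have h2 : 0 ≤ oo x r u E.p κ := h0 ▸ min_le_right (oo x r u w κ) (oo x r u E.p κ)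
  have hwp := (hw κ hκ').1
  have hur := (E.crosser' u hu).zr
  rcases min_choice (oo x r u w κ) (oo x r u E.p κ) with h | h
  -- Going back in time, `u` and `w` could only align on opposite sides of `r`, since they are
  -- mutual neighbours. This would put `p` on the wrong side of `w`.
  · have h3 : oo x r u w κ = 0 := h.symm.trans h0
    obtain ⟨l, hl⟩ := hx.exists_ratio hur h3
    have hl0 := hl.neg_of_mutual hx (hv κ hκ') ((hw κ hκ').alive_left (by simp [hr])
      (by simp [hwQ])) (hQR hwQ) (by simp [huQ]) huw
    rw [hl.oo_left] at hwp
    have := mul_nonneg (neg_nonneg.mpr hl0.le) h2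
    linarith
  -- As `q` is to the left of `u` and not to the right of `p`, an alignment of `u` and `p` is on the
  -- same side of `r`. This too contradicts the order of `w` and `p`.
  · have h3 : oo x r u E.p κ = 0 := h.symm.trans h0
    obtain ⟨l, hl⟩ := hx.exists_ratio hur h3
    have hb' := hb κ ⟨hκ.1, hκ.2.le⟩
    have hc' := hc κ hκ
    rw [hl.oo_left] at hb'
    rw [hl.oo_right, oo_swap] at hwp
    have hl0 : 0 ≤ l := nonneg_of_mul_nonneg_left hb' hc'
    have := mul_nonneg hl0 h1
    linarith

/-- Before the crossing of `z`, there is a time at which `q` is outside of the triangles at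
`u`. -/
theorem exists_outside (E : ChargedEvent x r) (hx : IsAdmissibleMotion x) (hE : E.Clear)
    (hu : u ∈ E.L) (hz : z ∈ E.L) (hzu : E.t z ≤ E.t u) (huw : u ≠ w)
    (huw' : 0 < oo x r u w (E.t u)) (hQR : Q ⊆ R) (huQ : u ∈ Q) (hr : r ∈ Q) (hwQ : w ∈ Q)
    (hw : ∀ τ ∈ Icc E.α₀ E.α₁, StrictTri x (insert E.p Q) r w E.p τ)
    (hv : ∀ τ ∈ Icc E.α₀ E.α₁, DelaunayAt x R u r τ)
    (hc : ∀ y ∈ Ico E.α₀ (E.t u), 0 < oo x r u E.q y) :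
    ∃ τ ∈ Icc E.α₀ (E.s z), (∀ v ∈ R, StrictTri x R r u v τ → 0 < DD x r u v E.q τ) ∧
      (∀ v ∈ R, StrictTri x R r v u τ → 0 < DD x r v u E.q τ) := by
  have htu := E.t_mem hu
  have hsz := E.le_s z hz
  have hst : E.s z < E.t u := (E.crosser' z hz).lt₁.trans_le hzu
  have hszp := E.s_lt_sp hx hz
  have hbz := (E.earlier hx hE hz).1
  have hup := (E.earlier hx hE hu).2 (E.t u) ⟨(E.crosser' u hu).lt₁.le, le_rfl⟩
  have hupne := E.p_ne u hu
  have hpq := E.crosser.zq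
  have hpr := E.crosser.zr
  have hqr := E.crosser.qr
  -- The time is `α₀` if `q` is to the left of `p` from there until `s z`, since `p` is then a
  -- neighbour in the full set. Otherwise it is the last alignment of `p` and `q` before `s z`, at
  -- which `q` is not under `p` because the event is clear.
  suffices h : ∃ τ ∈ Icc E.α₀ (E.s z), 0 ≤ DD x r u E.p E.q τ ∧ 0 < oo x r u E.p τ ∧
      0 < oo x r u w τ by
    obtain ⟨τ, hτ, h1, h2, h3⟩ := h
    have hτ' : τ ∈ Icc E.α₀ E.α₁ := ⟨hτ.1, by linarith [hτ.2, htu.2]⟩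
    refine ⟨τ, hτ, outside_of_neighbour (hQR hwQ) h2 h3 (hc τ ⟨hτ.1, by linarith [hτ.2]⟩) h1 ?_⟩
    rw [← DD_cycle]
    exact (hw τ hτ').2 u (by simp [huQ]) (E.crosser' u hu).zr huw hupne.symm
  by_cases hall : ∀ τ ∈ Icc E.α₀ (E.s z), 0 < oo x r E.p E.q τ
  · have h := E.order_persists hx hu huw huw' hup hQR huQ hr hwQ hw hv le_rfl htu.1
      (fun y hy => by
        rcases le_or_gt y (E.s z) with h | h
        · exact (hall y ⟨hy.1, h⟩).le
        · exact (hbz y ⟨h.le, hy.2.trans_lt (E.t_lt u hu)⟩).le) hc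
    refine ⟨E.α₀, ⟨le_rfl, hsz⟩, ?_, h.2, h.1⟩
    exact E.alive₀.DD_nonneg (Finset.mem_univ _) (Finset.mem_univ _) h.2.le
      (hall _ ⟨le_rfl, hsz⟩).le
  · push Not at hall
    obtain ⟨τ₀, hτ₀, hle⟩ := hall
    obtain ⟨ι, hι, h0, hpos⟩ := exists_last_zero (hx.continuous_oo r E.p E.q) hτ₀.2 hle
      (hbz _ ⟨le_rfl, hst.trans (E.t_lt u hu)⟩)
    have hια : E.α₀ ≤ ι := hτ₀.1.trans hι.1
    have h := E.order_persists hx hu huw huw' hup hQR huQ hr hwQ hw hv hια (hι.2.le.trans hst.le)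
      (fun y hy => by
        rcases hy.1.eq_or_lt with rfl | h1
        · exact h0.ge
        rcases le_or_gt y (E.s z) with h | h
        · exact (hpos y ⟨h1, h⟩).le
        · exact (hbz y ⟨h.le, hy.2.trans_lt (E.t_lt u hu)⟩).le)
      (fun y hy => hc y ⟨hια.trans hy.1, hy.2⟩)
    refine ⟨ι, ⟨hια, hι.2.le⟩, ?_, h.2, h.1⟩
    obtain ⟨l, hl⟩ := hx.exists_ratio hpr h0
    have hl1 := hl.not_under_pos hx hqr hpq (hE ι ⟨hια, by linarith [hι.2, E.sp_lt]⟩)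
    have e : DD x r u E.p E.q ι = oo x r u E.p ι * nn x r E.p ι * (l * (l - 1)) := by
      have h2 := hl.DD_eq u
      rw [DD_swap u E.p, oo_swap u E.p] at h2
      linear_combination -h2
    rw [e]
    exact (mul_pos (mul_pos h.2 (hx.nn_pos hpr ι)) hl1).le

/-- The point `q` stays inside the circle of the triangle `r u v` after the event. -/
theorem inside_after (E : ChargedEvent x r) (hx : IsAdmissibleMotion x) (hE : E.Clear)
    (hu : u ∈ E.L) (hy : y ∈ E.L) (huy : E.t u < E.t y) (huw : u ≠ w)
    (huw' : 0 < oo x r u w (E.t u)) (hQR : Q ⊆ R) (huQ : u ∈ Q) (hyQ : y ∈ Q) (hr : r ∈ Q)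
    (hwQ : w ∈ Q) (hqR : E.q ∉ R) (hvR : v ∈ R)
    (hw : ∀ τ ∈ Icc E.α₀ E.α₁, StrictTri x (insert E.p Q) r w E.p τ)
    (hv : ∀ τ ∈ Icc E.α₀ E.α₁, StrictTri x R r u v τ)
    (hNU : ∀ τ ∈ Icc E.α₀ E.α₁, ¬ Under x r E.q u τ) :
    ∀ τ, E.α₁ ≤ τ → DD x r u v E.q τ < 0 := by
  have cu := E.crosser' u hu
  have cy := E.crosser' y hy
  have hne : u ≠ y := by rintro rfl; exact lt_irrefl _ huy
  have hvq : v ≠ E.q := by rintro rfl; exact hqR hvR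
  have hs := E.le_s u hu
  have he := E.e_le u hu
  have hs' := E.le_s y hy
  have he' := E.e_le y hy
  have hvne := hv (E.t u) (E.t_mem hu)
  have htu := E.t_mem hu
  have hee := cu.end_lt hx cy hne huy
  have d1 : DD x r u v E.q (E.s u) < 0 := by
    have := cu.DD_pos v hvne.ne₃.symm hvq hvne.ne₂
    rw [DD_swap'] at this; linarith
  have d2 : 0 < DD x r u v E.q (E.e u) := by
    have := cu.DD_neg v hvne.ne₃.symm hvq hvne.ne₂
    rw [DD_swap'] at this; linarith
  have d3 := inside_at_end hx cu cy hne huy (hQR hr) (hQR huQ) (hQR hyQ) hvR hqR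
    (fun τ hτ => ⟨v, hvR, hv τ ⟨htu.1.trans hτ.1, hτ.2.trans he'⟩⟩)
    (hv _ ⟨hs'.trans cy.lt.le, he'⟩)
    (fun τ hτ => hNU τ ⟨by linarith [hτ.1, cu.lt], hτ.2.trans he'⟩)
  -- If `q` was always to the left of `u`, then `exists_outside` applies. If not, then at an earlier
  -- alignment `q` is not under `u`, which already puts it outside the circle.
  have d0 : ∃ τ, τ ≤ E.s u ∧ 0 < DD x r u v E.q τ := by
    by_cases hc : ∀ y ∈ Ico E.α₀ (E.t u), 0 < oo x r u E.q y
    · obtain ⟨τ, hτ, h, -⟩ := E.exists_outside hx hE hu hu le_rfl huw huw' hQR huQ hr hwQ hw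
        (fun τ hτ => (hv τ hτ).alive_left (hQR hr) (hQR huQ)) hc
      exact ⟨τ, hτ.2, h v hvR (hv τ ⟨hτ.1, by linarith [hτ.2, cu.lt]⟩)⟩
    · push Not at hc
      obtain ⟨f₁, hf₁, hle⟩ := hc
      have hf₁s : f₁ ≤ E.s u := by
        by_contra h
        have := cu.pos f₁ ⟨(not_le.mp h).le, hf₁.2⟩
        linarith
      obtain ⟨f₀, hf₀, h0, -⟩ := exists_last_zero (hx.continuous_oo r u E.q) hf₁s hle
        (cu.pos _ ⟨le_rfl, cu.lt₁⟩)
      have hmem : f₀ ∈ Icc E.α₀ E.α₁ := ⟨hf₁.1.trans hf₀.1, by linarith [hf₀.2, cu.lt]⟩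
      obtain ⟨l, hl⟩ := hx.exists_ratio cu.zr h0
      refine ⟨f₀, hf₀.2.le, ?_⟩
      rw [hl.DD_eq]
      exact mul_pos (mul_pos (hv f₀ hmem).1 (hx.nn_pos cu.zr f₀))
        (hl.not_under_pos hx cu.qr cu.zq (hNU f₀ hmem))
  obtain ⟨τ₀, hτ₀, d0⟩ := d0
  have hlt : τ₀ < E.s u := lt_of_le_of_ne hτ₀ (by rintro rfl; linarith)
  intro τ hτ
  by_contra hn
  have hlast : E.e y < τ := lt_of_le_of_ne (he'.trans hτ) (by rintro rfl; exact hn d3)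
  -- The signs at `τ₀`, `s u`, `e u`, `e y` are `+ - + -`, so the three possible co-circularities
  -- are used up.
  exact five_alternation_absurd (hx.continuous_DD r u v E.q)
    (encard_DD_zeros hx cu.zr hvne.ne₂ cu.qr hvne.ne₃ cu.zq hvq) hlt cu.lt hee hlast d0 d1 d2 d3
    (not_lt.mp hn)

/-- The analogue of `inside_after` for the triangle on the other side of `u`. -/
theorem inside_after' (E : ChargedEvent x r) (hx : IsAdmissibleMotion x) (hE : E.Clear)
    (hu : u ∈ E.L) (hy : y ∈ E.L) (huy : E.t y < E.t u) (huw : u ≠ w)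
    (huw' : 0 < oo x r u w (E.t u)) (hQR : Q ⊆ R) (huQ : u ∈ Q) (hyQ : y ∈ Q) (hr : r ∈ Q)
    (hwQ : w ∈ Q) (hqR : E.q ∉ R) (hvR : v ∈ R)
    (hw : ∀ τ ∈ Icc E.α₀ E.α₁, StrictTri x (insert E.p Q) r w E.p τ)
    (hv : ∀ τ ∈ Icc E.α₀ E.α₁, StrictTri x R r v u τ)
    (hNU : ∀ τ ∈ Icc E.α₀ E.α₁, ¬ Under x r E.q u τ)
    (hc : ∀ y, y < E.t u → 0 < oo x r u E.q y) :
    ∀ τ, E.α₁ ≤ τ → DD x r v u E.q τ < 0 := by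
  have cu := E.crosser' u hu
  have cy := E.crosser' y hy
  have hne : u ≠ y := by rintro rfl; exact lt_irrefl _ huy
  have hvq : v ≠ E.q := by rintro rfl; exact hqR hvR
  have hs := E.le_s u hu
  have he := E.e_le u hu
  have hs' := E.le_s y hy
  have he' := E.e_le y hy
  have hvne := hv (E.t u) (E.t_mem hu)
  have htu := E.t_mem hu
  have hss := cy.start_lt hx cu hne.symm huy
  have d1 : 0 < DD x r v u E.q (E.s u) := by
    have := cu.DD_pos v hvne.ne₃ hvq hvne.ne₁
    rw [← DD_cycle]; exact this
  have d2 : DD x r v u E.q (E.e u) < 0 := by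
    have := cu.DD_neg v hvne.ne₃ hvq hvne.ne₁
    rw [← DD_cycle]; exact this
  have d3 := inside_at_start hx cu cy hne huy (hQR hr) (hQR huQ) (hQR hyQ) hvR hqR
    (fun τ hτ => ⟨v, hvR, hv τ ⟨hs'.trans hτ.1, hτ.2.trans htu.2⟩⟩)
    (hv _ ⟨hs', cy.lt.le.trans he'⟩)
    (fun τ hτ => hNU τ ⟨hs'.trans hτ.1, by linarith [hτ.2, cu.lt]⟩)
  obtain ⟨τ₀, hτ₀, -, d0⟩ := E.exists_outside hx hE hu hy huy.le huw huw' hQR huQ hr hwQ hw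
    (fun τ hτ => (hv τ hτ).alive_right (hQR hr) (hQR huQ)) (fun y hy => hc y hy.2)
  have d0 := d0 v hvR (hv τ₀ ⟨hτ₀.1, by linarith [hτ₀.2, cy.lt]⟩)
  have hlt : τ₀ < E.s y := lt_of_le_of_ne hτ₀.2 (by rintro rfl; linarith)
  intro τ hτ
  by_contra hn
  have hlast : E.e u < τ := lt_of_le_of_ne (he.trans hτ) (by rintro rfl; exact hn d2)
  -- Here the pattern `+ - + -` occurs at `τ₀`, `s y`, `s u`, `e u`.
  exact five_alternation_absurd (hx.continuous_DD r v u E.q)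
    (encard_DD_zeros hx hvne.ne₁ cu.zr cu.qr hvne.ne₃ hvq cu.zq) hlt hss cu.lt hlast d0 d3 d1 d2
    (not_lt.mp hn)

/-- If `q` was not always on the left of `u` before the crossing, it stays on the right
afterwards. -/
theorem right_after (E : ChargedEvent x r) (hx : IsAdmissibleMotion x) (hu : u ∈ E.L)
    (hc : ¬ ∀ y, y < E.t u → 0 < oo x r u E.q y) : ∀ τ, E.t u < τ → oo x r u E.q τ < 0 := by
  have cu := E.crosser' u hu
  push Not at hc
  obtain ⟨f₁, hf₁, hle⟩ := hc
  have hf₁s : f₁ ≤ E.s u := by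
    by_contra h
    have := cu.pos f₁ ⟨(not_le.mp h).le, hf₁⟩
    linarith
  obtain ⟨f₀, hf₀, h0, -⟩ := exists_last_zero (hx.continuous_oo r u E.q) hf₁s hle
    (cu.pos _ ⟨le_rfl, cu.lt₁⟩)
  intro τ hτ
  by_contra hn
  -- The alignments at `f₀` and at the hit exhaust the two collinearities of `r`, `u`, `q`.
  rcases le_or_gt τ (E.e u) with h | h
  · exact hn (cu.neg τ ⟨hτ, h⟩)
  · rcases (not_lt.mp hn).eq_or_lt with h1 | h1
    · exact three_zeros_absurd (cu.oo_zeros hx) (hf₀.2.trans cu.lt₁) hτ h0 cu.zero h1.symm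
    · obtain ⟨g, hg, g0⟩ := exists_zero_of_neg_pos (hx.continuous_oo r u E.q) h
        (cu.neg _ ⟨cu.lt₂, le_rfl⟩) h1
      exact three_zeros_absurd (cu.oo_zeros hx) (hf₀.2.trans cu.lt₁) (cu.lt₂.trans hg.1) h0
        cu.zero g0

/-- The event `E₂` does not interfere with the almost Delaunay edge of `E₁`. -/
def Free (E₁ E₂ : ChargedEvent x r) : Prop := E₂.q ∉ E₁.A ∧ E₂.q ≠ E₁.p

/-- Freeness keeps the point `q` of `E₂` in the set in which `pr` is Delaunay during `E₁`. So the
point `p` of `E₁` would survive the crossing of `u` in `E₂`. -/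
theorem Free.not_inside {E₁ E₂ : ChargedEvent x r} (hx : IsAdmissibleMotion x)
    (h : E₁.Free E₂) (h1 : u ∈ E₁.L) (h2 : u ∈ E₂.L) (hs : E₁.α₀ ≤ E₂.s u)
    (he : E₂.e u ≤ E₁.α₁) : False :=
  (E₂.crosser' u h2).exclusion hx (E₁.p_ne u h1) h.2.symm (E₁.mem_sdiff h1) (by simp [h.1])
    fun τ hτ => E₁.alive τ ⟨hs.trans hτ.1, hτ.2.trans he⟩

/-- Neither crossing of `u` fits into the interval of the other event, so each sticks out at its own
end. -/
theorem Free.order {E₁ E₂ : ChargedEvent x r} (hx : IsAdmissibleMotion x) (h12 : E₁.Free E₂)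
    (h21 : E₂.Free E₁) (h1 : u ∈ E₁.L) (h2 : u ∈ E₂.L) (hα : E₁.α₀ ≤ E₂.α₀) :
    E₁.s u < E₂.α₀ ∧ E₁.α₁ < E₂.e u := by
  have he : E₁.α₁ < E₂.e u := by
    by_contra h
    exact h12.not_inside hx h1 h2 (hα.trans (E₂.le_s u h2)) (not_lt.mp h)
  refine ⟨?_, he⟩
  by_contra h
  exact h21.not_inside hx h2 h1 (not_lt.mp h)
    ((E₁.e_le u h1).trans (he.le.trans (E₂.e_le u h2)))

/-- A final position of `q` relative to the Delaunay neighbour `u` of `r`. -/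
theorem alive_inside_absurd (hx : IsAdmissibleMotion x) {q : Fin n} {τ : ℝ}
    (ha : DelaunayAt x Finset.univ u r τ) (hv : 0 < oo x r u v τ)
    (hD : DD x r u v q τ < 0)
    (h : oo x r u q τ < 0 ∨ 0 < oo x r v' u τ ∧ DD x r v' u q τ < 0) : False := by
  rcases lt_trichotomy (oo x r u q τ) 0 with hc | hc | hc
  · have := ha.DD_nonneg (Finset.mem_univ q) (Finset.mem_univ v) (by rw [oo_swap]; linarith) hv.le
    rw [← DD_cycle] at this
    linarith
  · obtain ⟨l, hl⟩ := hx.exists_ratio ha.2.2.1 hc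
    have := ha.ratio_pos (Finset.mem_univ q) (hx.nn_pos ha.2.2.1 τ) hl
    rw [hl.DD_eq] at hD
    have := mul_nonneg (mul_nonneg hv.le (nn_nonneg (x := x) (r := r) (a := u) (t := τ))) this
    linarith
  · rcases h with h | h
    · linarith
    · have := ha.DD_nonneg (Finset.mem_univ v') (Finset.mem_univ q) h.1.le hc.le
      linarith

/-- Four independent events that share the crosser `u` do not overlap. -/
theorem four_overlapping_absurd (hx : IsAdmissibleMotion x) {E₁ E₂ E₃ E₄ : ChargedEvent x r}
    (h12 : E₁.Free E₂) (h21 : E₂.Free E₁) (h23 : E₂.Free E₃) (h32 : E₃.Free E₂)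
    (h34 : E₃.Free E₄) (h43 : E₄.Free E₃) (hu1 : u ∈ E₁.L) (hu2 : u ∈ E₂.L) (hu3 : u ∈ E₃.L)
    (hu4 : u ∈ E₄.L) (ha12 : E₁.α₀ ≤ E₂.α₀) (ha23 : E₂.α₀ ≤ E₃.α₀) (ha34 : E₃.α₀ ≤ E₄.α₀)
    {b : ℝ} (hb1 : b ≤ E₁.α₁) (hb4 : E₄.α₀ ≤ b) (hy : y ∈ E₃.L) (hyu : E₃.t y < E₃.t u) :
    False := by
  obtain ⟨-, e2⟩ := h12.order hx h21 hu1 hu2 ha12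
  obtain ⟨s2, -⟩ := h23.order hx h32 hu2 hu3 ha23
  obtain ⟨s3, -⟩ := h34.order hx h43 hu3 hu4 ha34
  have hne : u ≠ y := by rintro rfl; exact lt_irrefl _ hyu
  have cy := E₃.crosser' y hy
  have cu := E₃.crosser' u hu3
  have hee := cy.end_lt hx cu hne.symm hyu
  -- The common time `b` makes the crossings of `u` in `E₂` and `E₃` overlap. So `u` is a neighbour
  -- of `r` in the full set from the start of the former to the end of the latter, which covers the
  -- crossing of `y` in `E₃`.
  refine cy.exclusion hx hne cu.zq (Finset.mem_univ _) (Finset.mem_univ _) fun τ hτ => ?_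
  have hsy := E₃.le_s y hy
  rcases le_or_gt τ (E₂.e u) with h | h
  · exact (E₂.crosser' u hu2).alive τ ⟨by linarith [hτ.1], h⟩
  · exact cu.alive τ ⟨by linarith, hτ.2.trans hee.le⟩

end ChargedEvent

/-! ### Points that pass between `r` and a neighbour of `r`. -/

section under
variable {n : ℕ} {x : Fin n → ℝ → Plane} {r q z q₁ q₂ : Fin n} {s t e a b : ℝ}

theorem Crosser.sign_before (hx : IsAdmissibleMotion x) (h : Crosser x r q z s t e) {g : ℝ}
    (hg : g < t) (h0 : oo x r z q g = 0) : ∀ τ, τ < g → oo x r z q τ < 0 := by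
  intro τ hτ
  have := (h.mirror.sign_after hx.mirror (g := -g) (by linarith)
    (by rw [oo_mirror, neg_neg, h0, neg_zero])).2 (-τ) (by linarith)
  rw [oo_mirror, neg_neg] at this
  linarith

/-- Two points cannot both pass under `z` before they are crossed by `z`, if neither does so
close to the crossing of the other. -/
theorem under_before_absurd_of_lt (hx : IsAdmissibleMotion x) {a₁ b₁ a₂ b₂ f₁ f₂ : ℝ}
    (h₁ : IsSingleCrossing x z q₁ r a₁ b₁) (h₂ : IsSingleCrossing x z q₂ r a₂ b₂)
    (hq : q₁ ≠ q₂) (hf₁ : f₁ < a₁) (hf₂ : f₂ < a₂) (hb : b₁ < f₂)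
    (u₁ : Under x r q₁ z f₁) (u₂ : Under x r q₂ z f₂) : False := by
  obtain ⟨t₁, ht₁, s₁, hs₁, e₁, he₁, c₁⟩ := h₁.exists_crosser hx hf₁ hb
  obtain ⟨t₂, ht₂, s₂, hs₂, e₂, he₂, c₂⟩ := h₂.exists_crosser hx hf₂ (lt_add_one b₂)
  obtain ⟨l₁, hl₁, hl₁', hr₁⟩ := u₁
  obtain ⟨l₂, hl₂, hl₂', hr₂⟩ := u₂
  have d1 : DD x r z q₁ q₂ f₁ < 0 := by
    have ho := c₂.sign_before hx (hs₂.1.trans c₂.lt₁) hr₂.oo_self f₁ (hs₁.1.trans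
      (c₁.lt.trans he₁.2))
    rw [DD_swap', hr₁.DD_eq]
    have := mul_pos (mul_pos (neg_pos.mpr ho) (hx.nn_pos c₁.zr f₁))
      (mul_pos hl₁ (show 0 < 1 - l₁ by linarith))
    linarith
  have d2 := c₁.DD_pos q₂ c₂.zq.symm hq.symm c₂.qr
  have d3 := c₁.DD_neg q₂ c₂.zq.symm hq.symm c₂.qr
  have d4 : 0 < DD x r z q₁ q₂ f₂ := by
    have ho : oo x r z q₁ f₂ < 0 := by
      by_contra hn
      rcases (not_lt.mp hn).eq_or_lt with h | h
      · exact three_zeros_absurd (c₁.oo_zeros hx) (hs₁.1.trans c₁.lt₁) (c₁.lt₂.trans he₁.2)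
          hr₁.oo_self c₁.zero h.symm
      · obtain ⟨g, hg, g0⟩ := exists_zero_of_neg_pos (hx.continuous_oo r z q₁) he₁.2
          (c₁.neg _ ⟨c₁.lt₂, le_rfl⟩) h
        exact three_zeros_absurd (c₁.oo_zeros hx) (hs₁.1.trans c₁.lt₁) (c₁.lt₂.trans hg.1)
          hr₁.oo_self c₁.zero g0
    rw [hr₂.DD_eq]
    have := mul_pos (mul_pos (neg_pos.mpr ho) (hx.nn_pos c₁.zr f₂))
      (mul_pos hl₂ (show 0 < 1 - l₂ by linarith))
    linarith
  have d5 : DD x r z q₁ q₂ s₂ < 0 := by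
    have := c₂.DD_pos q₁ c₁.zq.symm hq c₁.qr
    rw [DD_swap'] at this; linarith
  -- The determinant of `z`, `q₁`, `q₂` has signs `- + - + -` at `f₁`, `s₁`, `e₁`, `f₂`, `s₂`.
  refine five_alternation_absurd (f := fun τ => -DD x r z q₁ q₂ τ)
    (hx.continuous_DD r z q₁ q₂).neg ?_ hs₁.1 c₁.lt he₁.2 hs₂.1 (by linarith) (by linarith)
    (by linarith) (by linarith) (by linarith)
  simp only [neg_eq_zero]
  exact encard_DD_zeros hx c₁.zr c₁.qr c₂.qr c₁.zq c₂.zq hq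

theorem DelaunayAt.not_under {X : Finset (Fin n)} (h : DelaunayAt x X z r t) (hq : q ∈ X)
    (hx : IsAdmissibleMotion x) : ¬ Under x r q z t := by
  rintro ⟨l, hl, hl', hr⟩
  have := h.ratio_pos hq (hx.nn_pos h.2.2.1 t) hr
  have := mul_pos hl (show 0 < 1 - l by linarith)
  linarith

/-- While `z` is a neighbour of `r` in a set containing `q₂`, the point `q₂` is not under `z`. So
`f₂` avoids `[α₁, β₁]`, and likewise `f₁` avoids `[α₂, β₂]`. Hence one passage happens after the
crossing of the other point, the case of `under_before_absurd_of_lt`. -/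
theorem under_before_absurd (hx : IsAdmissibleMotion x) {a₁ b₁ a₂ b₂ f₁ f₂ α₁ β₁ α₂ β₂ : ℝ}
    {X : Finset (Fin n)} (h₁ : IsSingleCrossing x z q₁ r a₁ b₁)
    (h₂ : IsSingleCrossing x z q₂ r a₂ b₂) (hq : q₁ ≠ q₂) (hX₁ : q₁ ∈ X) (hX₂ : q₂ ∈ X)
    (hz₁ : ∀ τ ∈ Icc α₁ β₁, DelaunayAt x (X.erase q₁) z r τ)
    (hz₂ : ∀ τ ∈ Icc α₂ β₂, DelaunayAt x (X.erase q₂) z r τ)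
    (hb₁ : b₁ ≤ β₁) (hb₂ : b₂ ≤ β₂) (hf₁ : f₁ < a₁) (hf₂ : f₂ < a₂) (hα₁ : α₁ ≤ f₁)
    (hα₂ : α₂ ≤ f₂) (u₁ : Under x r q₁ z f₁) (u₂ : Under x r q₂ z f₂) : False := by
  have k₁ : f₂ < α₁ ∨ β₁ < f₂ := by
    by_contra h
    push Not at h
    exact (hz₁ f₂ h).not_under (by simp [hq.symm, hX₂]) hx u₂
  have k₂ : f₁ < α₂ ∨ β₂ < f₁ := by
    by_contra h
    push Not at h
    exact (hz₂ f₁ h).not_under (by simp [hq, hX₁]) hx u₁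
  rcases k₁ with k₁ | k₁
  · rcases k₂ with k₂ | k₂
    · linarith
    · exact under_before_absurd_of_lt hx h₂ h₁ hq.symm hf₂ hf₁ (hb₂.trans_lt k₂) u₂ u₁
  · exact under_before_absurd_of_lt hx h₁ h₂ hq hf₁ hf₂ (hb₁.trans_lt k₁) u₁ u₂

/-- The mirror image of `under_before_absurd`. -/
theorem under_after_absurd (hx : IsAdmissibleMotion x) {a₁ b₁ a₂ b₂ f₁ f₂ α₁ β₁ α₂ β₂ : ℝ}
    {X : Finset (Fin n)} (h₁ : IsSingleCrossing x z q₁ r a₁ b₁)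
    (h₂ : IsSingleCrossing x z q₂ r a₂ b₂) (hq : q₁ ≠ q₂) (hX₁ : q₁ ∈ X) (hX₂ : q₂ ∈ X)
    (hz₁ : ∀ τ ∈ Icc α₁ β₁, DelaunayAt x (X.erase q₁) z r τ)
    (hz₂ : ∀ τ ∈ Icc α₂ β₂, DelaunayAt x (X.erase q₂) z r τ)
    (ha₁ : α₁ ≤ a₁) (ha₂ : α₂ ≤ a₂) (hf₁ : b₁ < f₁) (hf₂ : b₂ < f₂) (hβ₁ : f₁ ≤ β₁)
    (hβ₂ : f₂ ≤ β₂) (u₁ : Under x r q₁ z f₁) (u₂ : Under x r q₂ z f₂) : False :=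
  under_before_absurd hx.mirror h₁.mirror h₂.mirror hq hX₁ hX₂
    (α₁ := -β₁) (β₁ := -α₁) (α₂ := -β₂) (β₂ := -α₂)
    (fun τ hτ => delaunayAt_mirror.mpr (hz₁ (-τ) ⟨by linarith [hτ.2], by linarith [hτ.1]⟩))
    (fun τ hτ => delaunayAt_mirror.mpr (hz₂ (-τ) ⟨by linarith [hτ.2], by linarith [hτ.1]⟩))
    (neg_le_neg ha₁) (neg_le_neg ha₂) (neg_lt_neg hf₁) (neg_lt_neg hf₂) (neg_le_neg hβ₁)
    (neg_le_neg hβ₂) (under_mirror.mpr (by rwa [neg_neg])) (under_mirror.mpr (by rwa [neg_neg]))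

end under

/-! ### Counting by keys, and restriction of the motion to a subset. -/

/-- A set whose elements have keys in a finite set `K`, at most `M` elements for each key. -/
theorem ncard_le_mul_of_key {α β : Type*} {S : Set α} (K : Finset β) (P : α → β → Prop) {M : ℕ}
    (h : ∀ a ∈ S, ∃ k ∈ K, P a k) (hM : ∀ k ∈ K, {a ∈ S | P a k}.encard ≤ M) :
    S.Finite ∧ S.ncard ≤ M * K.card := by
  classical
  have hfin : S.Finite := by
    refine (Set.Finite.biUnion (s := (K : Set β)) (t := fun k => {a ∈ S | P a k}) K.finite_toSet
      fun k hk => Set.finite_of_encard_le_coe (hM k hk)).subset fun a ha => ?_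
    obtain ⟨k, hk, hp⟩ := h a ha
    exact Set.mem_biUnion (Finset.mem_coe.mpr hk) ⟨ha, hp⟩
  refine ⟨hfin, ?_⟩
  by_cases hne : S.Nonempty
  swap
  · rw [Set.not_nonempty_iff_eq_empty.mp hne]; simp
  obtain ⟨a₀, ha₀⟩ := hne
  have : Nonempty β := ⟨(h a₀ ha₀).choose⟩
  choose! f hf hP using h
  rw [Set.ncard_eq_toFinset_card S hfin]
  refine Finset.card_le_mul_card_image_of_maps_to (f := f) (fun a ha => hf a (by simpa using ha)) M
    fun k hk => ?_
  have h1 := hM k hk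
  have h2 : ((hfin.toFinset.filter fun a => f a = k : Finset α) : Set α) ⊆ {a ∈ S | P a k} := by
    intro a ha
    simp only [Finset.coe_filter, Set.Finite.mem_toFinset, Set.mem_ofPred_eq] at ha
    refine ⟨ha.1, ?_⟩
    have := hP a ha.1
    rwa [ha.2] at this
  have h3 := (Set.encard_le_encard h2).trans h1
  rw [Set.encard_coe_eq_coe_finsetCard] at h3
  exact_mod_cast h3

section restrict
variable {n m : ℕ} {x : Fin n → ℝ → Plane}

theorem image_map_eq (φ : Fin m ↪ Fin n) (s : Finset (Fin m)) (t : ℝ) :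
    (fun i => x i t) '' ((s.map φ : Finset (Fin n)) : Set (Fin n))
      = (fun i => x (φ i) t) '' (s : Set (Fin m)) := by
  rw [Finset.coe_map, Set.image_image]

theorem cocircularAt_comp (φ : Fin m ↪ Fin n) {s : Finset (Fin m)} {t : ℝ} :
    CocircularAt (fun i => x (φ i)) s t ↔ CocircularAt x (s.map φ) t := by
  unfold CocircularAt; rw [image_map_eq, Finset.card_map]

theorem collinearAt_comp (φ : Fin m ↪ Fin n) {s : Finset (Fin m)} {t : ℝ} :
    CollinearAt (fun i => x (φ i)) s t ↔ CollinearAt x (s.map φ) t := by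
  unfold CollinearAt; rw [image_map_eq, Finset.card_map]

theorem IsAdmissibleMotion.comp (hx : IsAdmissibleMotion x) (φ : Fin m ↪ Fin n) :
    IsAdmissibleMotion fun i => x (φ i) where
  continuous i := hx.continuous _
  cocircular_le_three s hs := by
    simp only [cocircularAt_comp]; exact hx.cocircular_le_three _ (by rwa [Finset.card_map])
  collinear_le_two s hs := by
    simp only [collinearAt_comp]; exact hx.collinear_le_two _ (by rwa [Finset.card_map])
  no_coincidence i j hij := hx.no_coincidence _ _ (φ.injective.ne hij)
  no_simultaneous t s s' := by
    simp only [cocircularAt_comp, collinearAt_comp]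
    intro h h'
    exact Finset.map_injective φ (hx.no_simultaneous t _ _ h h')
  cocircular_crossing t s h a ha := by
    have e1 : ∀ τ, InsideCircleAt x ((s.map φ).erase (φ a)) (φ a) τ →
        InsideCircleAt (fun i => x (φ i)) (s.erase a) a τ := by
      rintro τ ⟨c, ρ, h1, h2⟩
      refine ⟨c, ρ, fun b hb => h1 (φ b) ?_, h2⟩
      rw [← Finset.map_erase]; exact Finset.mem_map_of_mem _ hb
    have e2 : ∀ τ, OutsideCircleAt x ((s.map φ).erase (φ a)) (φ a) τ →
        OutsideCircleAt (fun i => x (φ i)) (s.erase a) a τ := by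
      rintro τ ⟨c, ρ, h1, h2⟩
      refine ⟨c, ρ, fun b hb => h1 (φ b) ?_, h2⟩
      rw [← Finset.map_erase]; exact Finset.mem_map_of_mem _ hb
    rcases hx.cocircular_crossing t _ ((cocircularAt_comp φ).mp h) (φ a)
      (Finset.mem_map_of_mem _ ha) with ⟨h1, h2⟩ | ⟨h1, h2⟩
    · exact Or.inl ⟨h1.mono e2, h2.mono e1⟩
    · exact Or.inr ⟨h1.mono e1, h2.mono e2⟩
  collinear_crossing t p q r h := by
    refine hx.collinear_crossing t (φ p) (φ q) (φ r) ?_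
    have := (collinearAt_comp φ).mp h
    simpa [Finset.map_insert] using this

theorem DelaunayCocircularAt.cocircularAt {s : Finset (Fin n)} {t : ℝ}
    (h : DelaunayCocircularAt x s t) : CocircularAt x s t := by
  obtain ⟨h1, c, ρ, h2, -⟩ := h
  refine ⟨h1, c, ρ, ?_⟩
  rintro _ ⟨i, hi, rfl⟩
  exact h2 i hi

/-- The uniform bound makes the supremum defining `maxDelaunayCocircularities` a true maximum. -/
theorem delaunayCocircular_finite (hx : IsAdmissibleMotion x) :
    {e : Finset (Fin n) × ℝ | DelaunayCocircularAt x e.1 e.2}.Finite ∧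
      {e : Finset (Fin n) × ℝ | DelaunayCocircularAt x e.1 e.2}.ncard
        ≤ 3 * (Finset.univ : Finset (Finset (Fin n))).card := by
  refine ncard_le_mul_of_key Finset.univ (fun e s => e.1 = s) (fun e _ => ⟨e.1, by simp, rfl⟩)
    fun s _ => ?_
  by_cases hs : s.card = 4
  · refine le_trans ?_ (hx.cocircular_le_three s hs)
    refine Set.encard_le_encard_of_injOn (f := Prod.snd) ?_ ?_
    · rintro ⟨s', t⟩ ⟨h1, rfl⟩
      exact h1.cocircularAt
    · rintro ⟨s', t⟩ ⟨_, rfl⟩ ⟨s'', t'⟩ ⟨_, h⟩ rfl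
      simp at h; simp [h]
  · rw [Set.encard_eq_zero.mpr]
    · exact bot_le
    · ext ⟨s', t⟩
      simp only [Set.mem_ofPred_eq, Set.mem_empty_iff_false, iff_false]
      rintro ⟨h1, rfl⟩
      exact hs h1.1

theorem ncard_le_maxDelaunayCocircularities {x : Fin m → ℝ → Plane} (hx : IsAdmissibleMotion x) :
    {e : Finset (Fin m) × ℝ | DelaunayCocircularAt x e.1 e.2}.ncard
      ≤ maxDelaunayCocircularities m := by
  refine le_csSup ⟨3 * (Finset.univ : Finset (Finset (Fin m))).card, ?_⟩ ⟨x, hx, rfl⟩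
  rintro _ ⟨y, hy, rfl⟩
  exact (delaunayCocircular_finite hy).2

/-- A Delaunay co-circularity within the subset `R`. -/
def DelaunayCocircularIn (x : Fin n → ℝ → Plane) (R s : Finset (Fin n)) (t : ℝ) : Prop :=
  s ⊆ R ∧ s.card = 4 ∧ ∃ (c : Plane) (ρ : ℝ),
    (∀ i ∈ s, dist (x i t) c = ρ) ∧ ∀ z ∈ R, ρ ≤ dist (x z t) c

theorem delaunayCocircularIn_ncard (hx : IsAdmissibleMotion x) (R : Finset (Fin n)) :
    {e : Finset (Fin n) × ℝ | DelaunayCocircularIn x R e.1 e.2}.Finite ∧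
      {e : Finset (Fin n) × ℝ | DelaunayCocircularIn x R e.1 e.2}.ncard
        ≤ maxDelaunayCocircularities R.card := by
  let φ : Fin R.card ↪ Fin n := (R.orderEmbOfFin rfl).toEmbedding
  have hφ : ∀ i, φ i ∈ R := fun i => R.orderEmbOfFin_mem rfl i
  have hmap : Finset.univ.map φ = R := by
    apply Finset.coe_injective
    rw [Finset.coe_map]
    simp [φ]
  have hsub : {e : Finset (Fin n) × ℝ | DelaunayCocircularIn x R e.1 e.2} ⊆
      (fun e : Finset (Fin R.card) × ℝ => (e.1.map φ, e.2)) ''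
        {e | DelaunayCocircularAt (fun i => x (φ i)) e.1 e.2} := by
    rintro ⟨s, t⟩ ⟨h1, h2, c, ρ, h3, h4⟩
    have hs : s ⊆ Finset.univ.map φ := by rw [hmap]; exact h1
    obtain ⟨s', -, rfl⟩ := Finset.subset_map_iff.mp hs
    refine ⟨(s', t), ⟨by simpa using h2, c, ρ, fun i hi => h3 _ (Finset.mem_map_of_mem _ hi),
      fun z => h4 _ (hφ z)⟩, rfl⟩
  have hf := (delaunayCocircular_finite (hx.comp φ)).1
  refine ⟨(hf.image _).subset hsub, ?_⟩
  exact (Set.ncard_le_ncard hsub (hf.image _)).trans ((Set.ncard_image_le hf).trans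
    (ncard_le_maxDelaunayCocircularities (hx.comp φ)))

end restrict

/-! ### Swaps on the convex hull. -/

section hull
variable {n : ℕ} {x : Fin n → ℝ → Plane} {R : Finset (Fin n)} {a b c : Fin n} {t : ℝ}

/-- The edge `ab` is a counterclockwise edge of the convex hull of `R`. -/
def HullEdge (x : Fin n → ℝ → Plane) (R : Finset (Fin n)) (a b : Fin n) (t : ℝ) : Prop :=
  ∀ z ∈ R, z ≠ a → z ≠ b → 0 < oo x a b z t

/-- The counterclockwise hull neighbour of `a` changes from `b` to `c`. -/
structure HullSwap (x : Fin n → ℝ → Plane) (R : Finset (Fin n)) (a b c : Fin n) (t : ℝ) :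
    Prop where
  ha : a ∈ R
  hb : b ∈ R
  hc : c ∈ R
  ba : b ≠ a
  ca : c ≠ a
  bc : b ≠ c
  zero : oo x a b c t = 0
  left : ∀ᶠ τ in 𝓝[<] t, HullEdge x R a b τ
  right : ∀ᶠ τ in 𝓝[>] t, HullEdge x R a c τ

/-- If `ab` were a hull edge again later and `ac` already earlier, the triple would have a
collinearity on either side of `t`, three in all. -/
theorem HullSwap.last_or_first (hx : IsAdmissibleMotion x) (h : HullSwap x R a b c t) :
    (∀ t', t < t' → ¬ HullEdge x R a b t') ∨ (∀ t', t' < t → ¬ HullEdge x R a c t') := by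
  by_contra hn
  push Not at hn
  obtain ⟨⟨t₁, ht₁, h₁⟩, t₂, ht₂, h₂⟩ := hn
  obtain ⟨l, hl, hl'⟩ := (h.left.and (Ioo_mem_nhdsLT ht₂)).exists
  obtain ⟨u, hu, hu'⟩ := (h.right.and (Ioo_mem_nhdsGT ht₁)).exists
  have s₁ := h₁ c h.hc h.ca h.bc.symm
  have s₂ := h₂ b h.hb h.ba h.bc
  have s₃ := hl c h.hc h.ca h.bc.symm
  have s₄ := hu b h.hb h.ba h.bc
  rw [oo_swap] at s₂ s₄
  have hcont := hx.continuous_oo a b c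
  obtain ⟨z, hz, z0⟩ := exists_zero_of_neg_pos hcont hl'.1 (by linarith) s₃
  obtain ⟨w, hw, w0⟩ := exists_zero_of_neg_pos hcont hu'.2 (by linarith) s₁
  exact three_zeros_absurd (encard_oo_zeros hx h.ba h.ca h.bc) (hz.2.trans hl'.2)
    (hu'.1.trans hw.1) z0 h.zero w0

/-- The number of swaps on the convex hull is at most quadratic. -/
theorem hullSwap_ncard (hx : IsAdmissibleMotion x) (R : Finset (Fin n)) :
    {e : Finset (Fin n) × ℝ | ∃ a b c, e.1 = {a, b, c} ∧ HullSwap x R a b c e.2}.Finite ∧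
      {e : Finset (Fin n) × ℝ | ∃ a b c, e.1 = {a, b, c} ∧ HullSwap x R a b c e.2}.ncard
        ≤ 2 * R.card ^ 2 := by
  -- The key is the directed hull edge that is seen for the last or for the first time, with a bit
  -- telling which.
  have key := ncard_le_mul_of_key
    (S := {e : Finset (Fin n) × ℝ | ∃ a b c, e.1 = {a, b, c} ∧ HullSwap x R a b c e.2})
    ((Finset.univ : Finset Bool) ×ˢ R ×ˢ R)
    (fun e k => ∃ a b c, e.1 = {a, b, c} ∧ HullSwap x R a b c e.2 ∧ k.2.1 = a ∧
      (k.1 = true ∧ k.2.2 = b ∧ (∀ t', e.2 < t' → ¬ HullEdge x R a b t') ∨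
        k.1 = false ∧ k.2.2 = c ∧ (∀ t', t' < e.2 → ¬ HullEdge x R a c t'))) (M := 1) ?_ ?_
  · refine ⟨key.1, key.2.trans (le_of_eq ?_)⟩
    simp; ring
  · rintro ⟨s, t⟩ ⟨a, b, c, h1, h2⟩
    rcases h2.last_or_first hx with h | h
    · exact ⟨(true, a, b), by simp [h2.ha, h2.hb], a, b, c, h1, h2, rfl, Or.inl ⟨rfl, rfl, h⟩⟩
    · exact ⟨(false, a, c), by simp [h2.ha, h2.hc], a, b, c, h1, h2, rfl, Or.inr ⟨rfl, rfl, h⟩⟩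
  · rintro ⟨i, a, b⟩ -
    rw [Nat.cast_one, Set.encard_le_one_iff]
    rintro ⟨s, t⟩ ⟨s', t'⟩ ⟨-, a₁, b₁, c₁, e₁, h₁, k₁, g₁⟩ ⟨-, a₂, b₂, c₂, e₂, h₂, k₂, g₂⟩
    simp only at e₁ e₂ h₁ h₂ k₁ k₂ g₁ g₂
    subst k₁ k₂
    have htt : t = t' := by
      rcases g₁ with ⟨i₁, j₁, g₁⟩ | ⟨i₁, j₁, g₁⟩ <;> rcases g₂ with ⟨i₂, j₂, g₂⟩ | ⟨i₂, j₂, g₂⟩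
      · subst j₁ j₂
        rcases lt_trichotomy t t' with h | h | h
        · obtain ⟨y, hy, hy'⟩ := (h₂.left.and (Ioo_mem_nhdsLT h)).exists
          exact absurd hy (g₁ y hy'.1)
        · exact h
        · obtain ⟨y, hy, hy'⟩ := (h₁.left.and (Ioo_mem_nhdsLT h)).exists
          exact absurd hy (g₂ y hy'.1)
      · rw [i₁] at i₂; cases i₂
      · rw [i₁] at i₂; cases i₂
      · subst j₁ j₂
        rcases lt_trichotomy t t' with h | h | h
        · obtain ⟨y, hy, hy'⟩ := (h₁.right.and (Ioo_mem_nhdsGT h)).exists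
          exact absurd hy (g₂ y hy'.2)
        · exact h
        · obtain ⟨y, hy, hy'⟩ := (h₂.right.and (Ioo_mem_nhdsGT h)).exists
          exact absurd hy (g₁ y hy'.2)
    subst htt
    have := collinearAt_unique hx (collinearAt_of_oo_eq_zero hx h₁.ba h₁.ca h₁.bc h₁.zero)
      (collinearAt_of_oo_eq_zero hx h₂.ba h₂.ca h₂.bc h₂.zero)
    rw [e₁, e₂, this]

theorem hullSwap_of_aligned (hx : IsAdmissibleMotion x) {l : ℝ} (ha : a ∈ R) (hb : b ∈ R)
    (hc : c ∈ R) (hba : b ≠ a) (hca : c ≠ a) (hbc : b ≠ c) (hl0 : 0 < l) (hl : Ratio x a b c t l)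
    (hside : ∀ z ∈ R, z ≠ a → z ≠ b → z ≠ c → 0 < oo x a b z t) :
    HullSwap x R a b c t ∨ HullSwap x R a c b t := by
  have hev : ∀ S : Set ℝ, ∀ᶠ τ in 𝓝[S] t, ∀ z ∈ R, z ≠ a → z ≠ b → z ≠ c →
      0 < oo x a b z τ ∧ 0 < oo x a c z τ := by
    intro S
    refine (Finset.eventually_all R).mpr fun z hz => ?_
    by_cases h1 : z = a
    · simp [h1]
    by_cases h2 : z = b
    · simp [h2]
    by_cases h3 : z = c
    · simp [h3]
    have h4 := hside z hz h1 h2 h3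
    have h5 : 0 < oo x a c z t := by rw [hl.oo_left]; exact mul_pos hl0 h4
    filter_upwards [eventually_pos_of_pos (hx.continuous_oo a b z) h4 S,
      eventually_pos_of_pos (hx.continuous_oo a c z) h5 S] with τ h6 h7 _ _ _ using ⟨h6, h7⟩
  have hb' : ∀ τ, (∀ z ∈ R, z ≠ a → z ≠ b → z ≠ c → 0 < oo x a b z τ ∧ 0 < oo x a c z τ) →
      0 < oo x a b c τ → HullEdge x R a b τ := by
    intro τ h h' z hz h1 h2
    by_cases h3 : z = c
    · rw [h3]; exact h'
    · exact (h z hz h1 h2 h3).1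
  have hc' : ∀ τ, (∀ z ∈ R, z ≠ a → z ≠ b → z ≠ c → 0 < oo x a b z τ ∧ 0 < oo x a c z τ) →
      oo x a b c τ < 0 → HullEdge x R a c τ := by
    intro τ h h' z hz h1 h2
    by_cases h3 : z = b
    · rw [h3, oo_swap]; linarith
    · exact (h z hz h1 h3 h2).2
  rcases oo_sign_change hx hba hca hbc hl.oo_self with ⟨h1, h2⟩ | ⟨h1, h2⟩
  · exact Or.inl ⟨ha, hb, hc, hba, hca, hbc, hl.oo_self,
      ((hev _).and h1).mono fun τ h => hb' τ h.1 h.2, ((hev _).and h2).mono fun τ h => hc' τ h.1 h.2⟩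
  · exact Or.inr ⟨ha, hc, hb, hca, hba, hbc.symm, by rw [oo_swap, hl.oo_self, neg_zero],
      ((hev _).and h1).mono fun τ h => hc' τ h.1 h.2, ((hev _).and h2).mono fun τ h => hb' τ h.1 h.2⟩

/-- A collinearity at which the circumcircle of the triangle degenerates to a halfplane without
other points swaps two hull neighbours. -/
theorem exists_hullSwap (hx : IsAdmissibleMotion x) (ha : a ∈ R) (hb : b ∈ R)
    (hc : c ∈ R) (hba : b ≠ a) (hca : c ≠ a) (hbc : b ≠ c) (h0 : oo x a b c t = 0)
    (hD : ∀ z ∈ R, z ≠ a → z ≠ b → z ≠ c → 0 < DD x a b c z t) :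
    ∃ a' b' c', ({a, b, c} : Finset (Fin n)) = {a', b', c'} ∧ HullSwap x R a' b' c' t := by
  obtain ⟨l, hl⟩ := hx.exists_ratio hba h0
  have hl0 := hx.ratio_ne_zero hca hl
  have hl1 := hx.ratio_ne_one hbc hl
  have hnn := hx.nn_pos hba t
  have hD' : ∀ z ∈ R, z ≠ a → z ≠ b → z ≠ c → oo x a b z t * (l * (l - 1)) < 0 := by
    intro z hz h1 h2 h3
    have := hD z hz h1 h2 h3
    rw [DD_swap', hl.DD_eq] at this
    by_contra hn
    have := mul_nonneg (not_lt.mp hn) hnn.le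
    linarith
  have fin : ∀ {a' b' c'}, ({a, b, c} : Finset (Fin n)) = {a', b', c'} →
      HullSwap x R a' b' c' t ∨ HullSwap x R a' c' b' t →
      ∃ a' b' c', ({a, b, c} : Finset (Fin n)) = {a', b', c'} ∧ HullSwap x R a' b' c' t := by
    rintro a' b' c' e (h | h)
    · exact ⟨_, _, _, e, h⟩
    · exact ⟨_, _, _, e.trans (by rw [Finset.pair_comm]), h⟩
  -- The apex of the swap has to be an extreme point of the collinear triple: `b` if `l < 0`, `a` if
  -- `0 < l < 1`, and `c` if `1 < l`.
  rcases lt_or_gt_of_ne hl0 with hlt | hgt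
  · refine fin (a' := b) (b' := a) (c' := c) (by rw [Finset.insert_comm])
      (hullSwap_of_aligned hx (l := 1 - l) hb ha hc hba.symm hbc.symm hca.symm (by linarith)
        ⟨?_, ?_⟩ fun z hz h1 h2 h3 => ?_)
    · have := hl.1; unfold relX at this ⊢; linear_combination this
    · have := hl.2; unfold relY at this ⊢; linear_combination this
    · have h4 := hD' z hz h2 h1 h3
      have h5 : oo x b a z t = -oo x a b z t := by unfold oo relX relY; ring
      rw [h5]
      have h6 : 0 < l * (l - 1) := mul_pos_of_neg_of_neg hlt (by linarith)
      by_contra hn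
      have := mul_nonneg (show 0 ≤ oo x a b z t by linarith) h6.le
      linarith
  · rcases lt_or_gt_of_ne hl1 with hlt1 | hgt1
    · refine fin rfl (hullSwap_of_aligned hx ha hb hc hba hca hbc hgt hl fun z hz h1 h2 h3 => ?_)
      have h4 := hD' z hz h1 h2 h3
      by_contra hn
      have := mul_nonneg_of_nonpos_of_nonpos (not_lt.mp hn)
        (mul_nonpos_of_nonneg_of_nonpos hgt.le (show l - 1 ≤ 0 by linarith))
      linarith
    · refine fin (a' := c) (b' := b) (c' := a)
        (by rw [Finset.insert_comm, Finset.pair_comm a c, Finset.insert_comm])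
        (hullSwap_of_aligned hx (l := l / (l - 1)) hc hb ha hbc hca.symm hba
          (div_pos hgt (by linarith)) ⟨?_, ?_⟩ fun z hz h1 h2 h3 => ?_)
      · have := hl.1
        unfold relX at this ⊢
        rw [div_mul_eq_mul_div, eq_div_iff (by linarith)]; linear_combination this
      · have := hl.2
        unfold relY at this ⊢
        rw [div_mul_eq_mul_div, eq_div_iff (by linarith)]; linear_combination this
      · have h4 := hD' z hz h3 h2 h1
        have h5 : oo x c b z t = (1 - l) * oo x a b z t := by
          have e1 := hl.1
          have e2 := hl.2
          unfold relX at e1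
          unfold relY at e2
          unfold oo relX relY
          linear_combination
            (x b t 1 - x z t 1) * e1 + (x z t 0 - x b t 0) * e2
        rw [h5]
        by_contra hn
        have h7 : 0 ≤ oo x a b z t := by
          by_contra h
          have := mul_pos_of_neg_of_neg (show 1 - l < 0 by linarith) (not_le.mp h)
          linarith
        have := mul_nonneg h7 (mul_pos hgt (show 0 < l - 1 by linarith)).le
        linarith

end hull

/-! ### Changes of the Delaunay triangles of a subset. -/

section records
variable {n : ℕ} {x : Fin n → ℝ → Plane} {R : Finset (Fin n)} {a b c : Fin n} {t : ℝ}

/-- The changes of the strictly Delaunay triangles of `R`. -/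
def triRecords (x : Fin n → ℝ → Plane) (R : Finset (Fin n)) : Set (Fin n × Fin n × Fin n × ℝ) :=
  {e | e.1 ∈ R ∧ e.2.1 ∈ R ∧ e.2.2.1 ∈ R ∧
    e.2.2.2 ∈ frontier {τ | StrictTri x R e.1 e.2.1 e.2.2.1 τ}}

theorem isOpen_strictTri (hx : IsAdmissibleMotion x) (R : Finset (Fin n)) (a b c : Fin n) :
    IsOpen {τ | StrictTri x R a b c τ} := by
  have h1 : IsOpen {τ | 0 < oo x a b c τ} := isOpen_lt continuous_const (hx.continuous_oo a b c)
  have h2 : IsOpen {τ | ∀ z ∈ R, z ≠ a → z ≠ b → z ≠ c → 0 < DD x a b c z τ} := by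
    have : {τ | ∀ z ∈ R, z ≠ a → z ≠ b → z ≠ c → 0 < DD x a b c z τ}
        = ⋂ z ∈ R, {τ | z ≠ a → z ≠ b → z ≠ c → 0 < DD x a b c z τ} := by
      ext τ; simp
    rw [this]
    refine isOpen_biInter_finset fun z _ => ?_
    by_cases h : z ≠ a ∧ z ≠ b ∧ z ≠ c
    · have : {τ | z ≠ a → z ≠ b → z ≠ c → 0 < DD x a b c z τ} = {τ | 0 < DD x a b c z τ} := by
        ext τ; simp [h.1, h.2.1, h.2.2]
      rw [this]
      exact isOpen_lt continuous_const (hx.continuous_DD a b c z)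
    · have : {τ | z ≠ a → z ≠ b → z ≠ c → 0 < DD x a b c z τ} = Set.univ := by
        ext τ; simp only [Set.mem_ofPred_eq, Set.mem_univ, iff_true]; tauto
      rw [this]; exact isOpen_univ
  exact h1.inter h2

/-- At a frontier time the strict inequalities hold weakly and one of them fails. Either the
triangle is flat, which is a hull swap, or a fourth point reaches its empty circle. -/
theorem triRecords_event (hx : IsAdmissibleMotion x) (ha : a ∈ R) (hb : b ∈ R) (hc : c ∈ R)
    (h : t ∈ frontier {τ | StrictTri x R a b c τ}) :
    (∃ s, a ∈ s ∧ b ∈ s ∧ c ∈ s ∧ DelaunayCocircularIn x R s t) ∨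
    (∃ a' b' c', ({a, b, c} : Finset (Fin n)) = {a', b', c'} ∧ HullSwap x R a' b' c' t) := by
  have hcl := frontier_subset_closure h
  have hn : ¬ StrictTri x R a b c t := by
    have := h.2
    rwa [(isOpen_strictTri hx R a b c).interior_eq] at this
  obtain ⟨τ₀, hτ₀⟩ := closure_nonempty_iff.mp ⟨t, hcl⟩
  have hba := StrictTri.ne₁ hτ₀
  have hca := StrictTri.ne₂ hτ₀
  have hbc := StrictTri.ne₃ hτ₀
  have ho : 0 ≤ oo x a b c t :=
    closure_minimal (fun τ (hτ : StrictTri x R a b c τ) => hτ.1.le)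
      (isClosed_le continuous_const (hx.continuous_oo a b c)) hcl
  have hD : ∀ z ∈ R, 0 ≤ DD x a b c z t := fun z hz =>
    closure_minimal (fun τ (hτ : StrictTri x R a b c τ) => hτ.DD_nonneg hz)
      (isClosed_le continuous_const (hx.continuous_DD a b c z)) hcl
  rcases ho.eq_or_lt with ho | ho
  · right
    refine exists_hullSwap hx ha hb hc hba hca hbc ho.symm fun z hz h1 h2 h3 => ?_
    exact lt_of_le_of_ne (hD z hz) (DD_ne_zero_of_oo_eq_zero hx hba hca hbc ho.symm hba hca h1 hbc
      h2.symm h3.symm).symm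
  · left
    have : ∃ z ∈ R, z ≠ a ∧ z ≠ b ∧ z ≠ c ∧ DD x a b c z t = 0 := by
      by_contra hcon
      push Not at hcon
      exact hn ⟨ho, fun z hz h1 h2 h3 => lt_of_le_of_ne (hD z hz) (hcon z hz h1 h2 h3).symm⟩
    obtain ⟨z, hz, h1, h2, h3, h0⟩ := this
    refine ⟨{a, b, c, z}, by simp, by simp, by simp, ?_, ?_, ?_⟩
    · intro w hw
      simp at hw
      rcases hw with rfl | rfl | rfl | rfl <;> assumption
    · exact card_four hba hca h1 hbc h2.symm h3.symm
    · obtain ⟨y₀, y₁, key⟩ := DD_slack ho.ne'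
      set o : Plane := !₂[x a t 0 + y₀ / 2, x a t 1 + y₁ / 2] with hodef
      have hd : ∀ w, dist (x w t) o ^ 2 = DD x a b c w t / oo x a b c t
          + ((y₀ / 2) ^ 2 + (y₁ / 2) ^ 2) := by
        intro w
        have e := dist_sq_eq (x := x) a w t o
        have k := key w
        rw [e, ← k]
        simp [hodef]
        ring
      have hon : ∀ w, DD x a b c w t = 0 → dist (x w t) o
          = Real.sqrt ((y₀ / 2) ^ 2 + (y₁ / 2) ^ 2) := by
        intro w hw
        symm
        rw [Real.sqrt_eq_iff_eq_sq (by positivity) dist_nonneg, hd, hw, zero_div, zero_add]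
      refine ⟨o, Real.sqrt ((y₀ / 2) ^ 2 + (y₁ / 2) ^ 2), ?_, ?_⟩
      · intro w hw
        simp at hw
        rcases hw with rfl | rfl | rfl | rfl
        · exact hon _ (DD_origin _ _)
        · exact hon _ (DD_self_left _ _)
        · exact hon _ (DD_self_right _ _)
        · exact hon _ h0
      · intro w hw
        rw [Real.sqrt_le_left dist_nonneg, hd]
        have := div_nonneg (hD w hw) ho.le
        linarith

theorem encard_triples_le (s : Finset (Fin n)) (t : ℝ) (S : Set (Fin n × Fin n × Fin n × ℝ))
    (h : ∀ e ∈ S, e.1 ∈ s ∧ e.2.1 ∈ s ∧ e.2.2.1 ∈ s ∧ e.2.2.2 = t) :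
    S.encard ≤ (s.card ^ 3 : ℕ) := by
  have : S ⊆ ((s ×ˢ s ×ˢ s ×ˢ ({t} : Finset ℝ) : Finset _) : Set (Fin n × Fin n × Fin n × ℝ)) := by
    intro e he
    have := h e he
    simp only [Finset.mem_coe, Finset.mem_product, Finset.mem_singleton]
    exact this
  refine (Set.encard_le_encard this).trans ?_
  rw [Set.encard_coe_eq_coe_finsetCard]
  simp
  norm_cast
  exact le_of_eq (by ring)

/-- The number of changes of the strictly Delaunay triangles of `R`. -/
theorem triRecords_ncard (hx : IsAdmissibleMotion x) (R : Finset (Fin n)) :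
    (triRecords x R).Finite ∧ (triRecords x R).ncard
      ≤ 64 * maxDelaunayCocircularities R.card + 54 * R.card ^ 2 := by
  obtain ⟨f1, c1⟩ := delaunayCocircularIn_ncard hx R
  obtain ⟨f2, c2⟩ := hullSwap_ncard hx R
  -- The constants 64 and 27 count the ordered triples from the four points of a co-circularity and
  -- from the three points of a hull swap.
  have k1 := ncard_le_mul_of_key (S := {e : Fin n × Fin n × Fin n × ℝ | e ∈ triRecords x R ∧
      ∃ s, e.1 ∈ s ∧ e.2.1 ∈ s ∧ e.2.2.1 ∈ s ∧ DelaunayCocircularIn x R s e.2.2.2})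
    f1.toFinset (fun e k => e.1 ∈ k.1 ∧ e.2.1 ∈ k.1 ∧ e.2.2.1 ∈ k.1 ∧ e.2.2.2 = k.2) (M := 64)
    (fun e he => by
      obtain ⟨-, s, h1, h2, h3, h4⟩ := he
      exact ⟨(s, e.2.2.2), by simpa using h4, h1, h2, h3, rfl⟩)
    (fun k hk => by
      have hk : DelaunayCocircularIn x R k.1 k.2 := by simpa using hk
      have := encard_triples_le k.1 k.2 _ (fun e (he : e ∈ {e | e ∈ {e : Fin n × Fin n × Fin n × ℝ |
        e ∈ triRecords x R ∧ ∃ s, e.1 ∈ s ∧ e.2.1 ∈ s ∧ e.2.2.1 ∈ s ∧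
          DelaunayCocircularIn x R s e.2.2.2} ∧ (e.1 ∈ k.1 ∧ e.2.1 ∈ k.1 ∧ e.2.2.1 ∈ k.1 ∧
          e.2.2.2 = k.2)}) => he.2)
      rw [hk.2.1] at this
      exact this)
  have k2 := ncard_le_mul_of_key (S := {e : Fin n × Fin n × Fin n × ℝ | e ∈ triRecords x R ∧
      ∃ a' b' c', ({e.1, e.2.1, e.2.2.1} : Finset (Fin n)) = {a', b', c'} ∧
        HullSwap x R a' b' c' e.2.2.2})
    f2.toFinset (fun e k => e.1 ∈ k.1 ∧ e.2.1 ∈ k.1 ∧ e.2.2.1 ∈ k.1 ∧ e.2.2.2 = k.2) (M := 27)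
    (fun e he => by
      obtain ⟨-, a', b', c', h1, h2⟩ := he
      refine ⟨({e.1, e.2.1, e.2.2.1}, e.2.2.2), ?_, by simp, by simp, by simp, rfl⟩
      rw [Set.Finite.mem_toFinset]
      exact ⟨a', b', c', h1, h2⟩)
    (fun k hk => by
      rw [Set.Finite.mem_toFinset] at hk
      obtain ⟨a', b', c', h1, h2⟩ := hk
      have := encard_triples_le k.1 k.2 _ (fun e (he : e ∈ {e | e ∈ {e : Fin n × Fin n × Fin n × ℝ |
        e ∈ triRecords x R ∧ ∃ a' b' c', ({e.1, e.2.1, e.2.2.1} : Finset (Fin n)) = {a', b', c'} ∧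
          HullSwap x R a' b' c' e.2.2.2} ∧ (e.1 ∈ k.1 ∧ e.2.1 ∈ k.1 ∧ e.2.2.1 ∈ k.1 ∧
          e.2.2.2 = k.2)}) => he.2)
      rw [h1, Finset.card_eq_three.mpr ⟨a', b', c', h2.ba.symm, h2.ca.symm, h2.bc, rfl⟩] at this
      rw [h1]
      exact this)
  have hsub : triRecords x R ⊆ {e : Fin n × Fin n × Fin n × ℝ | e ∈ triRecords x R ∧
      ∃ s, e.1 ∈ s ∧ e.2.1 ∈ s ∧ e.2.2.1 ∈ s ∧ DelaunayCocircularIn x R s e.2.2.2} ∪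
      {e : Fin n × Fin n × Fin n × ℝ | e ∈ triRecords x R ∧
      ∃ a' b' c', ({e.1, e.2.1, e.2.2.1} : Finset (Fin n)) = {a', b', c'} ∧
        HullSwap x R a' b' c' e.2.2.2} := by
    intro e he
    rcases triRecords_event hx he.1 he.2.1 he.2.2.1 he.2.2.2 with h | h
    · exact Or.inl ⟨he, h⟩
    · exact Or.inr ⟨he, h⟩
  have hfin := k1.1.union k2.1
  refine ⟨hfin.subset hsub, ?_⟩
  have h3 := (Set.ncard_le_ncard hsub hfin).trans (Set.ncard_union_le _ _)
  have e1 : f1.toFinset.card ≤ maxDelaunayCocircularities R.card := by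
    rw [← Set.ncard_eq_toFinset_card _ f1]; exact c1
  have e2 : f2.toFinset.card ≤ 2 * R.card ^ 2 := by
    rw [← Set.ncard_eq_toFinset_card _ f2]; exact c2
  have := k1.2
  have := k2.2
  omega

end records

/-! ### Consecutive Delaunay neighbours of `r`. -/

section neighbours
variable {n : ℕ} {x : Fin n → ℝ → Plane} {r u v w z p : Fin n} {R : Finset (Fin n)} {t : ℝ}

/-- A Delaunay neighbour `u` of `r` has a next neighbour `v` in counterclockwise order. -/
theorem DelaunayAt.exists_strictTri (hx : IsAdmissibleMotion x) (hu : DelaunayAt x R u r t)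
    (hgen : ∀ v ∈ R, ∀ z ∈ R, v ≠ r → z ≠ r → v ≠ u → z ≠ u → z ≠ v → DD x r u v z t ≠ 0)
    (hz : z ∈ R) (huz : 0 < oo x r u z t) : ∃ v ∈ R, StrictTri x R r u v t := by
  -- The reference circle has diameter `ru`. Moving its centre along the bisector of `ru`, the first
  -- point met on the left of `ru` minimizes `σ z / oo x r u z t`.
  set σ : Fin n → ℝ := fun z => nn x r z t - relX x r u t * relX x r z t
    - relY x r u t * relY x r z t with hσ
  have hσu : σ u = 0 := by simp only [hσ, nn]; ring
  have ex : ∀ v z, DD x r u v z t = oo x r u v t * σ z - oo x r u z t * σ v := by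
    intro v z
    have h := DD_expand (x := x) (r := r) (t := t) (relX x r u t) (relY x r u t) 0 u v z
    simp only [sub_zero, zero_mul, add_zero] at h
    have e : ∀ w, nn x r w t - relX x r u t * relX x r w t - relY x r u t * relY x r w t = σ w :=
      fun _ => rfl
    rw [e, e, e, hσu, oo_swap u z] at h
    rw [h]; ring
  obtain ⟨v, hv, hmin⟩ := Finset.exists_min_image (R.filter fun z => 0 < oo x r u z t)
    (fun z => σ z / oo x r u z t) ⟨z, by simp [hz, huz]⟩
  simp only [Finset.mem_filter] at hv hmin
  have hvr : v ≠ r := by rintro rfl; have := hv.2; rw [oo_self_right] at this; exact lt_irrefl _ this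
  have hvu : v ≠ u := by rintro rfl; have := hv.2; rw [oo_self] at this; exact lt_irrefl _ this
  refine ⟨v, hv.1, hv.2, fun w hw hwr hwu hwv => lt_of_le_of_ne ?_
    (hgen v hv.1 w hw hvr hwr hvu hwu hwv).symm⟩
  rcases lt_trichotomy (oo x r u w t) 0 with h | h | h
  · rw [← DD_cycle, ← DD_cycle]
    exact hu.DD_nonneg hw hv.1 (by rw [oo_swap]; linarith) hv.2.le
  · obtain ⟨l, hl⟩ := hx.exists_ratio hu.2.2.1 h
    rw [hl.DD_eq]
    exact mul_nonneg (mul_nonneg hv.2.le (hx.nn_pos hu.2.2.1 t).le)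
      (hu.ratio_pos hw (hx.nn_pos hu.2.2.1 t) hl)
  · rw [ex]
    have := hmin w ⟨hw, h⟩
    rw [div_le_div_iff₀ hv.2 h] at this
    linarith

/-- A Delaunay neighbour `u` of `r` has a next neighbour `v` in clockwise order. -/
theorem DelaunayAt.exists_strictTri' (hx : IsAdmissibleMotion x) (hu : DelaunayAt x R u r t)
    (hgen : ∀ v ∈ R, ∀ z ∈ R, v ≠ r → z ≠ r → v ≠ u → z ≠ u → z ≠ v → DD x r u v z t ≠ 0)
    (hz : z ∈ R) (huz : 0 < oo x r z u t) : ∃ v ∈ R, StrictTri x R r v u t := by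
  obtain ⟨v, hv, h⟩ := DelaunayAt.exists_strictTri (t := -t) (z := z) hx.mirror
    (delaunayAt_mirror.mpr (by rwa [neg_neg]))
    (fun v hv z hz h1 h2 h3 h4 h5 => by
      rw [DD_mirror, neg_neg]; exact neg_ne_zero.mpr (hgen v hv z hz h1 h2 h3 h4 h5))
    hz (by rw [oo_mirror, neg_neg, oo_swap]; linarith)
  exact ⟨v, hv, by rwa [strictTri_mirror, neg_neg] at h⟩

theorem DD_ne_zero_of_crosser (hx : IsAdmissibleMotion x) {q : Fin n} {s t e : ℝ}
    (hz : Crosser x r q z s t e) (hu : u ≠ r) :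
    ∀ v ∈ R, ∀ z ∈ R, v ≠ r → z ≠ r → v ≠ u → z ≠ u → z ≠ v → DD x r u v z t ≠ 0 :=
  fun _ _ _ _ h1 h2 h3 h4 h5 =>
    DD_ne_zero_of_oo_eq_zero hx hz.zr hz.qr hz.zq hz.zero hu h1 h2 h3.symm h4.symm h5.symm

/-- A triangle which is Delaunay at one time of an interval but not at all times changes in this
interval. -/
theorem exists_frontier_of_not_forall {S : Set ℝ} {a b τ : ℝ} (hτ : τ ∈ Icc a b) (h : τ ∈ S)
    (hn : ¬ ∀ y ∈ Icc a b, y ∈ S) : ∃ y ∈ Icc a b, y ∈ frontier S := by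
  push Not at hn
  obtain ⟨y, hy, hyS⟩ := hn
  by_contra hcon
  push Not at hcon
  obtain ⟨z, -, hz, hz'⟩ := isPreconnected_Icc (a := a) (b := b) _ _ isOpen_interior isOpen_interior
    (fun z hz => by
      by_contra hz'
      rw [mem_union, not_or] at hz'
      refine hcon z hz ⟨?_, hz'.1⟩
      rw [interior_compl, mem_compl_iff, not_not] at hz'
      exact hz'.2)
    ⟨τ, hτ, by_contra fun h' => hcon τ hτ ⟨subset_closure h, h'⟩⟩
    ⟨y, hy, (interior_compl (s := S)).ge fun h' => hcon y hy ⟨h', fun h'' => hyS (interior_subset h'')⟩⟩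
  exact interior_subset hz' (interior_subset hz)

end neighbours

/-! ### What a sample sees of an event. -/

namespace ChargedEvent
variable {n : ℕ} {x : Fin n → ℝ → Plane} {r u v w y z p d : Fin n} {R Q : Finset (Fin n)}

/-- The times at which the Delaunay triangles of `R` at the edge `ru` change. -/
def edgeRecords (x : Fin n → ℝ → Plane) (R : Finset (Fin n)) (r u : Fin n) : Set ℝ :=
  {b | ∃ v, (r, u, v, b) ∈ triRecords x R ∨ (r, v, u, b) ∈ triRecords x R}

/-- A triangle at `rp` changes during the event, in the set with `p` in place of `d`. -/
def RimChange (E : ChargedEvent x r) (R : Finset (Fin n)) (d : Fin n) : Prop :=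
  ∃ b ∈ Icc E.α₀ E.α₁, ∃ w, (r, w, E.p, b) ∈ triRecords x (insert E.p (R.erase d))

/-- A triangle at `ru` changes during the event. -/
def SpokeChange (E : ChargedEvent x r) (R : Finset (Fin n)) (u : Fin n) : Prop :=
  ∃ b ∈ Icc E.α₀ E.α₁, b ∈ edgeRecords x R r u

/-- The edge `ru` is Delaunay in `R` during the event, and `q` passes under `u`. -/
def PassesUnder (E : ChargedEvent x r) (R : Finset (Fin n)) (u : Fin n) : Prop :=
  (∀ τ ∈ Icc E.α₀ E.α₁, DelaunayAt x R u r τ) ∧ ∃ τ ∈ Icc E.α₀ E.α₁, Under x r E.q u τ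

/-- The triangles at `ru` persist during the event and contain `q` in the circles afterwards. -/
def Settles (E : ChargedEvent x r) (R : Finset (Fin n)) (u : Fin n) : Prop :=
  ¬ E.SpokeChange R u ∧ ∃ v ∈ R, (∀ τ ∈ Icc E.α₀ E.α₁, StrictTri x R r u v τ) ∧
    (∀ τ, E.α₁ ≤ τ → DD x r u v E.q τ < 0) ∧
    ((∀ τ, E.t u < τ → oo x r u E.q τ < 0) ∨
      ∃ v' ∈ R, (∀ τ ∈ Icc E.α₀ E.α₁, StrictTri x R r v' u τ) ∧
        ∀ τ, E.α₁ ≤ τ → DD x r v' u E.q τ < 0)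

theorem strictTri_of_not_mem {a b : ℝ} {τ : ℝ} (hr : r ∈ R) (hu : u ∈ R) (hv : v ∈ R)
    (hτ : τ ∈ Icc a b) (h : StrictTri x R r u v τ)
    (hn : ∀ y ∈ Icc a b, (r, u, v, y) ∉ triRecords x R) :
    ∀ y ∈ Icc a b, StrictTri x R r u v y := by
  by_contra hcon
  obtain ⟨y, hy, hy'⟩ := exists_frontier_of_not_forall (S := {τ | StrictTri x R r u v τ}) hτ h hcon
  exact hn y hy ⟨hr, hu, hv, hy'⟩

/-- Every event shows in a set `R` with three crossers in one of four ways. -/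
theorem classify (E : ChargedEvent x r) (hx : IsAdmissibleMotion x) (hE : E.Clear)
    (hz : z ∈ E.L) (hu : u ∈ E.L) (hy : y ∈ E.L) (hzu : E.t z < E.t u) (huy : E.t u < E.t y)
    (hr : r ∈ R) (hzR : z ∈ R) (huR : u ∈ R) (hyR : y ∈ R) (hqR : E.q ∉ R)
    (hA : Disjoint R E.A) (hdr : d ≠ r) (hdz : d ≠ z) (hdu : d ≠ u) (hdy : d ≠ y) :
    E.RimChange R d ∨ E.SpokeChange R u ∨ E.PassesUnder R u ∨ E.Settles R u := by
  by_cases h1 : E.RimChange R d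
  · exact Or.inl h1
  by_cases h2 : E.SpokeChange R u
  · exact Or.inr (Or.inl h2)
  refine Or.inr (Or.inr ?_)
  -- The point `d` makes room for `p`, which keeps the sample size. It must be none of the points
  -- used below.
  set Q := R.erase d with hQ
  have hQR : Q ⊆ R := Finset.erase_subset _ _
  have huQ : u ∈ Q := Finset.mem_erase.mpr ⟨hdu.symm, huR⟩
  have hyQ : y ∈ Q := Finset.mem_erase.mpr ⟨hdy.symm, hyR⟩
  have hrQ : r ∈ Q := Finset.mem_erase.mpr ⟨hdr.symm, hr⟩
  have cu := E.crosser' u hu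
  have cz := E.crosser' z hz
  have htu := E.t_mem hu
  have hup := (E.earlier hx hE hu).2 _ ⟨cu.lt₁.le, le_rfl⟩
  have hsub : insert E.p Q ⊆ Finset.univ \ E.A := by
    intro i hi
    rw [Finset.mem_insert] at hi
    rcases hi with rfl | hi
    · exact (E.alive _ htu).1
    · simp only [Finset.mem_sdiff, Finset.mem_univ, true_and]
      exact Finset.disjoint_left.mp hA (hQR hi)
  -- The triangle `r w p` found at the hit of `u` persists, since there is no rim change. The
  -- triangle at `ru` found below persists for lack of a spoke change.
  obtain ⟨w, hw, hwt⟩ := ((E.alive _ htu).mono hsub (by simp) (by simp [hrQ])).exists_strictTri' hx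
    (DD_ne_zero_of_crosser hx cu (E.alive _ htu).2.2.1) (by simp [huQ]) hup
  have hwQ : w ∈ Q := by
    rw [Finset.mem_insert] at hw
    exact hw.resolve_left hwt.ne₃
  have hws := strictTri_of_not_mem (by simp [hrQ]) (by simp [hwQ]) (by simp) htu hwt
    fun b hb h => h1 ⟨b, hb, w, h⟩
  obtain ⟨huw, huw'⟩ := E.neighbour hx hE hu hy huy huQ hyQ hws
  obtain ⟨v, hv, hvt⟩ := ((cu.alive _ ⟨cu.lt₁.le, cu.lt₂.le⟩).mono (Finset.subset_univ R) huR
    hr).exists_strictTri hx (DD_ne_zero_of_crosser hx cu cu.zr) (hQR hwQ) huw'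
  have hvs := strictTri_of_not_mem hr huR hv htu hvt fun b hb h => h2 ⟨b, hb, v, Or.inl h⟩
  have hal : ∀ τ ∈ Icc E.α₀ E.α₁, DelaunayAt x R u r τ :=
    fun τ hτ => (hvs τ hτ).alive_left hr huR
  by_cases h3 : ∃ τ ∈ Icc E.α₀ E.α₁, Under x r E.q u τ
  · exact Or.inl ⟨hal, h3⟩
  right
  push Not at h3
  refine ⟨h2, v, hv, hvs, E.inside_after hx hE hu hy huy huw huw' hQR huQ hyQ hrQ hwQ hqR hv hws
    hvs h3, ?_⟩
  -- If `q` was always to the left of `u` before the hit, the earlier crosser `z` provides a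
  -- triangle on the other side of `ru`. If not, `q` stays to the right of `u` afterwards.
  by_cases hc : ∀ y, y < E.t u → 0 < oo x r u E.q y
  · right
    have htz := E.t_mem hz
    obtain ⟨l, hl, hlr⟩ := cz.opposite
    obtain ⟨v', hv', hvt'⟩ := (hal _ htz).exists_strictTri' (z := z) hx
      (DD_ne_zero_of_crosser hx cz cu.zr) hzR (by
        rw [oo_swap, hlr.oo_right]
        have := mul_neg_of_neg_of_pos hl (hc _ hzu)
        linarith)
    have hvs' := strictTri_of_not_mem hr hv' huR htz hvt' fun b hb h => h2 ⟨b, hb, v', Or.inr h⟩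
    have hzQ : z ∈ Q := Finset.mem_erase.mpr ⟨hdz.symm, hzR⟩
    exact ⟨v', hv', hvs', E.inside_after' hx hE hu hz hzu huw huw' hQR huQ hzQ hrQ hwQ hqR hv' hws
      hvs' h3 hc⟩
  · exact Or.inl (E.right_after hx hu hc)

/-- Two independent events do not both settle at the same edge, if the triangles at this edge
persist in between. -/
theorem Settles.absurd (hx : IsAdmissibleMotion x) {E₁ E₂ : ChargedEvent x r} (h₁ : E₁.Settles R u)
    (h₂ : E₂.Settles R u) (h12 : E₁.Free E₂) (h21 : E₂.Free E₁) (hu₁ : u ∈ E₁.L) (hu₂ : u ∈ E₂.L)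
    (hr : r ∈ R) (huR : u ∈ R) (hα : E₁.α₀ ≤ E₂.α₀)
    (hn : ∀ b ∈ edgeRecords x R r u, E₁.α₀ ≤ b → E₂.α₀ ≤ b) : False := by
  obtain ⟨-, v, hv, hvs, hD, h⟩ := h₁
  obtain ⟨-, hlt⟩ := h12.order hx h21 hu₁ hu₂ hα
  have htu := E₁.t_mem hu₁
  have hle : E₁.α₀ ≤ E₁.α₁ := htu.1.trans htu.2
  -- The triangles of the first event persist until `u` is crossed in the second. At that time the
  -- first `q` is still confined, although `u` is then a neighbour of `r` in the full set.
  have hno : ∀ b ∈ Icc E₁.α₀ (E₂.e u), b ∉ edgeRecords x R r u := fun b hb hb' =>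
    h₂.1 ⟨b, ⟨hn b hb' hb.1, hb.2.trans (E₂.e_le u hu₂)⟩, hb'⟩
  have hmem : E₁.α₀ ∈ Icc E₁.α₀ (E₂.e u) := ⟨le_rfl, hle.trans hlt.le⟩
  have hT : E₂.e u ∈ Icc E₁.α₀ (E₂.e u) := ⟨hle.trans hlt.le, le_rfl⟩
  have cu := E₂.crosser' u hu₂
  have h3 := strictTri_of_not_mem hr huR hv hmem (hvs _ ⟨le_rfl, hle⟩)
    (fun b hb h => hno b hb ⟨v, Or.inl h⟩) _ hT
  have ha := cu.alive _ ⟨cu.lt.le, le_rfl⟩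
  rcases h with h | ⟨v', hv', hvs', hD'⟩
  · exact alive_inside_absurd (v' := v) hx ha h3.1 (hD _ hlt.le)
      (Or.inl (h _ (htu.2.trans_lt hlt)))
  · have h4 := strictTri_of_not_mem hr hv' huR hmem (hvs' _ ⟨le_rfl, hle⟩)
      (fun b hb h => hno b hb ⟨v', Or.inr h⟩) _ hT
    exact alive_inside_absurd hx ha h3.1 (hD _ hlt.le) (Or.inr ⟨h4.1, hD' _ hlt.le⟩)

end ChargedEvent

/-! ### How many events share a change or a spoke. -/

/-- A relation with out-degrees at most `d` has large independent sets. -/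
theorem exists_independent {ι : Type*} [DecidableEq ι] (B : ι → ι → Prop) (d : ℕ) [DecidableRel B] (k : ℕ) :
    ∀ T : Finset ι, (∀ i ∈ T, (T.filter (B i)).card ≤ d) → (2 * d + 1) * k < T.card →
      ∃ I ⊆ T, I.card = k + 1 ∧ ∀ i ∈ I, ∀ j ∈ I, i ≠ j → ¬ B i j := by
  induction k with
  | zero =>
    intro T _ hT
    obtain ⟨i, hi⟩ := Finset.card_pos.mp (by simpa using hT)
    refine ⟨{i}, by simpa using hi, by simp, ?_⟩
    intro a ha b hb hab
    simp only [Finset.mem_singleton] at ha hb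
    exact absurd (ha.trans hb.symm) hab
  | succ k ih =>
    intro T hB hT
    have hne : T.Nonempty := Finset.card_pos.mp (by omega)
    -- In-degrees and out-degrees have the same sum, so some in-degree is at most `d`. Keeping this
    -- element discards at most `2 * d` others.
    obtain ⟨i, hi, hin⟩ : ∃ i ∈ T, (T.filter fun j => B j i).card ≤ d := by
      refine Finset.exists_le_of_sum_le hne (f := fun i => (T.filter fun j => B j i).card)
        (g := fun _ => d) ?_
      have := Finset.sum_card_bipartiteAbove_eq_sum_card_bipartiteBelow (s := T) (t := T) B
      simp only [Finset.bipartiteAbove, Finset.bipartiteBelow] at this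
      rw [← this]
      exact Finset.sum_le_sum fun i hi => hB i hi
    set T' := T.filter fun j => j ≠ i ∧ ¬ B i j ∧ ¬ B j i with hT'
    have hsub : T ⊆ T' ∪ ({i} ∪ T.filter (B i) ∪ T.filter fun j => B j i) := by
      intro j hj
      simp only [hT', Finset.mem_union, Finset.mem_filter, Finset.mem_singleton]
      tauto
    have h1 := Finset.card_le_card hsub
    have h2 := Finset.card_union_le T' ({i} ∪ T.filter (B i) ∪ T.filter fun j => B j i)
    have h3 := Finset.card_union_le ({i} ∪ T.filter (B i)) (T.filter fun j => B j i)
    have h4 := Finset.card_union_le {i} (T.filter (B i))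
    have h5 := hB i hi
    rw [Finset.card_singleton] at h4
    have hmul : (2 * d + 1) * (k + 1) = (2 * d + 1) * k + (2 * d + 1) := by ring
    obtain ⟨I, hI, hcard, hind⟩ := ih T' (fun j hj => (Finset.card_le_card
      (Finset.filter_subset_filter _ (Finset.filter_subset _ _))).trans
      (hB j (Finset.mem_of_mem_filter j hj))) (by omega)
    have hI' : ∀ j ∈ I, j ∈ T ∧ j ≠ i ∧ ¬ B i j ∧ ¬ B j i := fun j hj => by
      simpa [hT'] using hI hj
    refine ⟨insert i I, ?_, ?_, ?_⟩
    · intro j hj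
      rcases Finset.mem_insert.mp hj with rfl | hj
      · exact hi
      · exact (hI' j hj).1
    · rw [Finset.card_insert_of_notMem fun h => (hI' i h).2.1 rfl, hcard]
    · intro a ha b hb hab
      rcases Finset.mem_insert.mp ha with ha | ha <;> rcases Finset.mem_insert.mp hb with hb | hb
      · exact absurd (ha.trans hb.symm) hab
      · rw [ha]; exact (hI' b hb).2.2.1
      · rw [hb]; exact (hI' a ha).2.2.2
      · exact hind a ha b hb hab

/-- A family of charged events in which the crossers are the ones closest to the crossing. -/
structure ChargedFamily {n : ℕ} (x : Fin n → ℝ → Plane) (r : Fin n) {ι : Type*} (S : Finset ι)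
    (E : ι → ChargedEvent x r) (l : ℕ) : Prop where
  inj : ∀ i ∈ S, ∀ j ∈ S, (E i).q = (E j).q → (E i).p = (E j).p → i = j
  card_A : ∀ i ∈ S, (E i).A.card ≤ 7
  card_L : ∀ i ∈ S, (E i).L.card = l
  start_lt : ∀ i ∈ S, ∀ u ∈ (E i).L, (E i).a u < (E i).t₀
  closest : ∀ i ∈ S, ∀ u ∈ (E i).L, ∀ z s₀ s₁, IsSingleCrossing x z (E i).q r s₀ s₁ →
    (E i).a u < s₀ → s₀ ≤ (E i).t₀ → z = (E i).p ∨ z ∈ (E i).L ∨ z ∈ (E i).A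

namespace ChargedFamily
open ChargedEvent
variable {n : ℕ} {x : Fin n → ℝ → Plane} {r u p q : Fin n} {ι : Type*}
  {S T : Finset ι} {E : ι → ChargedEvent x r} {l k : ℕ} {R X : Finset (Fin n)} {b : ℝ}

/-- Compare with the latest of these crossings. All the others start between the crossing of `u`,
which is unique, and the latest one. As `L` consists of the closest crossers, their points `p` are
among its `p`, `L` and `A`. -/
theorem card_le_of_q_eq (F : ChargedFamily x r S E l) (hx : IsAdmissibleMotion x) (hT : T ⊆ S)
    (hu : ∀ i ∈ T, u ∈ (E i).L) (hq : ∀ i ∈ T, (E i).q = q) : T.card ≤ l + 8 := by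
  classical
  rcases T.eq_empty_or_nonempty with rfl | hne
  · simp
  obtain ⟨i, hi, hmax⟩ := Finset.exists_max_image T (fun i => (E i).t₀) hne
  have hsub : T.image (fun j => (E j).p) ⊆ insert (E i).p ((E i).L ∪ (E i).A) := by
    intro z hz
    obtain ⟨j, hj, rfl⟩ := Finset.mem_image.mp hz
    have hqq : (E j).q = (E i).q := (hq j hj).trans (hq i hi).symm
    have hj1 := (E j).single
    have hj2 := (E j).single' u (hu j hj)
    rw [hqq] at hj1 hj2
    have ha := (IsSingleCrossing.unique hx hj2 ((E i).single' u (hu i hi))).1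
    have h1 := F.start_lt j (hT hj) u (hu j hj)
    rw [ha] at h1
    rcases F.closest i (hT hi) u (hu i hi) _ _ _ hj1 h1 (hmax j hj) with h | h | h <;>
      simp [h]
  have h1 := Finset.card_le_card hsub
  rw [Finset.card_image_of_injOn fun a ha b hb hab =>
    F.inj a (hT ha) b (hT hb) ((hq a ha).trans (hq b hb).symm) hab] at h1
  have h2 := Finset.card_insert_le (E i).p ((E i).L ∪ (E i).A)
  have h3 := Finset.card_union_le (E i).L (E i).A
  have h4 := F.card_A i (hT hi)
  have h5 := F.card_L i (hT hi)
  omega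

/-- The points `p` and `A` of an event forbid at most 8 values of `q`. So `17 * k + 1` events with
distinct `q` contain `k + 1` mutually free ones, where `17 = 2 * 8 + 1`. -/
theorem card_le_of_no_independent (F : ChargedFamily x r S E l) (hx : IsAdmissibleMotion x)
    (hT : T ⊆ S) (hu : ∀ i ∈ T, u ∈ (E i).L)
    (hk : ¬ ∃ I ⊆ T, I.card = k + 1 ∧ ∀ i ∈ I, ∀ j ∈ I, i ≠ j → (E i).Free (E j)) :
    T.card ≤ 17 * k * (l + 8) := by
  classical
  have himg : (T.image fun i => (E i).q).card ≤ 17 * k := by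
    by_contra hlt
    obtain ⟨T', hT', hinj, himg⟩ : ∃ T' ⊆ T, Set.InjOn (fun i => (E i).q) (T' : Set ι) ∧
        (T'.image fun i => (E i).q) = T.image fun i => (E i).q := by
      obtain ⟨T', h1, h2, h3⟩ := Finset.exists_subset_injOn_image_eq_of_surjOn (f := fun i => (E i).q)
        T (T.image fun i => (E i).q) (by rw [Finset.coe_image]; exact Set.surjOn_image _ _)
      exact ⟨T', h1, h2, h3⟩
    have hcard : T'.card = (T.image fun i => (E i).q).card := by
      rw [← himg, Finset.card_image_of_injOn hinj]
    obtain ⟨I, hI, h1, h2⟩ := exists_independent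
      (fun i j => (E j).q ∈ insert (E i).p (E i).A) 8 k T' (fun i hi => by
        have h1 : ((T'.filter fun j => (E j).q ∈ insert (E i).p (E i).A).image fun j => (E j).q)
            ⊆ insert (E i).p (E i).A := by
          intro z hz
          obtain ⟨j, hj, rfl⟩ := Finset.mem_image.mp hz
          exact (Finset.mem_filter.mp hj).2
        have h2 := Finset.card_le_card h1
        rw [Finset.card_image_of_injOn (hinj.mono (by
          intro j hj; exact (Finset.mem_filter.mp hj).1))] at h2
        have h3 := Finset.card_insert_le (E i).p (E i).A
        have h4 := F.card_A i (hT (hT' hi))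
        omega) (by omega)
    refine hk ⟨I, hI.trans hT', h1, fun i hi j hj hij => ?_⟩
    have := h2 i hi j hj hij
    rw [Finset.mem_insert, not_or] at this
    exact ⟨this.2, this.1⟩
  have := Finset.card_le_mul_card_image (f := fun i => (E i).q) T (l + 8) (fun q hq =>
    F.card_le_of_q_eq hx ((Finset.filter_subset _ _).trans hT)
      (fun i hi => hu i (Finset.mem_of_mem_filter i hi)) (q := q)
      fun i hi => (Finset.mem_filter.mp hi).2)
  calc T.card ≤ (l + 8) * (T.image fun i => (E i).q).card := this
    _ ≤ (l + 8) * (17 * k) := Nat.mul_le_mul_left _ himg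
    _ = _ := by ring

theorem card_overlapping_le (F : ChargedFamily x r S E l) (hx : IsAdmissibleMotion x)
    (hT : T ⊆ S) (hu : ∀ i ∈ T, u ∈ (E i).L) (hb : ∀ i ∈ T, b ∈ Icc (E i).α₀ (E i).α₁)
    (hy : ∀ i ∈ T, ∃ y ∈ (E i).L, (E i).t y < (E i).t u) : T.card ≤ 51 * (l + 8) := by
  classical
  refine F.card_le_of_no_independent (k := 3) hx hT hu ?_
  rintro ⟨I, hI, hcard, hind⟩
  have pop : ∀ J : Finset ι, J.Nonempty → ∃ i ∈ J, ∀ j ∈ J.erase i, (E i).α₀ ≤ (E j).α₀ ∧ j ≠ i := by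
    intro J hJ
    obtain ⟨i, hi, hmin⟩ := Finset.exists_min_image J (fun i => (E i).α₀) hJ
    exact ⟨i, hi, fun j hj => ⟨hmin j (Finset.mem_of_mem_erase hj), Finset.ne_of_mem_erase hj⟩⟩
  obtain ⟨i₁, h₁, m₁⟩ := pop I (Finset.card_pos.mp (by omega))
  have c₁ := Finset.card_erase_of_mem h₁
  obtain ⟨i₂, h₂, m₂⟩ := pop (I.erase i₁) (Finset.card_pos.mp (by omega))
  have c₂ := Finset.card_erase_of_mem h₂
  obtain ⟨i₃, h₃, m₃⟩ := pop ((I.erase i₁).erase i₂) (Finset.card_pos.mp (by omega))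
  have c₃ := Finset.card_erase_of_mem h₃
  obtain ⟨i₄, h₄⟩ := Finset.card_pos.mp (show 0 < (((I.erase i₁).erase i₂).erase i₃).card by omega)
  have a12 := m₁ i₂ h₂
  have a23 := m₂ i₃ h₃
  have a34 := m₃ i₄ h₄
  have k₂ := Finset.mem_of_mem_erase h₂
  have k₃ := Finset.mem_of_mem_erase (Finset.mem_of_mem_erase h₃)
  have k₄ := Finset.mem_of_mem_erase (Finset.mem_of_mem_erase (Finset.mem_of_mem_erase h₄))
  obtain ⟨y, hy, hyt⟩ := hy i₃ (hI k₃)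
  exact four_overlapping_absurd hx (hind _ h₁ _ k₂ a12.2.symm) (hind _ k₂ _ h₁ a12.2)
    (hind _ k₂ _ k₃ a23.2.symm) (hind _ k₃ _ k₂ a23.2) (hind _ k₃ _ k₄ a34.2.symm)
    (hind _ k₄ _ k₃ a34.2) (hu _ (hI h₁)) (hu _ (hI k₂)) (hu _ (hI k₃)) (hu _ (hI k₄)) a12.1 a23.1
    a34.1 (hb _ (hI h₁)).2 (hb _ (hI k₄)).1 hy hyt

/-- By `hkey` no triangle at `ru` changes between the starts of two of these events, so already two
free ones contradict `Settles.absurd`. -/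
theorem card_settles_le (F : ChargedFamily x r S E l) (hx : IsAdmissibleMotion x) (hr : r ∈ R)
    (huR : u ∈ R) (hT : T ⊆ S) (hu : ∀ i ∈ T, u ∈ (E i).L) (hs : ∀ i ∈ T, (E i).Settles R u)
    (hkey : ∀ i ∈ T, ∀ j ∈ T, ∀ b ∈ edgeRecords x R r u, (E i).α₀ ≤ b → (E j).α₀ ≤ b) :
    T.card ≤ 17 * (l + 8) := by
  classical
  refine F.card_le_of_no_independent (k := 1) hx hT hu ?_
  rintro ⟨I, hI, hcard, hind⟩
  obtain ⟨i, j, hij, rfl⟩ := Finset.card_eq_two.mp hcard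
  have hi : i ∈ T := hI (by simp)
  have hj : j ∈ T := hI (by simp)
  have f1 := hind i (by simp) j (by simp) hij
  have f2 := hind j (by simp) i (by simp) hij.symm
  rcases le_total (E i).α₀ (E j).α₀ with h | h
  · exact (hs i hi).absurd hx (hs j hj) f1 f2 (hu i hi) (hu j hj) hr huR h (hkey i hi j hj)
  · exact (hs j hj).absurd hx (hs i hi) f2 f1 (hu j hj) (hu i hi) hr huR h (hkey j hj i hi)

/-- All intervals contain `b`, so those with the least `α₀` and the greatest `α₁` cover the rest.
Without their sets `A`, at most 14 points, `pr` is Delaunay on the union. Exclusion then forces each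
`q` to be one of these points, as an event has more than 14 crossers to choose from. -/
theorem card_rim_le (F : ChargedFamily x r S E l) (hx : IsAdmissibleMotion x) (hl : 14 < l)
    (hT : T ⊆ S) (hp : ∀ i ∈ T, (E i).p = p) (hb : ∀ i ∈ T, b ∈ Icc (E i).α₀ (E i).α₁) :
    T.card ≤ 14 := by
  classical
  rcases T.eq_empty_or_nonempty with rfl | hne
  · simp
  obtain ⟨i, hi, hmin⟩ := Finset.exists_min_image T (fun i => (E i).α₀) hne
  obtain ⟨j, hj, hmax⟩ := Finset.exists_max_image T (fun i => (E i).α₁) hne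
  have hc : ((E i).A ∪ (E j).A).card ≤ 14 := by
    have h1 := Finset.card_union_le (E i).A (E j).A
    have h2 := F.card_A i (hT hi)
    have h3 := F.card_A j (hT hj)
    omega
  have hsub : T.image (fun a => (E a).q) ⊆ (E i).A ∪ (E j).A := by
    intro z hz
    obtain ⟨a, ha, rfl⟩ := Finset.mem_image.mp hz
    by_contra hq
    obtain ⟨u, hu, huA⟩ := Finset.exists_mem_notMem_of_card_lt_card
      (show ((E i).A ∪ (E j).A).card < (E a).L.card by rw [F.card_L a (hT ha)]; omega)
    have hpi := (hp a ha).trans (hp i hi).symm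
    have hpj := (hp a ha).trans (hp j hj).symm
    refine ((E a).crosser' u hu).exclusion hx ((E a).p_ne u hu) (E a).crosser.zq
      (X := Finset.univ \ ((E i).A ∪ (E j).A)) (by simpa using huA) (by simpa using hq) ?_
    intro τ hτ
    have h1 : ∀ k, (E a).p = (E k).p → τ ∈ Icc (E k).α₀ (E k).α₁ → (E k).A ⊆ (E i).A ∪ (E j).A →
        (E k).p ∉ (E i).A ∪ (E j).A → r ∉ (E i).A ∪ (E j).A →
        DelaunayAt x (Finset.univ \ ((E i).A ∪ (E j).A)) (E a).p r τ := by
      intro k hk hτk hkA h2 h3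
      rw [hk]
      exact ((E k).alive τ hτk).mono (Finset.sdiff_subset_sdiff (Finset.Subset.refl _) hkA)
        (by simpa using h2) (by simpa using h3)
    have hpr : ∀ k ∈ T, (E a).p ∉ (E k).A ∧ r ∉ (E k).A := by
      intro k hk
      have := (E k).alive b (hb k hk)
      have h2 := this.1
      have h3 := this.2.1
      rw [← (hp a ha).trans (hp k hk).symm] at h2
      simp only [Finset.mem_sdiff, Finset.mem_univ, true_and] at h2 h3
      exact ⟨h2, h3⟩
    have hi' := hpr i hi
    have hj' := hpr j hj
    have hpn : (E a).p ∉ (E i).A ∪ (E j).A := by simp [hi'.1, hj'.1]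
    have hrn : r ∉ (E i).A ∪ (E j).A := by simp [hi'.2, hj'.2]
    rcases le_total τ b with h | h
    · exact h1 i hpi ⟨(hmin a ha).trans (((E a).le_s u hu).trans hτ.1), h.trans (hb i hi).2⟩
        Finset.subset_union_left (hpi ▸ hpn) hrn
    · exact h1 j hpj ⟨(hb j hj).1.trans h, (hτ.2.trans ((E a).e_le u hu)).trans (hmax a ha)⟩
        Finset.subset_union_right (hpj ▸ hpn) hrn
  have := Finset.card_le_card hsub
  rw [Finset.card_image_of_injOn fun a ha b hb hab =>
    F.inj a (hT ha) b (hT hb) hab ((hp a ha).trans (hp b hb).symm)] at this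
  omega

/-- The passages before the crossing of `u` all belong to one `q`, and so do those after it. During
the crossing `u` is a neighbour in the full set and nothing passes under it. -/
theorem card_passesUnder_le (F : ChargedFamily x r S E l) (hx : IsAdmissibleMotion x)
    (hT : T ⊆ S) (hu : ∀ i ∈ T, u ∈ (E i).L) (hq : ∀ i ∈ T, (E i).q ∈ X)
    (h : ∀ i ∈ T, (E i).PassesUnder (X.erase (E i).q) u) : T.card ≤ 2 * (l + 8) := by
  classical
  have one : ∀ T' ⊆ T, (∀ i ∈ T', ∀ j ∈ T', (E i).q = (E j).q) → T'.card ≤ l + 8 := by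
    intro T' hT' hqq
    rcases T'.eq_empty_or_nonempty with rfl | ⟨i, hi⟩
    · simp
    exact F.card_le_of_q_eq hx (hT'.trans hT) (fun j hj => hu j (hT' hj)) (q := (E i).q)
      fun j hj => hqq j hj i hi
  have h1 := one (T.filter fun i => ∃ τ ∈ Icc (E i).α₀ (E i).α₁, Under x r (E i).q u τ ∧
    τ < (E i).a u) (Finset.filter_subset _ _) (by
      intro i hi j hj
      obtain ⟨hi, f, hf, hU, hfa⟩ := Finset.mem_filter.mp hi
      obtain ⟨hj, f', hf', hU', hfa'⟩ := Finset.mem_filter.mp hj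
      by_contra hne
      exact under_before_absurd hx ((E i).single' u (hu i hi)) ((E j).single' u (hu j hj)) hne
        (hq i hi) (hq j hj) (h i hi).1 (h j hj).1
        (((E i).lt_e u (hu i hi)).le.trans ((E i).e_le u (hu i hi)))
        (((E j).lt_e u (hu j hj)).le.trans ((E j).e_le u (hu j hj)))
        hfa hfa' hf.1 hf'.1 hU hU')
  have h2 := one (T.filter fun i => ∃ τ ∈ Icc (E i).α₀ (E i).α₁, Under x r (E i).q u τ ∧
    (E i).b u < τ) (Finset.filter_subset _ _) (by
      intro i hi j hj
      obtain ⟨hi, f, hf, hU, hfa⟩ := Finset.mem_filter.mp hi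
      obtain ⟨hj, f', hf', hU', hfa'⟩ := Finset.mem_filter.mp hj
      by_contra hne
      exact under_after_absurd hx ((E i).single' u (hu i hi)) ((E j).single' u (hu j hj)) hne
        (hq i hi) (hq j hj) (h i hi).1 (h j hj).1
        (((E i).le_s u (hu i hi)).trans ((E i).s_lt u (hu i hi)).le)
        (((E j).le_s u (hu j hj)).trans ((E j).s_lt u (hu j hj)).le)
        hfa hfa' hf.2 hf'.2 hU hU')
  have h3 : T ⊆ (T.filter fun i => ∃ τ ∈ Icc (E i).α₀ (E i).α₁, Under x r (E i).q u τ ∧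
      τ < (E i).a u) ∪ (T.filter fun i => ∃ τ ∈ Icc (E i).α₀ (E i).α₁, Under x r (E i).q u τ ∧
      (E i).b u < τ) := by
    intro i hi
    obtain ⟨-, τ, hτ, hU⟩ := h i hi
    simp only [Finset.mem_union, Finset.mem_filter]
    rcases lt_or_ge τ ((E i).a u) with h1 | h1
    · exact Or.inl ⟨hi, τ, hτ, hU, h1⟩
    rcases lt_or_ge ((E i).b u) τ with h2 | h2
    · exact Or.inr ⟨hi, τ, hτ, hU, h2⟩
    exact absurd hU ((((E i).crosser' u (hu i hi)).alive τ ⟨((E i).s_lt u (hu i hi)).le.trans h1,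
      h2.trans ((E i).lt_e u (hu i hi)).le⟩).not_under (Finset.mem_univ _) hx)
  have h4 := Finset.card_le_card h3
  have h5 := Finset.card_union_le (T.filter fun i => ∃ τ ∈ Icc (E i).α₀ (E i).α₁,
    Under x r (E i).q u τ ∧ τ < (E i).a u) (T.filter fun i => ∃ τ ∈ Icc (E i).α₀ (E i).α₁,
      Under x r (E i).q u τ ∧ (E i).b u < τ)
  omega

/-- Few events are not clear. -/
theorem card_not_clear_le (F : ChargedFamily x r S E l) (hx : IsAdmissibleMotion x) (hT : T ⊆ S)
    (hp : ∀ i ∈ T, (E i).p = p) (h : ∀ i ∈ T, ¬ (E i).Clear) : T.card ≤ 17 := by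
  classical
  by_contra hlt
  have hinj : Set.InjOn (fun i => (E i).q) (T : Set ι) := fun a ha b hb hab =>
    F.inj a (hT ha) b (hT hb) hab ((hp a ha).trans (hp b hb).symm)
  -- Two events whose points `q` avoid each other's `A` suffice: both pass under the common `p`,
  -- within `{p, r}` and the two points `q`.
  obtain ⟨I, hI, h1, h2⟩ := exists_independent (fun i j => (E j).q ∈ (E i).A) 7 1 T (fun i hi => by
    have h1 : ((T.filter fun j => (E j).q ∈ (E i).A).image fun j => (E j).q) ⊆ (E i).A := by
      intro z hz
      obtain ⟨j, hj, rfl⟩ := Finset.mem_image.mp hz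
      exact (Finset.mem_filter.mp hj).2
    have h2 := Finset.card_le_card h1
    rw [Finset.card_image_of_injOn (hinj.mono (by
      intro j hj; exact (Finset.mem_filter.mp hj).1))] at h2
    have h4 := F.card_A i (hT hi)
    omega) (by omega)
  obtain ⟨i, j, hij, rfl⟩ := Finset.card_eq_two.mp h1
  have hi : i ∈ T := hI (by simp)
  have hj : j ∈ T := hI (by simp)
  have n1 := h2 i (by simp) j (by simp) hij
  have n2 := h2 j (by simp) i (by simp) hij.symm
  have hq : (E i).q ≠ (E j).q := fun h => hij (hinj hi hj h)
  have hc := h i hi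
  have hc' := h j hj
  unfold Clear at hc hc'
  push Not at hc hc'
  obtain ⟨f, hf, hU⟩ := hc
  obtain ⟨f', hf', hU'⟩ := hc'
  have al : ∀ i j, i ∈ T → j ∈ T → (E j).q ∉ (E i).A → (E i).q ≠ (E j).q →
      ∀ τ ∈ Icc (E i).α₀ (E i).α₁,
      DelaunayAt x (({p, r, (E i).q, (E j).q} : Finset (Fin n)).erase (E i).q) p r τ := by
    intro i j hi hj hn hne τ hτ
    have ha := (E i).alive τ hτ
    have hpq := (E i).crosser.zq
    have hqr := (E i).crosser.qr
    rw [hp i hi] at ha hpq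
    refine ha.mono ?_ (by simp [hpq]) (by simp [hqr.symm])
    intro z hz
    simp only [Finset.mem_erase, Finset.mem_insert, Finset.mem_singleton] at hz
    rcases hz with ⟨h1, rfl | rfl | h2 | rfl⟩
    · exact ha.1
    · exact ha.2.1
    · exact absurd h2 h1
    · simpa using hn
  have s1 := (E i).single
  have s2 := (E j).single
  rw [hp i hi] at s1 hU
  rw [hp j hj] at s2 hU'
  have al2 := al j i hj hi n2 hq.symm
  rw [Finset.pair_comm] at al2
  exact under_before_absurd hx s1 s2 hq (X := {p, r, (E i).q, (E j).q}) (by simp) (by simp)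
    (al i j hi hj n1 hq) al2
    (E i).t₁_le (E j).t₁_le hf.2 hf'.2 hf.1 hf'.1 hU hU'

end ChargedFamily

/-! ### Summation over the samples. -/

namespace ChargedFamily
open ChargedEvent
variable {n : ℕ} {x : Fin n → ℝ → Plane} {r u p q : Fin n} {ι : Type*}
  {S T : Finset ι} {E : ι → ChargedEvent x r} {l k m : ℕ} {R X : Finset (Fin n)} {b : ℝ}

/-- The changes of the Delaunay triangles of `R` at `r`. -/
noncomputable def vertexRecords (hx : IsAdmissibleMotion x) (R : Finset (Fin n)) (r : Fin n) :
    Finset (Fin n × Fin n × Fin n × ℝ) :=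
  (triRecords_ncard hx R).1.toFinset.filter fun e => e.1 = r

theorem mem_vertexRecords (hx : IsAdmissibleMotion x) {e : Fin n × Fin n × Fin n × ℝ} :
    e ∈ vertexRecords hx R r ↔ e ∈ triRecords x R ∧ e.1 = r := by
  simp [vertexRecords]

theorem exists_edgeRecords (hx : IsAdmissibleMotion x) (R : Finset (Fin n)) (r : Fin n) :
    ∃ B : Fin n → Finset ℝ, (∀ u b, b ∈ B u ↔ b ∈ edgeRecords x R r u) ∧
      ∑ u ∈ R, (B u).card ≤ 2 * (vertexRecords hx R r).card := by
  classical
  set V := vertexRecords hx R r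
  refine ⟨fun u => (V.filter fun e => e.2.1 = u).image (fun e => e.2.2.2) ∪
    (V.filter fun e => e.2.2.1 = u).image (fun e => e.2.2.2), ?_, ?_⟩
  · intro u b
    simp only [Finset.mem_union, Finset.mem_image, Finset.mem_filter, V, mem_vertexRecords,
      edgeRecords, Set.mem_ofPred_eq]
    constructor
    · rintro (⟨⟨a, c, d, e⟩, ⟨⟨h, rfl⟩, rfl⟩, rfl⟩ | ⟨⟨a, c, d, e⟩, ⟨⟨h, rfl⟩, rfl⟩, rfl⟩)
      · exact ⟨d, Or.inl h⟩
      · exact ⟨c, Or.inr h⟩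
    · rintro ⟨v, h | h⟩
      · exact Or.inl ⟨_, ⟨⟨h, rfl⟩, rfl⟩, rfl⟩
      · exact Or.inr ⟨_, ⟨⟨h, rfl⟩, rfl⟩, rfl⟩
  · have h1 : V.card = ∑ u ∈ R, (V.filter fun e => e.2.1 = u).card :=
      Finset.card_eq_sum_card_fiberwise fun e he => ((mem_vertexRecords hx).mp he).1.2.1
    have h2 : V.card = ∑ u ∈ R, (V.filter fun e => e.2.2.1 = u).card :=
      Finset.card_eq_sum_card_fiberwise fun e he => ((mem_vertexRecords hx).mp he).1.2.2.1
    have h3 : 2 * V.card = ∑ u ∈ R, ((V.filter fun e => e.2.1 = u).card +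
        (V.filter fun e => e.2.2.1 = u).card) := by
      rw [Finset.sum_add_distrib, ← h1, ← h2]; ring
    rw [h3]
    exact Finset.sum_le_sum fun u _ => (Finset.card_union_le _ _).trans
      (add_le_add Finset.card_image_le Finset.card_image_le)

-- Each change at `ru` is shared by at most `51 * (l + 8)` events. The settling events are sorted by
-- the number of changes at `ru` before their start, with at most `17 * (l + 8)` in each class. The
-- final factor 2 arises because a change at `r` belongs to two spokes.
open Classical in
theorem card_spoke_settles_le (F : ChargedFamily x r S E l) (hx : IsAdmissibleMotion x)
    (hr : r ∈ R) :
    (S.filter fun i => ∃ u ∈ R, u ∈ (E i).L ∧ (∃ y ∈ (E i).L, (E i).t y < (E i).t u) ∧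
      ((E i).SpokeChange R u ∨ (E i).Settles R u)).card
      ≤ (l + 8) * (136 * (vertexRecords hx R r).card + 17 * R.card) := by
  obtain ⟨B, hB, hsum⟩ := exists_edgeRecords hx R r
  set T₁ : Fin n → ℝ → Finset ι := fun u b => S.filter fun i => u ∈ (E i).L ∧
    (∃ y ∈ (E i).L, (E i).t y < (E i).t u) ∧ b ∈ Icc (E i).α₀ (E i).α₁
  set T₂ : Fin n → ℕ → Finset ι := fun u κ => S.filter fun i => u ∈ (E i).L ∧
    (E i).Settles R u ∧ ((B u).filter fun b => b < (E i).α₀).card = κ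
  have c₁ : ∀ u b, (T₁ u b).card ≤ 51 * (l + 8) := fun u b =>
    F.card_overlapping_le hx (b := b) (Finset.filter_subset _ _)
      (fun i hi => (Finset.mem_filter.mp hi).2.1)
      (fun i hi => (Finset.mem_filter.mp hi).2.2.2) (fun i hi => (Finset.mem_filter.mp hi).2.2.1)
  have c₂ : ∀ u ∈ R, ∀ κ, (T₂ u κ).card ≤ 17 * (l + 8) := fun u hu κ => by
    refine F.card_settles_le hx hr hu (Finset.filter_subset _ _)
      (fun i hi => (Finset.mem_filter.mp hi).2.1) (fun i hi => (Finset.mem_filter.mp hi).2.2.1) ?_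
    intro i hi j hj b hb hib
    have h1 := (Finset.mem_filter.mp hi).2.2.2
    have h2 := (Finset.mem_filter.mp hj).2.2.2
    by_contra hjb
    push Not at hjb
    have hlt : (B u).filter (fun b => b < (E i).α₀) ⊂ (B u).filter fun b => b < (E j).α₀ := by
      refine (Finset.ssubset_iff_of_subset fun c hc => ?_).mpr ⟨b, ?_, ?_⟩
      · rw [Finset.mem_filter] at hc ⊢
        exact ⟨hc.1, hc.2.trans_le (hib.trans hjb.le)⟩
      · exact Finset.mem_filter.mpr ⟨(hB u b).mpr hb, hjb⟩
      · exact fun h => absurd (Finset.mem_filter.mp h).2 (not_lt.mpr hib)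
    have := Finset.card_lt_card hlt
    omega
  have hsub : (S.filter fun i => ∃ u ∈ R, u ∈ (E i).L ∧ (∃ y ∈ (E i).L, (E i).t y < (E i).t u) ∧
      ((E i).SpokeChange R u ∨ (E i).Settles R u)) ⊆ R.biUnion fun u => (B u).biUnion (T₁ u) ∪
        (Finset.range ((B u).card + 1)).biUnion (T₂ u) := by
    intro i hi
    obtain ⟨hi, u, hu, huL, hy, h⟩ := Finset.mem_filter.mp hi
    refine Finset.mem_biUnion.mpr ⟨u, hu, Finset.mem_union.mpr ?_⟩
    rcases h with ⟨b, hb, hb'⟩ | h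
    · exact Or.inl (Finset.mem_biUnion.mpr ⟨b, (hB u b).mpr hb',
        Finset.mem_filter.mpr ⟨hi, huL, hy, hb⟩⟩)
    · refine Or.inr (Finset.mem_biUnion.mpr ⟨((B u).filter fun b => b < (E i).α₀).card, ?_,
        Finset.mem_filter.mpr ⟨hi, huL, h, rfl⟩⟩)
      exact Finset.mem_range.mpr (Nat.lt_succ_of_le (Finset.card_filter_le _ _))
  refine (Finset.card_le_card hsub).trans (Finset.card_biUnion_le.trans ?_)
  have : ∀ u ∈ R, ((B u).biUnion (T₁ u) ∪ (Finset.range ((B u).card + 1)).biUnion (T₂ u)).card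
      ≤ 68 * (l + 8) * (B u).card + 17 * (l + 8) := by
    intro u hu
    have h1 := Finset.card_biUnion_le_card_mul (B u) (T₁ u) _ fun b _ => c₁ u b
    have h2 := Finset.card_biUnion_le_card_mul (Finset.range ((B u).card + 1)) (T₂ u) _
      fun b _ => c₂ u hu b
    rw [Finset.card_range] at h2
    have h3 := Finset.card_union_le ((B u).biUnion (T₁ u))
      ((Finset.range ((B u).card + 1)).biUnion (T₂ u))
    nlinarith
  refine (Finset.sum_le_sum this).trans ?_
  rw [Finset.sum_add_distrib, ← Finset.mul_sum, Finset.sum_const, smul_eq_mul]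
  have := Nat.mul_le_mul_left (68 * (l + 8)) hsum
  nlinarith

-- Double counting with the enlarged sample `X = insert q R`, from which `R` is recovered by erasing
-- `q`.
open Classical in
theorem sum_card_passesUnder_le (F : ChargedFamily x r S E l) (hx : IsAdmissibleMotion x) :
    ∑ R ∈ Finset.powersetCard m Finset.univ, (S.filter fun i => r ∈ R ∧ (E i).q ∉ R ∧
      ∃ u ∈ R, u ∈ (E i).L ∧ (E i).PassesUnder R u).card
      ≤ ((Finset.powersetCard (m + 1) Finset.univ).filter fun X => r ∈ X).card *
        ((m + 1) * (2 * (l + 8))) := by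
  set T : Finset (Fin n) → Finset ι := fun X => S.filter fun i => (E i).q ∈ X ∧
    ∃ u ∈ X, u ∈ (E i).L ∧ (E i).PassesUnder (X.erase (E i).q) u
  have hT : ∀ X, (T X).card ≤ X.card * (2 * (l + 8)) := by
    intro X
    have hsub : T X ⊆ X.biUnion fun u => S.filter fun i => (E i).q ∈ X ∧ u ∈ (E i).L ∧
        (E i).PassesUnder (X.erase (E i).q) u := by
      intro i hi
      obtain ⟨hi, hq, u, hu, h⟩ := Finset.mem_filter.mp hi
      exact Finset.mem_biUnion.mpr ⟨u, hu, Finset.mem_filter.mpr ⟨hi, hq, h⟩⟩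
    refine (Finset.card_le_card hsub).trans (Finset.card_biUnion_le_card_mul _ _ _ fun u _ => ?_)
    exact F.card_passesUnder_le hx (Finset.filter_subset _ _) (X := X) (u := u)
      (fun i hi => (Finset.mem_filter.mp hi).2.2.1) (fun i hi => (Finset.mem_filter.mp hi).2.1)
      (fun i hi => (Finset.mem_filter.mp hi).2.2.2)
  rw [← Finset.card_sigma]
  refine le_trans (Finset.card_le_card_of_injOn (t := ((Finset.powersetCard (m + 1)
    Finset.univ).filter fun X => r ∈ X).sigma T) (fun e => ⟨insert (E e.2).q e.1, e.2⟩) ?_ ?_) ?_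
  · rintro ⟨R, i⟩ h
    simp only [Finset.coe_sigma, Set.mem_sigma_iff, Finset.mem_coe, Finset.mem_powersetCard,
      Finset.mem_filter] at h
    obtain ⟨⟨-, hm⟩, hi, hr, hq, u, hu, huL, hP⟩ := h
    simp only [Finset.coe_sigma, Set.mem_sigma_iff, Finset.mem_coe, Finset.mem_powersetCard,
      Finset.mem_filter, T]
    refine ⟨⟨⟨Finset.subset_univ _, ?_⟩, by simp [hr]⟩, hi, by simp, u, by simp [hu], huL, ?_⟩
    · rw [Finset.card_insert_of_notMem hq, hm]
    · rw [Finset.erase_insert hq]; exact hP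
  · rintro ⟨R, i⟩ h ⟨R', i'⟩ h' heq
    simp only [Finset.coe_sigma, Set.mem_sigma_iff, Finset.mem_coe, Finset.mem_filter] at h h'
    simp only [Sigma.mk.injEq, heq_eq_eq] at heq
    obtain ⟨h1, rfl⟩ := heq
    have := congrArg (fun X => X.erase (E i).q) h1
    simp only [Finset.erase_insert h.2.2.2.1, Finset.erase_insert h'.2.2.2.1] at this
    rw [this]
  · rw [Finset.card_sigma, ← smul_eq_mul, ← Finset.sum_const]
    refine Finset.sum_le_sum fun X hX => ?_
    have := (Finset.mem_powersetCard.mp (Finset.mem_filter.mp hX).1).2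
    rw [← this]
    exact hT X

-- In each pair counted on the left, each of the `m - 4` admissible `d` yields a change in the
-- sample with `p` in place of `d`. The map `(R, i, d) ↦ (insert p (R.erase d), i, d)` is injective.
-- A change is used by at most 14 events and `n` values of `d`.
open Classical in
theorem sum_card_rimChange_le (F : ChargedFamily x r S E l) (hx : IsAdmissibleMotion x)
    (hl : 14 < l) :
    (m - 4) * ∑ R ∈ Finset.powersetCard m Finset.univ, (S.filter fun i => r ∈ R ∧ (E i).p ∉ R ∧
      (R ∩ (E i).L).card = 3 ∧ ∀ d ∈ R \ insert r (E i).L, (E i).RimChange R d).card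
      ≤ 14 * n * ∑ Q ∈ Finset.powersetCard m Finset.univ, (vertexRecords hx Q r).card := by
  set T : Finset (Fin n) → Finset ι := fun Q => S.filter fun i =>
    ∃ b ∈ Icc (E i).α₀ (E i).α₁, ∃ w, (r, w, (E i).p, b) ∈ triRecords x Q
  have hT : ∀ Q, (T Q).card ≤ (vertexRecords hx Q r).card * 14 := by
    intro Q
    have hsub : T Q ⊆ (vertexRecords hx Q r).biUnion fun e => S.filter fun i =>
        (E i).p = e.2.2.1 ∧ e.2.2.2 ∈ Icc (E i).α₀ (E i).α₁ := by
      intro i hi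
      obtain ⟨hi, b, hb, w, h⟩ := Finset.mem_filter.mp hi
      exact Finset.mem_biUnion.mpr ⟨_, (mem_vertexRecords hx).mpr ⟨h, rfl⟩,
        Finset.mem_filter.mpr ⟨hi, rfl, hb⟩⟩
    refine (Finset.card_le_card hsub).trans (Finset.card_biUnion_le_card_mul _ _ _ fun u _ => ?_)
    exact F.card_rim_le hx hl (Finset.filter_subset _ _)
      (fun i hi => (Finset.mem_filter.mp hi).2.1) (fun i hi => (Finset.mem_filter.mp hi).2.2)
  set G : Finset (Fin n) → Finset ι := fun R => S.filter fun i => r ∈ R ∧ (E i).p ∉ R ∧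
    (R ∩ (E i).L).card = 3 ∧ ∀ d ∈ R \ insert r (E i).L, (E i).RimChange R d
  have h1 : (m - 4) * ∑ R ∈ Finset.powersetCard m Finset.univ, (G R).card
      = ((Finset.powersetCard m Finset.univ).sigma fun R => (G R).sigma fun i =>
        R \ insert r (E i).L).card := by
    rw [Finset.card_sigma, Finset.mul_sum]
    refine Finset.sum_congr rfl fun R hR => ?_
    rw [Finset.card_sigma, Finset.sum_const_nat (m := m - 4), mul_comm]
    intro i hi
    obtain ⟨hi, hr, -, h3, -⟩ := Finset.mem_filter.mp hi
    have hrL : r ∉ (E i).L := fun h => ((E i).crosser' r h).zr rfl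
    rw [Finset.card_sdiff, Finset.inter_comm, Finset.inter_insert_of_mem hr,
      Finset.card_insert_of_notMem (by simp [hrL]), h3, (Finset.mem_powersetCard.mp hR).2]
  have h2 : 14 * n * ∑ Q ∈ Finset.powersetCard m Finset.univ, (vertexRecords hx Q r).card
      ≥ ((Finset.powersetCard m Finset.univ).sigma fun Q => (T Q).sigma fun _ =>
        (Finset.univ : Finset (Fin n))).card := by
    rw [Finset.card_sigma, Finset.mul_sum]
    refine Finset.sum_le_sum fun Q _ => ?_
    rw [Finset.card_sigma, Finset.sum_const, smul_eq_mul, Finset.card_univ, Fintype.card_fin]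
    have := hT Q
    nlinarith
  rw [h1]
  refine le_trans (Finset.card_le_card_of_injOn
    (fun e => ⟨insert (E e.2.1).p (e.1.erase e.2.2), e.2.1, e.2.2⟩) ?_ ?_) h2
  · rintro ⟨R, i, d⟩ h
    simp only [Finset.coe_sigma, Set.mem_sigma_iff, Finset.mem_coe, Finset.mem_powersetCard, G,
      Finset.mem_filter] at h
    obtain ⟨⟨-, hm⟩, ⟨hi, hr, hp, h3, hd'⟩, hd⟩ := h
    simp only [Finset.coe_sigma, Set.mem_sigma_iff, Finset.mem_coe, Finset.mem_powersetCard,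
      Finset.mem_filter, T, Finset.mem_univ, and_true]
    refine ⟨⟨Finset.subset_univ _, ?_⟩, hi, hd' d hd⟩
    have hdR := (Finset.mem_sdiff.mp hd).1
    rw [Finset.card_insert_of_notMem (fun h => hp (Finset.mem_of_mem_erase h)),
      Finset.card_erase_of_mem hdR, hm]
    have := Finset.card_pos.mpr ⟨d, hdR⟩
    omega
  · rintro ⟨R, i, d⟩ h ⟨R', i', d'⟩ h' heq
    simp only [Finset.coe_sigma, Set.mem_sigma_iff, Finset.mem_coe, Finset.mem_filter, G] at h h'
    simp only [Sigma.mk.injEq, heq_eq_eq] at heq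
    obtain ⟨h1, rfl, h2⟩ := heq
    subst h2
    have := congrArg (fun X => insert d (X.erase (E i).p)) h1
    simp only [Finset.erase_insert (fun h0 => h.2.1.2.2.1 (Finset.mem_of_mem_erase h0)),
      Finset.erase_insert (fun h0 => h'.2.1.2.2.1 (Finset.mem_of_mem_erase h0)),
      Finset.insert_erase (Finset.mem_sdiff.mp h.2.2).1,
      Finset.insert_erase (Finset.mem_sdiff.mp h'.2.2).1] at this
    rw [this]

end ChargedFamily

/-! ### Samples that fit an event. -/

namespace ChargedEvent
variable {n : ℕ} {x : Fin n → ℝ → Plane} {r : Fin n} {m : ℕ} {R : Finset (Fin n)}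

/-- The set `R` contains `r`, three of the crossers, and none of the other points of the event. -/
def Fits (E : ChargedEvent x r) (R : Finset (Fin n)) : Prop :=
  r ∈ R ∧ E.p ∉ R ∧ E.q ∉ R ∧ Disjoint R E.A ∧ (R ∩ E.L).card = 3

/-- The three sampled crossers are sorted by hitting time and the middle one serves as `u`. A rim
change for all `d` is kept as a separate alternative, to be averaged over `d`. -/
theorem exists_type (E : ChargedEvent x r) (hx : IsAdmissibleMotion x) (hE : E.Clear)
    (hR : E.Fits R) :
    (∀ d ∈ R \ insert r E.L, E.RimChange R d) ∨ ∃ u ∈ R, u ∈ E.L ∧ (∃ y ∈ E.L, E.t y < E.t u) ∧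
      (E.SpokeChange R u ∨ E.PassesUnder R u ∨ E.Settles R u) := by
  classical
  obtain ⟨hr, hp, hq, hA, h3⟩ := hR
  by_cases hd : ∀ d ∈ R \ insert r E.L, E.RimChange R d
  · exact Or.inl hd
  right
  push Not at hd
  obtain ⟨d, hd, hrim⟩ := hd
  have pop : ∀ J ⊆ R ∩ E.L, J.Nonempty → ∃ i ∈ J, ∀ j ∈ J.erase i, E.t i < E.t j := by
    intro J hJ hJ'
    obtain ⟨i, hi, hmin⟩ := Finset.exists_min_image J E.t hJ'
    refine ⟨i, hi, fun j hj => lt_of_le_of_ne (hmin j (Finset.mem_of_mem_erase hj)) ?_⟩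
    exact (E.crosser' i (Finset.mem_inter.mp (hJ hi)).2).hit_ne hx
      (E.crosser' j (Finset.mem_inter.mp (hJ (Finset.mem_of_mem_erase hj))).2)
      (Finset.ne_of_mem_erase hj).symm
  obtain ⟨z, hz, mz⟩ := pop _ (Finset.Subset.refl _) (Finset.card_pos.mp (by omega))
  have c₁ := Finset.card_erase_of_mem hz
  obtain ⟨u, hu, mu⟩ := pop ((R ∩ E.L).erase z) (Finset.erase_subset _ _)
    (Finset.card_pos.mp (by omega))
  have c₂ := Finset.card_erase_of_mem hu
  obtain ⟨y, hy⟩ := Finset.card_pos.mp (show 0 < (((R ∩ E.L).erase z).erase u).card by omega)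
  have hzu := mz u hu
  have huy := mu y hy
  have hu := Finset.mem_inter.mp (Finset.mem_of_mem_erase hu)
  have hy := Finset.mem_inter.mp (Finset.mem_of_mem_erase (Finset.mem_of_mem_erase hy))
  have hz := Finset.mem_inter.mp hz
  rw [Finset.mem_sdiff, Finset.mem_insert, not_or] at hd
  have hne : ∀ w ∈ E.L, d ≠ w := fun w hw h => hd.2.2 (h ▸ hw)
  exact ⟨u, hu.1, hu.2, ⟨z, hz.2, hzu⟩, (E.classify hx hE hz.2 hu.2 hy.2 hzu huy hr hz.1 hu.1 hy.1
    hq hA hd.2.1 (hne z hz.2) (hne u hu.2) (hne y hy.2)).resolve_left hrim⟩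

-- A fitting sample consists of `r`, three crossers, and `m - 4` points outside the at most `l + 10`
-- special ones: `L`, `A`, `r`, `p`, `q`.
open Classical in
theorem card_fits_ge (E : ChargedEvent x r) (hA : E.A.card ≤ 7) (hrA : r ∉ E.A) (hm : 4 ≤ m) :
    E.L.card.choose 3 * (n - (E.L.card + 10)).choose (m - 4)
      ≤ ((Finset.powersetCard m Finset.univ).filter fun R => E.Fits R).card := by
  set Z : Finset (Fin n) := E.L ∪ (E.A ∪ {r, E.p, E.q}) with hZ
  have hZc : Z.card ≤ E.L.card + 10 := by
    have h1 := Finset.card_union_le E.L (E.A ∪ {r, E.p, E.q})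
    have h2 := Finset.card_union_le E.A {r, E.p, E.q}
    have h3 := Finset.card_le_three (a := r) (b := E.p) (c := E.q)
    rw [hZ]
    omega
  have hrL : r ∉ E.L := fun h => (E.crosser' r h).zr rfl
  have hpr := E.crosser.zr
  have hqr := E.crosser.qr
  have hpL : E.p ∉ E.L := fun h => E.p_ne _ h rfl
  have hqL : E.q ∉ E.L := fun h => (E.crosser' _ h).zq rfl
  have h1 : E.L.card.choose 3 * (n - (E.L.card + 10)).choose (m - 4)
      ≤ (Finset.powersetCard 3 E.L ×ˢ Finset.powersetCard (m - 4) (Finset.univ \ Z)).card := by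
    rw [Finset.card_product, Finset.card_powersetCard, Finset.card_powersetCard]
    refine Nat.mul_le_mul_left _ (Nat.choose_le_choose _ ?_)
    rw [Finset.card_sdiff, Finset.inter_univ, Finset.card_univ, Fintype.card_fin]
    omega
  refine h1.trans (Finset.card_le_card_of_injOn (fun e => insert r (e.1 ∪ e.2)) ?_ ?_)
  · rintro ⟨T, W⟩ h
    simp only [Finset.coe_product, Set.mem_prod, Finset.mem_coe, Finset.mem_powersetCard] at h
    obtain ⟨⟨hT, hT3⟩, hW, hWc⟩ := h
    have hWn : ∀ w ∈ W, w ∉ E.L ∧ w ∉ E.A ∧ w ≠ r ∧ w ≠ E.p ∧ w ≠ E.q := by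
      intro w hw
      have := hW hw
      simp only [hZ, Finset.mem_sdiff, Finset.mem_univ, Finset.mem_union, Finset.mem_insert,
        Finset.mem_singleton, true_and] at this
      tauto
    have hdis : Disjoint T W := Finset.disjoint_left.mpr fun w hw hw' => (hWn w hw').1 (hT hw)
    have hrn : r ∉ T ∪ W := by
      rw [Finset.mem_union]
      rintro (h | h)
      · exact hrL (hT h)
      · exact (hWn r h).2.2.1 rfl
    simp only [Finset.coe_filter, Finset.mem_powersetCard, Set.mem_ofPred_eq]
    refine ⟨⟨Finset.subset_univ _, ?_⟩, by simp, ?_, ?_, ?_, ?_⟩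
    · rw [Finset.card_insert_of_notMem hrn, Finset.card_union_of_disjoint hdis, hT3, hWc]
      omega
    · simp only [Finset.mem_insert, Finset.mem_union, not_or]
      exact ⟨hpr, fun h => hpL (hT h), fun h => (hWn _ h).2.2.2.1 rfl⟩
    · simp only [Finset.mem_insert, Finset.mem_union, not_or]
      exact ⟨hqr, fun h => hqL (hT h), fun h => (hWn _ h).2.2.2.2 rfl⟩
    · rw [Finset.disjoint_left]
      intro w hw
      rcases Finset.mem_insert.mp hw with rfl | hw
      · exact hrA
      rcases Finset.mem_union.mp hw with hw | hw
      · exact E.not_mem w (hT hw)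
      · exact (hWn w hw).2.1
    · have : insert r (T ∪ W) ∩ E.L = T := by
        ext w
        simp only [Finset.mem_inter, Finset.mem_insert, Finset.mem_union]
        constructor
        · rintro ⟨rfl | h | h, h'⟩
          · exact absurd h' hrL
          · exact h
          · exact absurd h' (hWn w h).1
        · exact fun h => ⟨Or.inr (Or.inl h), hT h⟩
      rw [this, hT3]
  · rintro ⟨T, W⟩ h ⟨T', W'⟩ h' heq
    simp only [Finset.coe_product, Set.mem_prod, Finset.mem_coe, Finset.mem_powersetCard] at h h'
    have key : ∀ T W : Finset (Fin n), T ⊆ E.L → W ⊆ Finset.univ \ Z →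
        insert r (T ∪ W) ∩ E.L = T ∧ insert r (T ∪ W) \ Z = W := by
      intro T W hT hW
      have hWn : ∀ w ∈ W, w ∉ E.L ∧ w ∉ Z := by
        intro w hw
        have := hW hw
        simp only [Finset.mem_sdiff, Finset.mem_univ, true_and] at this
        exact ⟨fun h => this (Finset.mem_union_left _ h), this⟩
      have hTZ : ∀ w ∈ T, w ∈ Z := fun w hw => Finset.mem_union_left _ (hT hw)
      have hrZ : r ∈ Z := by simp [hZ]
      constructor
      · ext w
        simp only [Finset.mem_inter, Finset.mem_insert, Finset.mem_union]
        constructor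
        · rintro ⟨rfl | h | h, h'⟩
          · exact absurd h' hrL
          · exact h
          · exact absurd h' (hWn w h).1
        · exact fun h => ⟨Or.inr (Or.inl h), hT h⟩
      · ext w
        simp only [Finset.mem_sdiff, Finset.mem_insert, Finset.mem_union]
        constructor
        · rintro ⟨rfl | h | h, h'⟩
          · exact absurd hrZ h'
          · exact absurd (hTZ w h) h'
          · exact h
        · exact fun h => ⟨Or.inr (Or.inr h), (hWn w h).2⟩
    have k₁ := key T W h.1.1 h.2.1
    have k₂ := key T' W' h'.1.1 h'.2.1
    have heq : insert r (T ∪ W) = insert r (T' ∪ W') := heq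
    rw [heq] at k₁
    rw [Prod.mk.injEq]
    exact ⟨k₁.1.symm.trans k₂.1, k₁.2.symm.trans k₂.2⟩

end ChargedEvent

namespace ChargedFamily
open ChargedEvent
variable {n : ℕ} {x : Fin n → ℝ → Plane} {r : Fin n} {ι : Type*}
  {S T : Finset ι} {E : ι → ChargedEvent x r} {l k m : ℕ}

open Classical in
/-- The count of the charged events with a fixed crossing point `r`. -/
theorem card_mul_le (F : ChargedFamily x r S E l) (hx : IsAdmissibleMotion x) (hl : 14 < l)
    (hm : 4 ≤ m) (hclear : ∀ i ∈ S, (E i).Clear) :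
    (m - 4) * (S.card * (l.choose 3 * (n - (l + 10)).choose (m - 4)))
      ≤ (m - 4) * (∑ R ∈ Finset.powersetCard m Finset.univ, (l + 8) *
          (136 * (vertexRecords hx R r).card + 17 * if r ∈ R then m else 0) +
          (m + 1) * (2 * (l + 8)) *
            ((Finset.powersetCard (m + 1) Finset.univ).filter fun X => r ∈ X).card) +
        14 * n * ∑ Q ∈ Finset.powersetCard m Finset.univ, (vertexRecords hx Q r).card := by
  have h0 : S.card * (l.choose 3 * (n - (l + 10)).choose (m - 4)) ≤
      ∑ R ∈ Finset.powersetCard m Finset.univ, (S.filter fun i => (E i).Fits R).card := by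
    rw [← smul_eq_mul, ← Finset.sum_const]
    have := Finset.sum_card_bipartiteAbove_eq_sum_card_bipartiteBelow (s := S)
      (t := Finset.powersetCard m (Finset.univ : Finset (Fin n))) fun i R => (E i).Fits R
    simp only [Finset.bipartiteAbove, Finset.bipartiteBelow] at this
    rw [← this]
    refine Finset.sum_le_sum fun i hi => ?_
    have h1 := (E i).alive _ ⟨le_rfl, (E i).le_t₀.trans
      ((E i).single.1.lt.le.trans (E i).t₁_le)⟩
    have h2 := h1.2.1
    simp only [Finset.mem_sdiff, Finset.mem_univ, true_and] at h2
    have h3 := (E i).card_fits_ge (F.card_A i hi) h2 hm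
    rwa [F.card_L i hi] at h3
  have h1 : ∑ R ∈ Finset.powersetCard m Finset.univ, (S.filter fun i => (E i).Fits R).card ≤
      ∑ R ∈ Finset.powersetCard m Finset.univ, (l + 8) *
          (136 * (vertexRecords hx R r).card + 17 * if r ∈ R then m else 0) +
      ∑ R ∈ Finset.powersetCard m Finset.univ, (S.filter fun i => r ∈ R ∧ (E i).q ∉ R ∧
        ∃ u ∈ R, u ∈ (E i).L ∧ (E i).PassesUnder R u).card +
      ∑ R ∈ Finset.powersetCard m Finset.univ, (S.filter fun i => r ∈ R ∧ (E i).p ∉ R ∧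
        (R ∩ (E i).L).card = 3 ∧ ∀ d ∈ R \ insert r (E i).L, (E i).RimChange R d).card := by
    rw [← Finset.sum_add_distrib, ← Finset.sum_add_distrib]
    refine Finset.sum_le_sum fun R hR => ?_
    by_cases hr : r ∈ R
    swap
    · rw [Finset.filter_false_of_mem fun i _ h => hr h.1]
      simp
    have h2 := F.card_spoke_settles_le hx hr
    rw [(Finset.mem_powersetCard.mp hR).2] at h2
    rw [if_pos hr]
    refine le_trans ?_ (add_le_add_left (add_le_add_left h2 _) _)
    refine le_trans (Finset.card_le_card ?_) ((Finset.card_union_le _ _).trans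
      (add_le_add_left (Finset.card_union_le _ _) _))
    intro i hi
    obtain ⟨hi, hf⟩ := Finset.mem_filter.mp hi
    simp only [Finset.mem_union, Finset.mem_filter]
    rcases (E i).exists_type hx (hclear i hi) hf with h | ⟨u, hu, huL, hy, h | h | h⟩
    · exact Or.inr ⟨hi, hr, hf.2.1, hf.2.2.2.2, h⟩
    · exact Or.inl (Or.inl ⟨hi, u, hu, huL, hy, Or.inl h⟩)
    · exact Or.inl (Or.inr ⟨hi, hr, hf.2.2.1, u, hu, huL, h⟩)
    · exact Or.inl (Or.inl ⟨hi, u, hu, huL, hy, Or.inr h⟩)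
  have h2 := F.sum_card_passesUnder_le hx (m := m)
  have h3 := F.sum_card_rimChange_le hx hl (m := m)
  have h4 := Nat.mul_le_mul_left (m - 4) (h0.trans h1)
  have h5 := Nat.mul_le_mul_left (m - 4) h2
  rw [mul_add, mul_add] at h4
  rw [mul_add]
  refine h4.trans (add_le_add (add_le_add_right (h5.trans (le_of_eq (by ring))) _) h3)

end ChargedFamily

/-! ### From crossings to charged events. -/

section hits
variable {n : ℕ} {x : Fin n → ℝ → Plane} {p q r u z : Fin n} {a b t a' b' t' : ℝ} {l : ℕ}

/-- The point `r` hits `uq` at time `t`, and the crossing interval `[a, b]` can be enlarged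
slightly. -/
def CrossingHit (x : Fin n → ℝ → Plane) (r q u : Fin n) (a b t : ℝ) : Prop :=
  t ∈ Icc a b ∧ ∀ lo < a, ∀ hi > b, ∃ s ∈ Ioo lo a, ∃ e ∈ Ioo b hi, Crosser x r q u s t e

theorem IsSingleCrossing.exists_hit (hx : IsAdmissibleMotion x) (h : IsSingleCrossing x u q r a b) :
    ∃ t, CrossingHit x r q u a b t := by
  obtain ⟨t, ht, s, hs, e, he, c⟩ := h.exists_crosser hx (sub_one_lt a) (lt_add_one b)
  refine ⟨t, ht, fun lo hlo hi hhi => ?_⟩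
  obtain ⟨t', ht', s', hs', e', he', c'⟩ := h.exists_crosser hx hlo hhi
  have : t' = t := by
    have h0 := c'.zero
    rcases lt_trichotomy t' t with h1 | h1 | h1
    · have := c.pos t' ⟨hs.2.le.trans ht'.1, h1⟩
      linarith
    · exact h1
    · have := c.neg t' ⟨h1, ht'.2.trans he.1.le⟩
      linarith
  subst this
  exact ⟨s', hs', e', he', c'⟩

/-- The second interval is enlarged so little that it still starts after the enlarged first one. The
opposite order of hits would then contradict `Crosser.start_lt`. -/
theorem CrossingHit.lt_of_start_le (hx : IsAdmissibleMotion x) (h : CrossingHit x r q u a b t)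
    (h' : CrossingHit x r q z a' b' t') (huz : u ≠ z) (ha : a ≤ a') : t < t' := by
  obtain ⟨s, hs, e, he, c⟩ := h.2 (a - 1) (sub_one_lt a) (b + 1) (lt_add_one b)
  obtain ⟨s', hs', e', he', c'⟩ := h'.2 s (hs.2.trans_le ha) (b' + 1) (lt_add_one b')
  by_contra hn
  have := c'.start_lt hx c huz.symm (lt_of_le_of_ne (not_lt.mp hn) (c'.hit_ne hx c huz.symm))
  linarith [hs'.1]

theorem CrossingHit.start_ne (hx : IsAdmissibleMotion x) (h : CrossingHit x r q u a b t)
    (h' : CrossingHit x r q z a' b' t') (huz : u ≠ z) : a ≠ a' := by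
  intro ha
  have h1 := h.lt_of_start_le hx h' huz ha.le
  have h2 := h'.lt_of_start_le hx h huz.symm ha.ge
  linarith

theorem CrossingHit.end_lt (hx : IsAdmissibleMotion x) (h : CrossingHit x r q u a b t)
    (h' : CrossingHit x r q z a' b' t') (huz : u ≠ z) (ht : t < t') : b < b' := by
  by_contra hn
  obtain ⟨s, hs, e, he, c⟩ := h.2 (a - 1) (sub_one_lt a) (b + 1) (lt_add_one b)
  obtain ⟨s', hs', e', he', c'⟩ := h'.2 (a' - 1) (sub_one_lt a') e
    (show b' < e by linarith [he.1])
  have := c.end_lt hx c' huz ht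
  linarith [he'.2]

theorem CrossingHit.end_ne (hx : IsAdmissibleMotion x) (h : CrossingHit x r q u a b t)
    (h' : CrossingHit x r q z a' b' t') (huz : u ≠ z) : b ≠ b' := by
  rcases le_total a a' with ha | ha
  · exact (h.end_lt hx h' huz (h.lt_of_start_le hx h' huz ha)).ne
  · exact (h'.end_lt hx h huz.symm (h'.lt_of_start_le hx h huz.symm ha)).ne'

/-- A finite set contains a subset of given size that consists of the largest elements. -/
theorem exists_top_subset {ι : Type*} (C : Finset ι) (f : ι → ℝ) :
    ∀ l ≤ C.card, ∃ L ⊆ C, L.card = l ∧ ∀ u ∈ L, ∀ z ∈ C, f u < f z → z ∈ L := by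
  classical
  intro l
  induction l with
  | zero => exact fun _ => ⟨∅, by simp, by simp, by simp⟩
  | succ l ih =>
    intro hl
    obtain ⟨L, hL, hc, h⟩ := ih (by omega)
    have hne : (C \ L).Nonempty := by
      rw [← Finset.card_pos, Finset.card_sdiff_of_subset hL]; omega
    obtain ⟨m, hm, hmax⟩ := Finset.exists_max_image (C \ L) f hne
    rw [Finset.mem_sdiff] at hm
    refine ⟨insert m L, Finset.insert_subset hm.1 hL, ?_, ?_⟩
    · rw [Finset.card_insert_of_notMem hm.2, hc]
    · intro u hu z hz huz
      rw [Finset.mem_insert]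
      rcases Finset.mem_insert.mp hu with rfl | hu
      · by_contra hn
        rw [not_or] at hn
        have := hmax z (Finset.mem_sdiff.mpr ⟨hz, hn.2⟩)
        linarith
      · exact Or.inr (h u hu z hz huz)

/-- A single crossing with an almost Delaunay interval that contains at least `l` earlier
crossers of the same pair. -/
def IsLongEvent (x : Fin n → ℝ → Plane) (l : ℕ) (p q r : Fin n) : Prop :=
  ∃ t₀ t₁ α₀ α₁ : ℝ, ∃ A : Finset (Fin n), IsSingleCrossing x p q r t₀ t₁ ∧ α₀ ≤ t₀ ∧ t₁ ≤ α₁ ∧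
    A.card ≤ 7 ∧ (∀ τ ∈ Icc α₀ α₁, DelaunayAt x (Finset.univ \ A) p r τ) ∧
    DelaunayAt x Finset.univ p r α₀ ∧
    l ≤ {u | u ≠ p ∧ u ∉ A ∧ ∃ s₀ s₁ : ℝ, IsSingleCrossing x u q r s₀ s₁ ∧ α₀ < s₀ ∧ s₁ < α₁ ∧
      s₀ < t₀}.ncard

/-- For `L` the `l` crossers with the latest starts are taken. Starts, hits and ends have the same
order. So a crosser that starts between one of them and `t₀` ends before `α₁`, and unless it is `p`
or in `A`, it is in `L`. -/
theorem IsLongEvent.exists_chargedEvent (hx : IsAdmissibleMotion x) (h : IsLongEvent x l p q r) :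
    ∃ E : ChargedEvent x r, E.q = q ∧ E.p = p ∧ E.A.card ≤ 7 ∧ E.L.card = l ∧
      (∀ u ∈ E.L, E.a u < E.t₀) ∧
      ∀ u ∈ E.L, ∀ z s₀ s₁, IsSingleCrossing x z E.q r s₀ s₁ → E.a u < s₀ → s₀ ≤ E.t₀ →
        z = E.p ∨ z ∈ E.L ∨ z ∈ E.A := by
  classical
  obtain ⟨t₀, t₁, α₀, α₁, A, hs, h0, h1, hA, hal, hal₀, hl⟩ := h
  set C : Finset (Fin n) := Finset.univ.filter fun u => u ≠ p ∧ u ∉ A ∧ ∃ s₀ s₁ : ℝ,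
    IsSingleCrossing x u q r s₀ s₁ ∧ α₀ < s₀ ∧ s₁ < α₁ ∧ s₀ < t₀ with hC
  have hlC : l ≤ C.card := by
    rw [← Set.ncard_coe_finset]
    convert hl using 2
    ext u; simp [hC]
  have hCm : ∀ u ∈ C, u ≠ p ∧ u ∉ A ∧ ∃ s₀ s₁ : ℝ,
      IsSingleCrossing x u q r s₀ s₁ ∧ α₀ < s₀ ∧ s₁ < α₁ ∧ s₀ < t₀ := fun u hu =>
    (Finset.mem_filter.mp hu).2
  have hd : ∀ u, ∃ a b t s e : ℝ, u ∈ C → IsSingleCrossing x u q r a b ∧ α₀ < a ∧ b < α₁ ∧ a < t₀ ∧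
      CrossingHit x r q u a b t ∧ s ∈ Ioo α₀ a ∧ e ∈ Ioo b α₁ ∧ Crosser x r q u s t e := by
    intro u
    by_cases hu : u ∈ C
    · obtain ⟨-, -, a, b, h2, h3, h4, h5⟩ := hCm u hu
      obtain ⟨t, ht⟩ := h2.exists_hit hx
      obtain ⟨s, hs, e, he, c⟩ := ht.2 α₀ h3 α₁ h4
      exact ⟨a, b, t, s, e, fun _ => ⟨h2, h3, h4, h5, ht, hs, he, c⟩⟩
    · exact ⟨0, 0, 0, 0, 0, fun h => absurd h hu⟩
  choose a b t s e hd using hd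
  obtain ⟨L, hLC, hLc, hLt⟩ := exists_top_subset C a l hlC
  obtain ⟨tp, htp⟩ := hs.exists_hit hx
  obtain ⟨sp, hsp, ep, hep, cp⟩ := htp.2 (t₀ - 1) (sub_one_lt _) (t₁ + 1) (lt_add_one _)
  refine ⟨{ q := q, p := p, t₀ := t₀, t₁ := t₁, sp := sp, tp := tp, ep := ep, α₀ := α₀, α₁ := α₁
            A := A, L := L, a := a, b := b, s := s, t := t, e := e
            single := hs, crosser := cp, sp_lt := hsp.2, le_t₀ := h0, t₁_le := h1
            tp_le := htp.1.2.trans h1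
            alive := hal, alive₀ := hal₀
            p_ne := fun u hu => (hCm u (hLC hu)).1.symm
            not_mem := fun u hu => (hCm u (hLC hu)).2.1
            single' := fun u hu => (hd u (hLC hu)).1
            crosser' := fun u hu => (hd u (hLC hu)).2.2.2.2.2.2.2
            le_s := fun u hu => (hd u (hLC hu)).2.2.2.2.2.1.1.le
            s_lt := fun u hu => (hd u (hLC hu)).2.2.2.2.2.1.2
            lt_e := fun u hu => (hd u (hLC hu)).2.2.2.2.2.2.1.1
            e_le := fun u hu => (hd u (hLC hu)).2.2.2.2.2.2.1.2.le
            t_lt := fun u hu => (hd u (hLC hu)).2.2.2.2.1.lt_of_start_le hx htp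
              (hCm u (hLC hu)).1 (hd u (hLC hu)).2.2.2.1.le }, rfl, rfl, hA, hLc,
    fun u hu => (hd u (hLC hu)).2.2.2.1, ?_⟩
  intro u hu z s₀ s₁ hz hus hst
  by_cases hzp : z = p
  · exact Or.inl hzp
  by_cases hzA : z ∈ A
  · exact Or.inr (Or.inr hzA)
  refine Or.inr (Or.inl ?_)
  obtain ⟨tz, htz⟩ := hz.exists_hit hx
  have hzC : z ∈ C := Finset.mem_filter.mpr ⟨Finset.mem_univ _, hzp, hzA, s₀, s₁, hz,
    (hd u (hLC hu)).2.1.trans hus,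
    (htz.end_lt hx htp hzp (htz.lt_of_start_le hx htp hzp hst)).trans_le h1,
    lt_of_le_of_ne hst (htz.start_ne hx htp hzp)⟩
  refine hLt u hu z hzC ?_
  rw [(hd z hzC).1.unique hx hz |>.1]
  exact hus

end hits

namespace ChargedFamily
variable {n : ℕ} {x : Fin n → ℝ → Plane} {r : Fin n} {ι : Type*}
  {S T : Finset ι} {E : ι → ChargedEvent x r} {l k m : ℕ}

theorem mono (F : ChargedFamily x r S E l) (hT : T ⊆ S) : ChargedFamily x r T E l where
  inj i hi j hj := F.inj i (hT hi) j (hT hj)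
  card_A i hi := F.card_A i (hT hi)
  card_L i hi := F.card_L i (hT hi)
  start_lt i hi := F.start_lt i (hT hi)
  closest i hi := F.closest i (hT hi)

end ChargedFamily

/-! ### Summation over `r`. -/

section counting
open ChargedFamily
variable {n : ℕ} {x : Fin n → ℝ → Plane} {l k m : ℕ}

-- The events that are not clear number at most 17 for each `p`, and `c` counts the others.
open Classical in
theorem card_longEvents_at_le (hx : IsAdmissibleMotion x) (hl : 14 < l) (hm : 4 ≤ m) (r : Fin n) :
    ∃ c : ℕ, (Finset.univ.filter fun e : Fin n × Fin n => IsLongEvent x l e.1 e.2 r).card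
        ≤ 17 * n + c ∧
      (m - 4) * (c * (l.choose 3 * (n - (l + 10)).choose (m - 4)))
      ≤ (m - 4) * (∑ R ∈ Finset.powersetCard m Finset.univ, (l + 8) *
          (136 * (vertexRecords hx R r).card + 17 * if r ∈ R then m else 0) +
          (m + 1) * (2 * (l + 8)) *
            ((Finset.powersetCard (m + 1) Finset.univ).filter fun X => r ∈ X).card) +
        14 * n * ∑ Q ∈ Finset.powersetCard m Finset.univ, (vertexRecords hx Q r).card := by
  have hE : ∀ i : {e : Fin n × Fin n // IsLongEvent x l e.1 e.2 r}, _ :=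
    fun i => i.2.exists_chargedEvent hx
  choose E hq hp hA hL hst hcl using hE
  have F : ChargedFamily x r Finset.univ E l := by
    refine ⟨fun i _ j _ h1 h2 => ?_, fun i _ => hA i, fun i _ => hL i, fun i _ => hst i,
      fun i _ => hcl i⟩
    rw [hq, hq] at h1
    rw [hp, hp] at h2
    exact Subtype.ext (Prod.ext h2 h1)
  refine ⟨(Finset.univ.filter fun i => (E i).Clear).card, ?_,
    (F.mono (Finset.subset_univ _)).card_mul_le hx hl hm fun i hi => (Finset.mem_filter.mp hi).2⟩
  have h1 : (Finset.univ.filter fun e : Fin n × Fin n => IsLongEvent x l e.1 e.2 r).card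
      = (Finset.univ : Finset {e : Fin n × Fin n // IsLongEvent x l e.1 e.2 r}).card := by
    rw [Finset.card_univ, Fintype.card_subtype]
  have h2 : (Finset.univ.filter fun i => ¬ (E i).Clear).card ≤ 17 * n := by
    have := Finset.card_le_mul_card_image (f := fun i => (E i).p)
      (Finset.univ.filter fun i => ¬ (E i).Clear) 17 (fun p _ =>
        F.card_not_clear_le hx (p := p) (Finset.subset_univ _)
          (fun i hi => (Finset.mem_filter.mp hi).2)
          (fun i hi => (Finset.mem_filter.mp (Finset.mem_filter.mp hi).1).2))
    refine this.trans (Nat.mul_le_mul_left _ ?_)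
    simpa using Finset.card_le_univ ((Finset.univ.filter fun i => ¬ (E i).Clear).image
      fun i => (E i).p)
  have h3 := Finset.card_filter_add_card_filter_not (s := Finset.univ) fun i => (E i).Clear
  omega

open Classical in
theorem card_longEvents_le (hx : IsAdmissibleMotion x) (hl : 14 < l) (hm : 4 ≤ m) {F : ℕ}
    (hF : F = 64 * maxDelaunayCocircularities m + 54 * m ^ 2) :
    ∃ c : ℕ, (Finset.univ.filter fun e : Fin n × Fin n × Fin n =>
        IsLongEvent x l e.1 e.2.1 e.2.2).card ≤ 17 * n ^ 2 + c ∧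
      (m - 4) * (c * (l.choose 3 * (n - (l + 10)).choose (m - 4)))
      ≤ (m - 4) * (n.choose m * ((l + 8) * (136 * F + 17 * m ^ 2) +
          (m + 1) * (2 * (l + 8)) * n)) + 14 * n * (n.choose m * F) := by
  choose c hc hc' using fun r => card_longEvents_at_le hx hl hm r
  refine ⟨∑ r, c r, ?_, ?_⟩
  · have h1 : (Finset.univ.filter fun e : Fin n × Fin n × Fin n =>
        IsLongEvent x l e.1 e.2.1 e.2.2).card = ∑ r : Fin n, (Finset.univ.filter
        fun e : Fin n × Fin n => IsLongEvent x l e.1 e.2 r).card := by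
      rw [Finset.card_eq_sum_card_fiberwise (f := fun e => e.2.2) (t := Finset.univ)
        fun e _ => by simp]
      refine Finset.sum_congr rfl fun r _ => ?_
      refine Finset.card_bij (fun e _ => (e.1, e.2.1)) ?_ ?_ ?_
      · rintro ⟨p, q, r'⟩ h
        simp only [Finset.mem_filter, Finset.mem_univ, true_and] at h ⊢
        obtain ⟨h, rfl⟩ := h
        exact h
      · rintro ⟨p, q, r'⟩ h ⟨p', q', r''⟩ h' heq
        simp only [Finset.mem_filter, Finset.mem_univ, true_and] at h h'
        obtain ⟨h, rfl⟩ := h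
        obtain ⟨h', rfl⟩ := h'
        simp only [Prod.mk.injEq] at heq
        rw [heq.1, heq.2]
      · rintro ⟨p, q⟩ h
        simp only [Finset.mem_filter, Finset.mem_univ, true_and] at h
        exact ⟨(p, q, r), by simpa using h, rfl⟩
    rw [h1]
    refine (Finset.sum_le_sum fun r _ => hc r).trans (le_of_eq ?_)
    rw [Finset.sum_add_distrib, Finset.sum_const, Finset.card_univ, Fintype.card_fin, smul_eq_mul]
    ring
  have hrec : ∑ r : Fin n, ∑ R ∈ Finset.powersetCard m Finset.univ, (vertexRecords hx R r).card
      ≤ n.choose m * F := by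
    rw [Finset.sum_comm]
    have h1 : ∀ R ∈ Finset.powersetCard m (Finset.univ : Finset (Fin n)),
        ∑ r : Fin n, (vertexRecords hx R r).card ≤ F := by
      intro R hR
      have h2 := (triRecords_ncard hx R).2
      rw [(Finset.mem_powersetCard.mp hR).2, ← hF,
        Set.ncard_eq_toFinset_card _ (triRecords_ncard hx R).1,
        Finset.card_eq_sum_card_fiberwise (f := fun e => e.1) (t := Finset.univ)
        fun e _ => by simp] at h2
      exact h2
    refine (Finset.sum_le_sum h1).trans ?_
    rw [Finset.sum_const, Finset.card_powersetCard, Finset.card_univ, Fintype.card_fin,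
      smul_eq_mul]
  have hite : ∑ r : Fin n, ∑ R ∈ Finset.powersetCard m (Finset.univ : Finset (Fin n)),
      (if r ∈ R then m else 0) = n.choose m * m ^ 2 := by
    rw [Finset.sum_comm]
    have h1 : ∀ R ∈ Finset.powersetCard m (Finset.univ : Finset (Fin n)),
        ∑ r : Fin n, (if r ∈ R then m else 0) = m ^ 2 := by
      intro R hR
      rw [← Finset.sum_filter, Finset.sum_const, Finset.filter_univ_mem,
        (Finset.mem_powersetCard.mp hR).2, smul_eq_mul, sq]
    rw [Finset.sum_congr rfl h1, Finset.sum_const, Finset.card_powersetCard, Finset.card_univ,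
      Fintype.card_fin, smul_eq_mul]
  have hX : ∑ r : Fin n, ((Finset.powersetCard (m + 1) Finset.univ).filter fun X => r ∈ X).card
      ≤ n.choose m * n := by
    have := Finset.sum_card_bipartiteAbove_eq_sum_card_bipartiteBelow (s := Finset.univ)
      (t := Finset.powersetCard (m + 1) (Finset.univ : Finset (Fin n))) fun r X => r ∈ X
    simp only [Finset.bipartiteAbove, Finset.bipartiteBelow, Finset.filter_univ_mem] at this
    -- The sum is `(m + 1) * n.choose (m + 1) = n.choose m * (n - m)`.
    rw [this, Finset.sum_const_nat fun X hX => (Finset.mem_powersetCard.mp hX).2,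
      Finset.card_powersetCard, Finset.card_univ, Fintype.card_fin, Nat.choose_succ_right_eq]
    exact Nat.mul_le_mul_left _ (Nat.sub_le _ _)
  have hsum := Finset.sum_le_sum fun r (_ : r ∈ Finset.univ) => hc' r
  simp only [Finset.sum_add_distrib, ← Finset.mul_sum, mul_add, ← Finset.sum_mul] at hsum
  rw [hite] at hsum
  refine hsum.trans ?_
  have k1 := Nat.mul_le_mul_left ((m - 4) * ((l + 8) * 136)) hrec
  have k2 := Nat.mul_le_mul_left ((m - 4) * ((m + 1) * (2 * (l + 8)))) hX
  have k3 := Nat.mul_le_mul_left (14 * n) hrec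
  generalize m - 4 = M at *
  linarith

end counting

/-! ### Binomial estimates and the bound for long events. -/

section estimates
variable {n l k m : ℕ}

/-- The bound on `k` gives `k ≤ 8 * (l - 2)`, and `3072 = 6 * 8 ^ 3`. -/
theorem pow_three_le_choose_three (hk : 22 ≤ k) (hl : l = k / 4) :
    k ^ 3 ≤ 3072 * l.choose 3 := by
  obtain ⟨a, rfl⟩ : ∃ a, l = a + 2 := ⟨l - 2, by omega⟩
  have h1 : k ≤ 8 * a := by omega
  have h2 : (a + 2).choose 3 * 6 = (a + 2) * (a + 1) * a := by
    have := Nat.descFactorial_eq_factorial_mul_choose (a + 2) 3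
    simp [Nat.descFactorial, Nat.factorial] at this
    linarith
  have h3 := Nat.pow_le_pow_left h1 3
  have h4 : a ^ 3 ≤ (a + 2) * (a + 1) * a := by nlinarith [Nat.zero_le a]
  nlinarith

/-- The quotient of the binomials is `(n - j) / (j + 1)`, where `n < k * (m + 1)` and `m + 1 ≤ 2 *
(j + 1)`. -/
theorem choose_succ_le (hm : 7 ≤ m) (hn : n < k * (m + 1)) {j : ℕ} (hj : m ≤ j + 4) :
    n.choose (j + 1) ≤ 2 * k * n.choose j := by
  have h1 := Nat.choose_succ_right_eq n j
  have h2 : n - j ≤ 2 * k * (j + 1) := by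
    have : k * (m + 1) ≤ k * (2 * (j + 1)) := Nat.mul_le_mul_left _ (by omega)
    have : k * (2 * (j + 1)) = 2 * k * (j + 1) := by ring
    omega
  have h3 := Nat.mul_le_mul_left (n.choose j) h2
  refine Nat.le_of_mul_le_mul_right (c := j + 1) ?_ (Nat.succ_pos j)
  rw [h1]
  refine h3.trans (le_of_eq (by ring))

theorem choose_le_pow_mul (hm : 7 ≤ m) (hn : n < k * (m + 1)) :
    n.choose m ≤ (2 * k) ^ 4 * n.choose (m - 4) := by
  obtain ⟨j, rfl⟩ : ∃ j, m = j + 4 := ⟨m - 4, by omega⟩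
  have h1 := choose_succ_le hm hn (j := j) (by omega)
  have h2 := choose_succ_le hm hn (j := j + 1) (by omega)
  have h3 := choose_succ_le hm hn (j := j + 2) (by omega)
  have h4 := choose_succ_le hm hn (j := j + 3) (by omega)
  calc n.choose (j + 4) ≤ 2 * k * (2 * k * (2 * k * (2 * k * n.choose j))) := by
        refine h4.trans (Nat.mul_le_mul_left _ (h3.trans (Nat.mul_le_mul_left _ (h2.trans
          (Nat.mul_le_mul_left _ h1)))))
    _ = _ := by simp only [Nat.add_sub_cancel]; ring

/-- Deleting one of at least `n / 2` points costs at most the fraction `2 / k` of the current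
binomial, hence of the original one, and the losses add up. -/
theorem choose_sub_ge (hm : m * k ≤ n) : ∀ z : ℕ, 2 * z ≤ n →
    ((k : ℝ) - 2 * z) * n.choose m ≤ k * (n - z).choose m := by
  intro z
  induction z with
  | zero => intro _; simp
  | succ z ih =>
    intro hz
    have h1 := ih (by omega)
    obtain ⟨N, hN⟩ : ∃ N, n - z = N + 1 := ⟨n - z - 1, by omega⟩
    have hN' : n - (z + 1) = N := by omega
    rw [hN] at h1
    rw [hN']
    have h2 : (N + 1).choose m ≤ n.choose m := Nat.choose_le_choose _ (by omega)
    have h2 : ((N + 1).choose m : ℝ) ≤ n.choose m := by exact_mod_cast h2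
    have h3 : N.choose m * (N + 1) + (N + 1).choose m * m = (N + 1).choose m * (N + 1) := by
      rcases le_or_gt m (N + 1) with h | h
      · have := Nat.choose_mul_succ_eq N m
        rw [this, ← mul_add]; congr 1; omega
      · rw [Nat.choose_eq_zero_of_lt h, Nat.choose_eq_zero_of_lt (by omega)]; simp
    have h3 : (N.choose m : ℝ) * (N + 1) + (N + 1).choose m * m
        = (N + 1).choose m * (N + 1) := by exact_mod_cast h3
    have h4 : m * k ≤ 2 * (N + 1) := by omega
    have h4 : (m : ℝ) * k ≤ 2 * (N + 1) := by exact_mod_cast h4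
    have h5 : (0 : ℝ) ≤ (N + 1).choose m := Nat.cast_nonneg _
    have h6 : (k : ℝ) * (N + 1).choose m - 2 * (N + 1).choose m ≤ k * N.choose m := by
      have hp : (0 : ℝ) < N + 1 := by positivity
      refine le_of_mul_le_mul_right ?_ hp
      have := mul_le_mul_of_nonneg_left h4 h5
      nlinarith
    push_cast
    linarith

/-- A random set of `n / k` points contains prescribed patterns with sufficient probability. -/
theorem choose_le_mul_pattern (hk : 80 ≤ k) (hl : l = k / 4) (hm : m = n / k) (hm' : 10 ≤ m) :
    (n.choose m : ℝ) ≤ 196608 * k * (l.choose 3 * (n - (l + 10)).choose (m - 4) : ℕ) := by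
  have hkm : m * k ≤ n := by rw [hm]; exact Nat.div_mul_le_self n k
  have hn : n < k * (m + 1) := by rw [hm]; exact Nat.lt_mul_div_succ n (by omega)
  have hnk : 10 * k ≤ n := (Nat.mul_le_mul_right k hm').trans hkm
  have h1 := pow_three_le_choose_three (by omega) hl
  have h2 := choose_le_pow_mul (by omega : 7 ≤ m) hn
  have h3 := choose_sub_ge (m := m - 4) (n := n) (k := k)
    ((Nat.mul_le_mul_right k (Nat.sub_le m 4)).trans hkm) (l + 10) (by omega)
  have h1 : (k : ℝ) ^ 3 ≤ 3072 * l.choose 3 := by exact_mod_cast h1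
  have h2 : (n.choose m : ℝ) ≤ (2 * k) ^ 4 * n.choose (m - 4) := by exact_mod_cast h2
  -- For `k ≥ 80` the `l + 10` deleted points cost at most three quarters of the binomial. This is
  -- the reason for the threshold.
  have h4 : k ≤ 4 * (k - 2 * (l + 10)) ∧ 2 * (l + 10) ≤ k := by omega
  have h4 : (k : ℝ) ≤ 4 * ((k : ℝ) - 2 * (l + 10 : ℕ)) := by
    have h5 : ((k - 2 * (l + 10) : ℕ) : ℝ) = (k : ℝ) - 2 * (l + 10 : ℕ) := by
      rw [Nat.cast_sub h4.2]; push_cast; ring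
    rw [← h5]; exact_mod_cast h4.1
  have hkpos : (0 : ℝ) < k := by exact_mod_cast (by omega : 0 < k)
  set a : ℝ := ((n.choose (m - 4) : ℕ) : ℝ)
  set b : ℝ := (((n - (l + 10)).choose (m - 4) : ℕ) : ℝ)
  have ha : 0 ≤ a := Nat.cast_nonneg _
  have hb : 0 ≤ b := Nat.cast_nonneg _
  have h5 : a ≤ 4 * b := by
    refine le_of_mul_le_mul_left ?_ hkpos
    have := mul_le_mul_of_nonneg_right h4 ha
    linarith
  push_cast
  -- The constant is `196608 = 2 ^ 4 * 4 * 3072`.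
  calc (n.choose m : ℝ) ≤ (2 * k) ^ 4 * a := h2
    _ ≤ (2 * k) ^ 4 * (4 * b) := by gcongr
    _ = 64 * k * (k ^ 3 * b) := by ring
    _ ≤ 64 * k * (3072 * l.choose 3 * b) := by gcongr
    _ = _ := by ring

open Classical in
/-- The bound on the number of long events. -/
theorem card_longEvents_le_real {x : Fin n → ℝ → Plane} (hx : IsAdmissibleMotion x) (hk : 80 ≤ k) :
    ((Finset.univ.filter fun e : Fin n × Fin n × Fin n =>
        IsLongEvent x (k / 4) e.1 e.2.1 e.2.2).card : ℝ) ≤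
      3000000000 * ((k : ℝ) ^ 2 * maxDelaunayCocircularities (n / k) + k * (n : ℝ) ^ 2) := by
  set m := n / k with hm
  set N := maxDelaunayCocircularities m
  set T := Finset.univ.filter fun e : Fin n × Fin n × Fin n =>
        IsLongEvent x (k / 4) e.1 e.2.1 e.2.2
  have hN : (0 : ℝ) ≤ N := Nat.cast_nonneg _
  have hn0 : (0 : ℝ) ≤ n := Nat.cast_nonneg _
  have hk80 : (80 : ℝ) ≤ k := by exact_mod_cast hk
  have hlt : n < k * (m + 1) := by rw [hm]; exact Nat.lt_mul_div_succ n (by omega)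
  rcases lt_or_ge m 10 with h10 | h10
  -- For samples of fewer than 10 points one has `n ≤ 10 * k`, and the trivial bound `n ^ 3`
  -- suffices.
  · have h1 : T.card ≤ n ^ 3 := by
      refine (Finset.card_le_univ T).trans (le_of_eq ?_)
      simp only [Fintype.card_prod, Fintype.card_fin]
      ring
    have h2 : n ≤ k * 10 := hlt.le.trans (Nat.mul_le_mul_left _ (by omega))
    have h1 : (T.card : ℝ) ≤ n ^ 3 := by exact_mod_cast h1
    have h2 : (n : ℝ) ≤ k * 10 := by exact_mod_cast h2
    have h3 : (n : ℝ) ^ 3 ≤ 10 * (k * n ^ 2) := by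
      have := mul_le_mul_of_nonneg_right h2 (sq_nonneg (n : ℝ))
      nlinarith
    have h4 : 0 ≤ (k : ℝ) ^ 2 * N := by positivity
    have h5 : 0 ≤ (k : ℝ) * n ^ 2 := by positivity
    linarith
  have hkm : m * k ≤ n := by rw [hm]; exact Nat.div_mul_le_self n k
  obtain ⟨c, hc, hc'⟩ := card_longEvents_le hx (l := k / 4) (m := m) (by omega) (by omega) rfl
  have hpat := choose_le_mul_pattern hk rfl hm h10
  set K := (k / 4).choose 3 * (n - (k / 4 + 10)).choose (m - 4)
  set F := 64 * maxDelaunayCocircularities m + 54 * m ^ 2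
  set P := n.choose m
  have hP : 0 < P := Nat.choose_pos (by
    have : m * 1 ≤ m * k := Nat.mul_le_mul_left m (by omega)
    omega)
  obtain ⟨M, hM⟩ : ∃ M, m = M + 4 := ⟨m - 4, by omega⟩
  have hM6 : 6 ≤ M := by omega
  have hM' : m - 4 = M := by omega
  rw [hM'] at hc'
  have hl : k / 4 + 8 ≤ k := by omega
  -- This turns the factor `14 * n / (m - 4)` of the rim changes into `56 * k`.
  have hn4 : n ≤ 4 * k * M := by
    have : k * (m + 1) ≤ k * (4 * M) := Nat.mul_le_mul_left _ (by omega)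
    have h2 : k * (4 * M) = 4 * k * M := by ring
    omega
  have e1 : M * (c * K) ≤ M * (P * (k * (136 * F + 17 * m ^ 2) + (m + 1) * (2 * k) * n + 56 * k * F))
      := by
    refine hc'.trans ?_
    have a1 : 14 * n * (P * F) ≤ 14 * (4 * k * M) * (P * F) := by gcongr
    have a2 : M * (P * ((k / 4 + 8) * (136 * F + 17 * m ^ 2) + (m + 1) * (2 * (k / 4 + 8)) * n)) ≤
        M * (P * (k * (136 * F + 17 * m ^ 2) + (m + 1) * (2 * k) * n)) := by gcongr
    refine (add_le_add a2 a1).trans (le_of_eq ?_)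
    ring
  have e2 := Nat.le_of_mul_le_mul_left e1 (by omega)
  set Y := k * (136 * F + 17 * m ^ 2) + (m + 1) * (2 * k) * n + 56 * k * F with hY
  have e2 : (c : ℝ) * K ≤ P * Y := by exact_mod_cast e2
  have hPR : (0 : ℝ) < P := by exact_mod_cast hP
  have hKR : (0 : ℝ) < K := by
    by_contra hn
    have : (K : ℝ) = 0 := le_antisymm (not_lt.mp hn) (Nat.cast_nonneg _)
    rw [this, mul_zero] at hpat
    linarith
  have e3 : (c : ℝ) ≤ 196608 * k * Y := by
    refine le_of_mul_le_mul_right ?_ hKR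
    have := mul_le_mul_of_nonneg_right hpat (Nat.cast_nonneg (α := ℝ) Y)
    linarith
  have hkmR : (m : ℝ) * k ≤ n := by exact_mod_cast hkm
  have hm1 : (1 : ℝ) ≤ m := by exact_mod_cast (by omega : 1 ≤ m)
  have hsq : ((m : ℝ) * k) ^ 2 ≤ n ^ 2 := by gcongr
  -- The changes contribute `k ^ 2 * N`; everything else is absorbed by `k * n ^ 2` through `m * k ≤
  -- n`.
  have e4 : (k : ℝ) * Y ≤ 12288 * (k ^ 2 * N + k * n ^ 2) := by
    have hYR : (Y : ℝ) = k * (136 * F + 17 * m ^ 2) + (m + 1) * (2 * k) * n + 56 * k * F := by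
      rw [hY]; push_cast; ring
    have hFR : (F : ℝ) = 64 * N + 54 * m ^ 2 := by simp only [F, N]; push_cast; ring
    rw [hYR, hFR]
    have b1 : (k : ℝ) * ((m + 1) * (2 * k) * n) ≤ 4 * k * n ^ 2 := by
      have : ((m : ℝ) + 1) * (2 * k) ≤ 4 * n := by nlinarith
      have h2 : ((m : ℝ) + 1) * (2 * k) * (k * n) ≤ 4 * n * (k * n) := by gcongr
      linarith
    have b2 : 80 * (n : ℝ) ^ 2 ≤ k * n ^ 2 := by gcongr
    have b3 : 0 ≤ (k : ℝ) * n ^ 2 := by positivity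
    nlinarith
  have hcR : (T.card : ℝ) ≤ 17 * n ^ 2 + c := by exact_mod_cast hc
  have b2 : 80 * (n : ℝ) ^ 2 ≤ k * n ^ 2 := by gcongr
  have h4 : 0 ≤ (k : ℝ) ^ 2 * N := by positivity
  linarith

end estimates

/-! ### From chargeable crossings to long events. -/

section charging
variable {n : ℕ} {x : Fin n → ℝ → Plane} {p q r : Fin n} {c₀ k : ℕ} {t₀ t₁ : ℝ}

/-- A chargeable crossing gives rise to a long event, forwards or backwards in time. -/
theorem IsFirstChargeable.isLongEvent (hx : IsAdmissibleMotion x) (hc₀ : c₀ < 8) (hk : 80 ≤ k)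
    (h : IsFirstChargeable x c₀ k p q r t₀ t₁) :
    IsLongEvent x (k / 4) p q r ∨ IsLongEvent (mirrorMotion x) (k / 4) p q r := by
  classical
  obtain ⟨hs, α₀, α₁, h0, h1, d0, d1, ⟨A, hA, hal⟩, hcard⟩ := h
  have hlt := hs.1.lt
  have hmid := hal ((t₀ + t₁) / 2) ⟨by linarith, by linarith⟩
  have halive : ∀ τ ∈ Icc α₀ α₁, DelaunayAt x (Finset.univ \ A) p r τ := by
    intro τ hτ
    rcases hτ.1.eq_or_lt with rfl | h2
    · exact d0.mono (Finset.subset_univ _) hmid.1 hmid.2.1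
    rcases hτ.2.eq_or_lt with rfl | h3
    · exact d1.mono (Finset.subset_univ _) hmid.1 hmid.2.1
    exact hal τ ⟨h2, h3⟩
  set U := {u : Fin n | ∃ s₀ s₁ : ℝ, IsSingleCrossing x u q r s₀ s₁ ∧ Icc s₀ s₁ ⊆ Icc α₀ α₁}
  set Lf := {u | u ≠ p ∧ u ∉ A ∧ ∃ s₀ s₁ : ℝ, IsSingleCrossing x u q r s₀ s₁ ∧ α₀ < s₀ ∧ s₁ < α₁ ∧
      s₀ < t₀}
  set Rt := {u | u ≠ p ∧ u ∉ A ∧ ∃ s₀ s₁ : ℝ, IsSingleCrossing x u q r s₀ s₁ ∧ α₀ < s₀ ∧ s₁ < α₁ ∧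
      t₁ < s₁}
  set B₀ := {u | ∃ s₁ : ℝ, IsSingleCrossing x u q r α₀ s₁}
  set B₁ := {u | ∃ s₀ : ℝ, IsSingleCrossing x u q r s₀ α₁}
  have hB₀ : B₀.ncard ≤ 1 := by
    rw [Set.ncard_le_one]
    rintro u ⟨s, hu⟩ z ⟨s', hz⟩
    by_contra huz
    obtain ⟨t, ht⟩ := hu.exists_hit hx
    obtain ⟨t', ht'⟩ := hz.exists_hit hx
    exact ht.start_ne hx ht' huz rfl
  have hB₁ : B₁.ncard ≤ 1 := by
    rw [Set.ncard_le_one]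
    rintro u ⟨s, hu⟩ z ⟨s', hz⟩
    by_contra huz
    obtain ⟨t, ht⟩ := hu.exists_hit hx
    obtain ⟨t', ht'⟩ := hz.exists_hit hx
    exact ht.end_ne hx ht' huz rfl
  have hsub : U ⊆ (insert p (A : Set (Fin n)) ∪ (B₀ ∪ B₁)) ∪ (Lf ∪ Rt) := by
    rintro u ⟨s₀, s₁, hu, hI⟩
    by_contra hn
    simp only [Set.mem_union, Set.mem_insert_iff, Finset.mem_coe, not_or] at hn
    obtain ⟨⟨⟨hup, huA⟩, hu0, hu1⟩, hL, hR⟩ := hn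
    have hle := hu.1.lt.le
    have i0 := (hI ⟨le_rfl, hle⟩).1
    have i1 := (hI ⟨hle, le_rfl⟩).2
    have i0 : α₀ < s₀ := lt_of_le_of_ne i0 (by rintro rfl; exact hu0 ⟨_, hu⟩)
    have i1 : s₁ < α₁ := lt_of_le_of_ne i1 (by rintro rfl; exact hu1 ⟨_, hu⟩)
    rcases lt_or_ge s₀ t₀ with h2 | h2
    · exact hL ⟨hup, huA, s₀, s₁, hu, i0, i1, h2⟩
    · obtain ⟨t, ht⟩ := hu.exists_hit hx
      obtain ⟨t', ht'⟩ := hs.exists_hit hx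
      exact hR ⟨hup, huA, s₀, s₁, hu, i0, i1,
        ht'.end_lt hx ht (Ne.symm hup) (ht'.lt_of_start_le hx ht (Ne.symm hup) h2)⟩
  have h2 := Set.ncard_le_ncard hsub
  have h3 := Set.ncard_union_le (insert p (A : Set (Fin n)) ∪ (B₀ ∪ B₁)) (Lf ∪ Rt)
  have h4 := Set.ncard_union_le (insert p (A : Set (Fin n))) (B₀ ∪ B₁)
  have h5 := Set.ncard_union_le B₀ B₁
  have h6 := Set.ncard_union_le Lf Rt
  have h7 := Set.ncard_insert_le p (A : Set (Fin n))
  rw [Set.ncard_coe_finset] at h7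
  -- At most 10 of the `k` crossers are lost: `p`, the points of `A`, and one whose interval touches
  -- each end. Half of the rest lie on one side of the crossing.
  have h8 : k / 4 ≤ Lf.ncard ∨ k / 4 ≤ Rt.ncard := by omega
  rcases h8 with h8 | h8
  · exact Or.inl ⟨t₀, t₁, α₀, α₁, A, hs, h0, h1, by omega, halive, d0, h8⟩
  · right
    refine ⟨-t₁, -t₀, -α₁, -α₀, A, isSingleCrossing_mirror.mpr (by simpa using hs), neg_le_neg h1,
      neg_le_neg h0, by omega, fun τ hτ => delaunayAt_mirror.mpr (halive _ ⟨by linarith [hτ.2],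
        by linarith [hτ.1]⟩), delaunayAt_mirror.mpr (by rwa [neg_neg]), ?_⟩
    refine h8.trans (Set.ncard_le_ncard ?_)
    rintro u ⟨hup, huA, s₀, s₁, hu, i0, i1, hlt⟩
    exact ⟨hup, huA, -s₁, -s₀, isSingleCrossing_mirror.mpr (by simpa using hu), neg_lt_neg i1,
      neg_lt_neg i0, neg_lt_neg hlt⟩

theorem IsSecondChargeable.reflect (h : IsSecondChargeable x c₀ k p q r t₀ t₁) :
    IsFirstChargeable (reflectMotion x) c₀ k q p r t₀ t₁ := by
  unfold IsFirstChargeable AlmostDelaunayOn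
  simp only [isSingleCrossing_reflect, delaunayAt_reflect]
  exact h

open Classical in
/-- The long events of a motion and its three symmetric images. -/
theorem chargeableCrossings_ncard_le (hx : IsAdmissibleMotion x) (hc₀ : c₀ < 8) (hk : 80 ≤ k) :
    (chargeableCrossings x c₀ k).Finite ∧ ((chargeableCrossings x c₀ k).ncard : ℝ) ≤
      4 * (3000000000 * ((k : ℝ) ^ 2 * maxDelaunayCocircularities (n / k) + k * (n : ℝ) ^ 2)) := by
  set G : (Fin n → ℝ → Plane) → Finset (Fin n × Fin n × Fin n) := fun y =>
    Finset.univ.filter fun e => IsLongEvent y (k / 4) e.1 e.2.1 e.2.2 with hG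
  set σ : Fin n × Fin n × Fin n → Fin n × Fin n × Fin n := fun e => (e.2.1, e.1, e.2.2)
  set H := (G x ∪ G (mirrorMotion x)) ∪
    ((G (reflectMotion x)).image σ ∪ (G (mirrorMotion (reflectMotion x))).image σ) with hH
  set f : Fin n × Fin n × Fin n × ℝ × ℝ → Fin n × Fin n × Fin n := fun e => (e.1, e.2.1, e.2.2.1)
  have hmaps : ∀ e ∈ chargeableCrossings x c₀ k, f e ∈ (H : Set (Fin n × Fin n × Fin n)) := by
    rintro ⟨p, q, r, t₀, t₁⟩ (h | h)
    · have := h.isLongEvent hx hc₀ hk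
      simp only [hH, hG, f, Finset.mem_coe, Finset.mem_union, Finset.mem_filter, Finset.mem_univ,
        true_and]
      exact Or.inl this
    · have := h.reflect.isLongEvent hx.reflect hc₀ hk
      simp only [hH, Finset.mem_coe, Finset.mem_union, Finset.mem_image]
      right
      rcases this with h | h
      · exact Or.inl ⟨(q, p, r), by simpa [hG] using h, rfl⟩
      · exact Or.inr ⟨(q, p, r), by simpa [hG] using h, rfl⟩
  have hsingle : ∀ e ∈ chargeableCrossings x c₀ k,
      IsSingleCrossing x e.1 e.2.1 e.2.2.1 e.2.2.2.1 e.2.2.2.2 := by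
    rintro e (h | h) <;> exact h.1
  have hinj : Set.InjOn f (chargeableCrossings x c₀ k) := by
    rintro ⟨p, q, r, t₀, t₁⟩ h ⟨p', q', r', t₀', t₁'⟩ h' heq
    simp only [f, Prod.mk.injEq] at heq
    obtain ⟨rfl, rfl, rfl⟩ := heq
    have k1 : IsSingleCrossing x p q r t₀ t₁ := hsingle _ h
    have k2 : IsSingleCrossing x p q r t₀' t₁' := hsingle _ h'
    obtain ⟨rfl, rfl⟩ := k1.unique hx k2
    rfl
  have hfin : (chargeableCrossings x c₀ k).Finite :=
    Set.Finite.of_injOn hmaps hinj H.finite_toSet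
  refine ⟨hfin, ?_⟩
  have h1 := Set.ncard_le_ncard_of_injOn f hmaps hinj H.finite_toSet
  rw [Set.ncard_coe_finset, hH] at h1
  have h2 := Finset.card_union_le (G x ∪ G (mirrorMotion x))
    ((G (reflectMotion x)).image σ ∪ (G (mirrorMotion (reflectMotion x))).image σ)
  have h3 := Finset.card_union_le (G x) (G (mirrorMotion x))
  have h4 := Finset.card_union_le ((G (reflectMotion x)).image σ)
    ((G (mirrorMotion (reflectMotion x))).image σ)
  have h5 := Finset.card_image_le (s := G (reflectMotion x)) (f := σ)
  have h6 := Finset.card_image_le (s := G (mirrorMotion (reflectMotion x))) (f := σ)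
  have h7 : (chargeableCrossings x c₀ k).ncard ≤ (G x).card + (G (mirrorMotion x)).card +
      ((G (reflectMotion x)).card + (G (mirrorMotion (reflectMotion x))).card) := by omega
  have h7 : ((chargeableCrossings x c₀ k).ncard : ℝ) ≤ (G x).card + (G (mirrorMotion x)).card +
      ((G (reflectMotion x)).card + (G (mirrorMotion (reflectMotion x))).card) := by
    exact_mod_cast h7
  have b1 := card_longEvents_le_real hx hk
  have b2 := card_longEvents_le_real hx.mirror hk
  have b3 := card_longEvents_le_real hx.reflect hk
  have b4 := card_longEvents_le_real hx.reflect.mirror hk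
  simp only [hG] at h7
  linarith

end charging

/-- The factor `n / k` in the argument of `N` is rounded down. -/
theorem theorem5 (c₀ : ℕ) (hc₀ : c₀ < 8) :
    ∃ (C : ℝ) (k₀ : ℕ), ∀ k : ℕ, 12 < k → k₀ ≤ k →
      ∀ (n : ℕ) (x : Fin n → ℝ → Plane), IsAdmissibleMotion x →
        (chargeableCrossings x c₀ k).Finite ∧
        ((chargeableCrossings x c₀ k).ncard : ℝ) ≤
          C * ((k : ℝ) ^ 2 * (maxDelaunayCocircularities (n / k) : ℝ)
            + (k : ℝ) * (n : ℝ) ^ 2 * betaDS n) := by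
  refine ⟨12000000000, 80, fun k _ hk n x hx => ?_⟩
  obtain ⟨h1, h2⟩ := chargeableCrossings_ncard_le hx hc₀ hk
  refine ⟨h1, ?_⟩
  -- The bound obtained is `O(k² N(n / k) + k n²)`, without `betaDS`; the factor is put in by `1 ≤
  -- betaDS n`, with `n = 0` treated apart because there `betaDS 0 = 0`.
  have h3 : (k : ℝ) * (n : ℝ) ^ 2 ≤ k * (n : ℝ) ^ 2 * betaDS n := by
    rcases Nat.eq_zero_or_pos n with rfl | hn
    · simp
    · exact le_mul_of_one_le_right (by positivity) (one_le_betaDS hn)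
  linarith
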